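/- Let $\mathcal H=L^2(\mathbb R_+,dp/p)$, and let $(T(a)\psi)(p)=e^{iap}\psi(p)$ ($a\in\mathbb R$), $(J\psi)(p)=\overline{\psi(p)}$, and let $\Delta$ be the positive self-adjoint operator on $\mathcal H$ with $(\Delta^{it}\psi)(p)=\psi(e^{-2\pi t}p)$ for all $t\in\mathbb R$. Put $H=\ker(1-J\Delta^{1/2})$ (this realizes the irreducible one-dimensional standard pair $(H,T)$), let $H'$ be the symplectic complement of $H$ with respect to $\mathrm{Im}\langle\cdot,\cdot\rangle$, and for $I=(a,b)$ with $a<b$ let $H(I)=T(a)H\cap T(b)H'$. For $r>0$ put $I_r=(-r,r)$. For $\psi\in\mathcal H$ let $\psi^{\tt s}(p)=\psi(p)$ for $p>0$ and $\psi^{\tt s}(p)=\overline{\psi(-p)}$ for $p<0$; this defines a tempered distribution on $\mathbb R$. Fourier transforms are $\hat f(p)=(2\pi)^{-1/2}\int f(x)e^{ipx}\,dx$ and $\check u(x)=(2\pi)^{-1/2}\int u(p)e^{-ipx}\,dp$, the latter in the sense of tempered distributions. For every $r>0$ and every $\psi\in\mathcal H$ the following are equivalent: 1. $\psi\in H(I_r)$.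 2. The inverse Fourier transform of $\psi^{\tt s}$ has support in the closed interval $\overline{I_r}=[-r,r]$. 3. $\psi$ extends to an entire function with $\psi(-\bar p)=\overline{\psi(p)}$ and $|\psi(p)|\le C|p|e^{r|\mathrm{Im}\,p|}$ for all $p\in\mathbb C$ and some constant $C>0$. 4. $\psi$ extends to an entire function with $\psi(-\bar p)=\overline{\psi(p)}$ and of exponential type at most $r$, i.e. for every $\varepsilon>0$ there is $C_\varepsilon>0$ with $|\psi(p)|\le C_\varepsilon e^{(r+\varepsilon)|p|}$ for all $p\in\mathbb C$. Moreover, for every bounded open interval $I=(a,b)$, $a<b$: if $\psi\in H(I)$, then $p\mapsto -i\psi(p)/p$ is the restriction to $\mathbb R_+$ of the Fourier transform of a real function in $L^2(\mathbb R,dx)$ with support in $\overline I$. For every real $f\in C_c^\infty(I)$ the function $\widehat{f'}|_{\mathbb R_+}$ lies in $\mathcal H$, and $$K=\{\widehat{f'}|_{\mathbb R_+}: f\in C_c^\infty(I)\ \text{real-valued}\}$$ is contained in $H(I)$ and cyclic, i.e. $K+iK$ is dense in $\mathcal H$. -/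

import Mathlib

open MeasureTheory Set Complex
open scoped ComplexConjugate FourierTransform SchwartzMap ENNReal InnerProductSpace

noncomputable section

namespace LightRay

/-- The measure `dp/p` on the half line `(0, ∞)`. -/
def halfLineMeasure : Measure ℝ :=
  (volume.restrict (Ioi (0 : ℝ))).withDensity fun p => ENNReal.ofReal p⁻¹

/-- The Hilbert space `L²(ℝ₊, dp/p)`. -/
abbrev Hilb : Type := Lp ℂ 2 halfLineMeasure

/-- `θ ↦ e^θ` maps Lebesgue measure `dθ` on `ℝ` to `dp/p` on `(0, ∞)`. -/
theorem measurePreserving_exp : MeasurePreserving Real.exp volume halfLineMeasure := by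
  refine ⟨Real.measurable_exp, ?_⟩
  ext s hs
  rw [Measure.map_apply Real.measurable_exp hs, halfLineMeasure,
    withDensity_apply _ hs, Measure.restrict_restrict hs]
  have himg : Real.exp '' (Real.exp ⁻¹' s) = s ∩ Ioi 0 := by
    rw [image_preimage_eq_inter_range, Real.range_exp]
  rw [← himg, lintegral_image_eq_lintegral_abs_deriv_mul (f' := Real.exp)
    (Real.measurable_exp hs) (fun x _ => (Real.hasDerivAt_exp x).hasDerivWithinAt)
    Real.exp_injective.injOn]
  have : ∀ x : ℝ, ENNReal.ofReal |Real.exp x| * ENNReal.ofReal (Real.exp x)⁻¹ = 1 := by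
    intro x
    rw [← ENNReal.ofReal_mul (abs_nonneg _), abs_of_pos (Real.exp_pos x),
      mul_inv_cancel₀ (Real.exp_pos x).ne', ENNReal.ofReal_one]
  simp only [this]
  simp

theorem memLp_phase_mul (a : ℝ) (ψ : Hilb) :
    MemLp (fun p : ℝ => cexp (I * a * p) * ψ p) 2 halfLineMeasure := by
  refine (Lp.memLp ψ).of_le
    ((by fun_prop : Continuous fun p : ℝ => cexp (I * a * p)).aestronglyMeasurable.mul
      (Lp.aestronglyMeasurable ψ)) (Filter.Eventually.of_forall fun p => ?_)
  have : ‖cexp (I * a * p)‖ = 1 := by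
    rw [Complex.norm_exp]; simp
  rw [norm_mul, this, one_mul]

/-- The translations `(T(a)ψ)(p) = e^{iap} ψ(p)`. -/
def transl (a : ℝ) (ψ : Hilb) : Hilb := (memLp_phase_mul a ψ).toLp _

/-- The modular conjugation `(Jψ)(p) = conj (ψ(p))`. -/
def modConj (ψ : Hilb) : Hilb := star ψ

/-- The unitary from `L²(ℝ₊, dp/p)` to `L²(ℝ, ds)` that diagonalizes dilations: the
change of variables `p = e^θ` followed by the `L²` Fourier transform in `θ` with kernel
`e^{-2πisθ}`. -/
def mellin (ψ : Hilb) : Lp ℂ 2 (volume : Measure ℝ) :=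
  𝓕 (Lp.compMeasurePreserving Real.exp measurePreserving_exp ψ)

/-- `IsModularPower z ψ χ` says that `ψ` lies in the domain of `Δ^z` and `Δ^z ψ = χ`.
Here `Δ` is the positive self-adjoint operator that becomes multiplication by
`e^{-4π²s}` after applying `mellin`, so that `Δ^{it}` is the unitary dilation group
`(Δ^{it}ψ)(p) = ψ(e^{-2πt}p)` (see `isModularPower_I_mul_iff`). -/
def IsModularPower (z : ℂ) (ψ χ : Hilb) : Prop :=
  mellin χ =ᵐ[volume] fun s : ℝ => cexp (-(4 * Real.pi ^ 2 * s) * z) * mellin ψ s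

/-- The standard subspace `H = ker (1 - J Δ^{1/2})`. -/
def standardSubspace : Set Hilb :=
  {ψ | ∃ χ : Hilb, IsModularPower (1 / 2) ψ χ ∧ modConj χ = ψ}

/-- The symplectic complement with respect to the imaginary part of the scalar product. -/
def symplecticComplement (K : Set Hilb) : Set Hilb :=
  {ψ | ∀ χ ∈ K, (⟪ψ, χ⟫_ℂ).im = 0}

/-- The local subspace `H(a, b) = T(a)H ∩ T(b)H'` of the interval `(a, b)`. -/
def localSubspace (a b : ℝ) : Set Hilb :=
  transl a '' standardSubspace ∩ transl b '' symplecticComplement standardSubspace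

/-- A real linear subspace `K` is cyclic if `K + iK` is dense. -/
def IsCyclic (K : Set Hilb) : Prop :=
  Dense {x : Hilb | ∃ ξ ∈ K, ∃ η ∈ K, x = ξ + I • η}

/-- The skew-symmetric extension `ψˢ` of `ψ` to the real line. -/
def skewExt (ψ : Hilb) (p : ℝ) : ℂ :=
  if p < 0 then conj (ψ (-p)) else ψ p

/-- The Fourier transform `f̂(p) = (2π)^{-1/2} ∫ f(x) e^{ipx} dx` of an integrable function. -/
def fourierHat (f : ℝ → ℂ) (p : ℝ) : ℂ :=
  ((Real.sqrt (2 * Real.pi))⁻¹ : ℝ) * ∫ x : ℝ, f x * cexp (I * p * x)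

/-- The Fourier transform of the derivative of a real function. -/
def derivHat (f : ℝ → ℝ) : ℝ → ℂ :=
  fourierHat fun x : ℝ => ((deriv f x : ℝ) : ℂ)

/-- The vectors of `L²(ℝ₊, dp/p)` given by the restrictions of `(f')^` to `(0, ∞)`, where `f` is
a real smooth function with compact support in the open interval `(a, b)`. -/
def testVectors (a b : ℝ) : Set Hilb :=
  {ψ | ∃ f : ℝ → ℝ, ContDiff ℝ (⊤ : ℕ∞) f ∧ HasCompactSupport f ∧ tsupport f ⊆ Ioo a b ∧
    ψ =ᵐ[halfLineMeasure] derivHat f}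

theorem measurePreserving_dilation (t : ℝ) :
    MeasurePreserving (fun p : ℝ => Real.exp (-(2 * Real.pi * t)) * p)
      halfLineMeasure halfLineMeasure := by
  have h1 : MeasurePreserving (fun θ : ℝ => Real.exp (-(2 * Real.pi * t) + θ)) volume
      halfLineMeasure :=
    measurePreserving_exp.comp (measurePreserving_add_left volume (-(2 * Real.pi * t)))
  refine ⟨by fun_prop, ?_⟩
  conv_lhs => rw [← measurePreserving_exp.map_eq]
  rw [Measure.map_map (by fun_prop) Real.measurable_exp, ← h1.map_eq]
  congr 1
  ext θ
  simp [Real.exp_add]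

/-- The dilations `(Δ^{it}ψ)(p) = ψ(e^{-2πt}p)`. -/
def dilation (t : ℝ) (ψ : Hilb) : Hilb :=
  Lp.compMeasurePreserving (fun p : ℝ => Real.exp (-(2 * Real.pi * t)) * p)
    (measurePreserving_dilation t) ψ

theorem fourier_translate (c : ℝ) (g : Lp ℂ 2 (volume : Measure ℝ)) :
    (𝓕 (Lp.compMeasurePreserving (fun θ : ℝ => c + θ) (measurePreserving_add_left volume c) g) :
      Lp ℂ 2 (volume : Measure ℝ)) =ᵐ[volume]
      fun s : ℝ => cexp (2 * Real.pi * I * s * c) * (𝓕 g : Lp ℂ 2 (volume : Measure ℝ)) s := by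
  have hu : ∀ s : ℝ, ‖cexp (2 * Real.pi * I * s * c)‖ = 1 := fun s => by
    rw [Complex.norm_exp]; simp
  have hmem : ∀ h : Lp ℂ 2 (volume : Measure ℝ),
      MemLp (fun s : ℝ => cexp (2 * Real.pi * I * s * c) * h s) 2 volume := fun h => by
    refine (Lp.memLp h).of_le
      ((by fun_prop : Continuous fun s : ℝ =>
        cexp (2 * Real.pi * I * s * c)).aestronglyMeasurable.mul
        (Lp.aestronglyMeasurable h)) (Filter.Eventually.of_forall fun s => ?_)
    rw [norm_mul, hu, one_mul]
  have hiso : Isometry fun h : Lp ℂ 2 (volume : Measure ℝ) => (hmem h).toLp _ := by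
    refine Isometry.of_dist_eq fun h k => ?_
    rw [dist_eq_norm, dist_eq_norm, Lp.norm_def, Lp.norm_def]
    congr 1
    refine eLpNorm_congr_norm_ae ?_
    filter_upwards [Lp.coeFn_sub ((hmem h).toLp _) ((hmem k).toLp _), Lp.coeFn_sub h k,
      (hmem h).coeFn_toLp, (hmem k).coeFn_toLp] with s h1 h2 h3 h4
    rw [h1, h2, Pi.sub_apply, Pi.sub_apply, h3, h4, ← mul_sub, norm_mul, hu, one_mul]
  suffices h : 𝓕 (Lp.compMeasurePreserving (fun θ : ℝ => c + θ)
      (measurePreserving_add_left volume c) g) =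
      (hmem (𝓕 g : Lp ℂ 2 (volume : Measure ℝ))).toLp _ by
    rw [h]
    exact (hmem _).coeFn_toLp
  refine DenseRange.induction_on
    (SchwartzMap.denseRange_toLpCLM (p := 2) ENNReal.ofNat_ne_top) g ?_ ?_
  · apply isClosed_eq
    · exact (Lp.fourierTransformₗᵢ ℝ ℂ).continuous.comp
        (Lp.isometry_compMeasurePreserving _).continuous
    · exact hiso.continuous.comp (Lp.fourierTransformₗᵢ ℝ ℂ).continuous
  · intro f
    have h1 : Lp.compMeasurePreserving (fun θ : ℝ => c + θ) (measurePreserving_add_left volume c)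
        (SchwartzMap.toLpCLM ℝ ℂ 2 volume f) =
        (SchwartzMap.compSubConstCLM ℂ (-c) f).toLp 2 := by
      refine Lp.ext ?_
      refine (Lp.coeFn_compMeasurePreserving _ _).trans ?_
      have h2 := (measurePreserving_add_left (volume : Measure ℝ) c).quasiMeasurePreserving.ae_eq_comp
        (f.coeFn_toLp 2 volume)
      refine h2.trans ?_
      refine Filter.EventuallyEq.trans ?_ (SchwartzMap.coeFn_toLp _ 2 volume).symm
      refine Filter.Eventually.of_forall fun s => ?_
      simp [add_comm]
    rw [h1, SchwartzMap.toLp_fourier_eq]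
    refine Lp.ext ?_
    refine (SchwartzMap.coeFn_toLp _ 2 volume).trans ?_
    refine Filter.EventuallyEq.trans ?_ (hmem _).coeFn_toLp.symm
    rw [SchwartzMap.toLpCLM_apply, SchwartzMap.toLp_fourier_eq]
    filter_upwards [SchwartzMap.coeFn_toLp (𝓕 f) 2 volume] with s hs
    rw [hs, SchwartzMap.fourier_coe, SchwartzMap.fourier_coe,
      Real.fourier_real_eq_integral_exp_smul, Real.fourier_real_eq_integral_exp_smul,
      ← integral_const_mul]
    rw [← integral_add_right_eq_self _ (-c)]
    refine integral_congr_ae (Filter.Eventually.of_forall fun x => ?_)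
    simp only [SchwartzMap.compSubConstCLM_apply, smul_eq_mul, ← mul_assoc, ← Complex.exp_add]
    congr 2
    · push_cast; ring
    · ring_nf

theorem mellin_dilation (t : ℝ) (ψ : Hilb) : IsModularPower (I * t) ψ (dilation t ψ) := by
  have h : Lp.compMeasurePreserving Real.exp measurePreserving_exp (dilation t ψ) =
      Lp.compMeasurePreserving (fun θ : ℝ => -(2 * Real.pi * t) + θ)
        (measurePreserving_add_left volume _)
        (Lp.compMeasurePreserving Real.exp measurePreserving_exp ψ) := by
    rw [dilation, ← Lp.compMeasurePreserving_comp_apply, ← Lp.compMeasurePreserving_comp_apply]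
    have : (fun p : ℝ => Real.exp (-(2 * Real.pi * t)) * p) ∘ Real.exp =
        Real.exp ∘ fun θ : ℝ => -(2 * Real.pi * t) + θ := by
      ext θ
      simp [Real.exp_add]
    simp only [this]
  rw [IsModularPower, mellin, h]
  filter_upwards [fourier_translate (-(2 * Real.pi * t))
    (Lp.compMeasurePreserving Real.exp measurePreserving_exp ψ)] with s hs
  rw [hs, mellin]
  congr 2
  push_cast
  ring

theorem mellin_injective : Function.Injective mellin := by
  intro ψ χ h
  have h1 := (Lp.fourierTransformₗᵢ ℝ ℂ).injective h
  exact (Lp.isometry_compMeasurePreserving measurePreserving_exp).injective h1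

/-- The imaginary powers `Δ^{it}` are the dilations. -/
theorem isModularPower_I_mul_iff (t : ℝ) (ψ χ : Hilb) :
    IsModularPower (I * t) ψ χ ↔ χ = dilation t ψ := by
  refine ⟨fun h => mellin_injective (Lp.ext (h.trans (mellin_dilation t ψ).symm)), ?_⟩
  rintro rfl
  exact mellin_dilation t ψ

theorem memLp_div_add_I (ψ : Hilb) :
    MemLp (fun p : ℝ => ((p : ℂ) + I)⁻¹ * ψ p) 2 (volume.restrict (Ioi (0 : ℝ))) := by
  have hac : (volume.restrict (Ioi (0 : ℝ))) ≪ halfLineMeasure := by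
    refine withDensity_absolutelyContinuous' (by fun_prop) ?_
    filter_upwards [ae_restrict_mem measurableSet_Ioi] with p hp
    simpa using hp
  have hm : AEStronglyMeasurable (ψ : ℝ → ℂ) (volume.restrict (Ioi (0 : ℝ))) :=
    (Lp.aestronglyMeasurable ψ).mono_ac hac
  have hc : Measurable fun p : ℝ => ((p : ℂ) + I)⁻¹ := by fun_prop
  refine ⟨hc.aestronglyMeasurable.mul hm, ?_⟩
  have hψ := (Lp.memLp ψ).2
  rw [eLpNorm_lt_top_iff_lintegral_rpow_enorm_lt_top (by norm_num) (by norm_num)] at hψ ⊢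
  refine lt_of_le_of_lt ?_ hψ
  refine le_of_le_of_eq ?_ (lintegral_withDensity_eq_lintegral_mul₀' (by fun_prop)
    ((Lp.aestronglyMeasurable ψ).enorm.pow_const _)).symm
  refine lintegral_mono_ae ?_
  filter_upwards [ae_restrict_mem measurableSet_Ioi] with p hp
  have hp : 0 < p := hp
  simp only [Pi.mul_apply, ENNReal.toReal_ofNat, enorm_mul]
  rw [ENNReal.mul_rpow_of_nonneg _ _ (by norm_num)]
  gcongr
  rw [← ofReal_norm, ENNReal.ofReal_rpow_of_nonneg (norm_nonneg _) (by norm_num)]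
  refine ENNReal.ofReal_le_ofReal ?_
  have h2 : ‖(p : ℂ) + I‖ ^ 2 = p ^ 2 + 1 := by
    rw [← Complex.normSq_eq_norm_sq, Complex.normSq_apply]
    simp
    ring
  rw [norm_inv, Real.rpow_ofNat, inv_pow, h2]
  gcongr
  nlinarith [sq_nonneg (p - 1)]

theorem memLp_skewExt_div (ψ : Hilb) :
    MemLp (fun p : ℝ => ((p : ℂ) + I)⁻¹ * skewExt ψ p) 2 volume := by
  have h1 := memLp_div_add_I ψ
  have h3 : MemLp (fun p : ℝ => ((p : ℂ) + I)⁻¹ * skewExt ψ p) 2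
      (volume.restrict (Iio (0 : ℝ))) := by
    have hmp : MeasurePreserving (fun p : ℝ => -p) (volume.restrict (Iio (0 : ℝ)))
        (volume.restrict (Ioi (0 : ℝ))) := by
      have := (Measure.measurePreserving_neg (volume : Measure ℝ)).restrict_preimage
        (measurableSet_Ioi (a := (0 : ℝ)))
      simpa using this
    have h4 := (h1.comp_measurePreserving hmp).star.neg
    refine h4.ae_eq ?_
    filter_upwards [ae_restrict_mem measurableSet_Iio] with p hp
    have hp : p < 0 := hp
    simp only [skewExt, hp, if_true, Pi.neg_apply, Pi.star_apply, Function.comp_apply, star_mul']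
    rw [← neg_mul]
    congr 1
    simp only [RCLike.star_def, map_inv₀, map_add, Complex.conj_ofReal, Complex.conj_I]
    rw [← inv_neg]
    congr 1
    push_cast
    ring
  have h5 : MemLp (fun p : ℝ => ((p : ℂ) + I)⁻¹ * skewExt ψ p) 2
      (volume.restrict (Ici (0 : ℝ))) := by
    rw [← restrict_Ioi_eq_restrict_Ici]
    refine h1.ae_eq ?_
    filter_upwards [ae_restrict_mem measurableSet_Ioi] with p hp
    have hp : 0 < p := hp
    simp [skewExt, hp.not_gt]
  rw [← memLp_indicator_iff_restrict measurableSet_Iio] at h3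
  rw [← memLp_indicator_iff_restrict measurableSet_Ici] at h5
  have h6 := h3.add h5
  rwa [← compl_Iio, indicator_self_add_compl] at h6

/-- `ψˢ` as a tempered distribution; `skewDistribution_apply` shows that it is the usual
`φ ↦ ∫ φ(p) ψˢ(p) dp`. It is written as `(p + i)` times the `L²` function `ψˢ(p) / (p + i)`. -/
def skewDistribution (ψ : Hilb) : 𝓢'(ℝ, ℂ) :=
  TemperedDistribution.smulLeftCLM ℂ (fun p : ℝ => (p : ℂ) + I)
    (Lp.toTemperedDistribution ((memLp_skewExt_div ψ).toLp _))

theorem skewDistribution_apply (ψ : Hilb) (φ : 𝓢(ℝ, ℂ)) :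
    skewDistribution ψ φ = ∫ p : ℝ, φ p * skewExt ψ p := by
  have ht : (fun p : ℝ => (p : ℂ) + I).HasTemperateGrowth :=
    Function.HasTemperateGrowth.add (Complex.ofRealCLM).hasTemperateGrowth (Function.HasTemperateGrowth.const I)
  rw [skewDistribution, TemperedDistribution.smulLeftCLM_apply_apply,
    Lp.toTemperedDistribution_apply]
  refine integral_congr_ae ?_
  filter_upwards [(memLp_skewExt_div ψ).coeFn_toLp] with p hp
  have hne : (p : ℂ) + I ≠ 0 := fun h => by
    have := congrArg Complex.im h
    simp at this
  rw [hp, SchwartzMap.smulLeftCLM_apply_apply ht, smul_eq_mul, smul_eq_mul]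
  field_simp

/-- The continuous linear map `φ ↦ φ̌`, `φ̌(p) = (2π)^{-1/2} ∫ φ(x) e^{-ixp} dx`, on Schwartz
functions (see `schwartzCheck_apply`). -/
def schwartzCheck : 𝓢(ℝ, ℂ) →L[ℂ] 𝓢(ℝ, ℂ) :=
  (((Real.sqrt (2 * Real.pi))⁻¹ : ℝ) : ℂ) •
    (SchwartzMap.compCLMOfContinuousLinearEquiv ℂ
      (ContinuousLinearEquiv.smulLeft (Units.mk0 ((2 * Real.pi)⁻¹ : ℝ) (by positivity))) ∘L
        FourierTransform.fourierCLM ℂ 𝓢(ℝ, ℂ))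

theorem schwartzCheck_apply (φ : 𝓢(ℝ, ℂ)) (p : ℝ) :
    schwartzCheck φ p =
      ((Real.sqrt (2 * Real.pi))⁻¹ : ℝ) * ∫ x : ℝ, φ x * cexp (-(I * x * p)) := by
  change (((Real.sqrt (2 * Real.pi))⁻¹ : ℝ) : ℂ) * (𝓕 φ) ((2 * Real.pi)⁻¹ * p) = _
  rw [SchwartzMap.fourier_coe, Real.fourier_real_eq_integral_exp_smul]
  congr 1
  refine integral_congr_ae (Filter.Eventually.of_forall fun x => ?_)
  simp only [smul_eq_mul]
  rw [mul_comm]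
  congr 2
  have : (Real.pi : ℂ) ≠ 0 := by exact_mod_cast Real.pi_ne_zero
  push_cast
  field_simp

/-- The inverse Fourier transform `ǔ(φ) = u(φ̌)` of a tempered distribution, corresponding to
`ǔ(x) = (2π)^{-1/2} ∫ u(p) e^{-ipx} dp`. -/
def invFourier (u : 𝓢'(ℝ, ℂ)) : 𝓢'(ℝ, ℂ) :=
  PointwiseConvergenceCLM.precomp ℂ schwartzCheck u

/-- `F` is an entire function that extends `ψ` and satisfies `F(-p̄) = conj (F(p))`. -/
def IsSymmetricEntireExtension (ψ : Hilb) (F : ℂ → ℂ) : Prop :=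
  Differentiable ℂ F ∧ (∀ᵐ p : ℝ ∂halfLineMeasure, F p = ψ p) ∧ ∀ p : ℂ, F (-conj p) = conj (F p)

end LightRay

end

noncomputable section

namespace LightRay

open Filter Topology

/-! The bridge between locality and distributions is the pairing with test vectors. For real `f` the
factor `-ip` in the transform of `f'` cancels the weight `1/p` of the measure, and the skew symmetry
of `ψˢ` gives `∫ f̌ ψˢ = 2 Im ⟪(f')^, ψ⟫` (`integral_entireHat_neg_mul_skewExt`). Thus the inverse
transform of `ψˢ` vanishes on an open set exactly when `ψ` is symplectically orthogonal to the test
vectors supported there.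

Membership in `H` follows from analyticity. With `p = e^θ`, the operator `Δ^{1/2}` continues `θ` to
`θ + iπ`, that is, `p` to `-p` through the upper half plane. A function holomorphic there with
`h(-p) = conj h(p)` on the real line therefore gives a vector of `H`, by a contour shift if it
decays (`mem_standardSubspace_of_decay`) and by closedness of `H` if it grows linearly
(`mem_standardSubspace_of_entire`). Conjugation by `J` exchanges the half planes, and `JH ⊆ H'`
because `Δ^{1/2}` is symmetric. Hence the bounds in the two half planes place a vector in `T(a)H`
and `T(b)H'`. This gives 3 ⇒ 1 and the locality of test vectors, and the latter gives 1 ⇒ 2.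

For 2 ⇒ 3, `ψˢ/(p+i)` lies in `L²`. Its inverse transform `G` satisfies `G' = -G` off `[-r,r]`, so
it is zero on the left and `C e^{-x}` on the right. The tail transforms to an explicit function
whose pole at `-i` is removed on multiplying by `p+i`, and the compact part is entire. Integrability
of `|ψ|²/p` forces a zero at the origin, which sharpens the growth `1+|p|` to `|p|`.

For 4 ⇒ 3 there is no pointwise bound on the real axis, but the primitive of `F` grows at most
linearly there. Phragmén–Lindelöf bounds the primitive, and Cauchy's estimate returns to `F`.

The real `L²` function comes from repeating the support argument with `-iF(p)/p`: its inverse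
transform is locally constant outside the interval, hence zero there. For cyclicity, a vector
orthogonal to all small translates of one bump yields an integrable function on the half line whose
transform vanishes on an interval. Boundary uniqueness in the upper half plane kills it. -/

/-! ### Fourier transforms and duality with Schwartz functions -/

theorem integrable_schwartz_mul_of_memLp (φ : 𝓢(ℝ, ℂ)) {v : ℝ → ℂ} (hv : MemLp v 2 volume) :
    Integrable fun x => φ x * v x := by
  simpa using! (φ.memLp 2 volume).integrable_mul hv

/-- A smooth compactly supported real function as a complex Schwartz function. -/
def testSchwartz (g : ℝ → ℝ) (hg : ContDiff ℝ (⊤ : ℕ∞) g) (hc : HasCompactSupport g) : 𝓢(ℝ, ℂ) :=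
  (hc.comp_left (g := ofReal) ofReal_zero).toSchwartzMap (ofRealCLM.contDiff.comp hg)

theorem testSchwartz_apply (g : ℝ → ℝ) (hg : ContDiff ℝ (⊤ : ℕ∞) g) (hc : HasCompactSupport g)
    (x : ℝ) : testSchwartz g hg hc x = g x := rfl

theorem ae_eq_of_forall_schwartz {v w : ℝ → ℂ} (hv : LocallyIntegrable v)
    (hw : LocallyIntegrable w) (h : ∀ φ : 𝓢(ℝ, ℂ), ∫ x, φ x * v x = ∫ x, φ x * w x) :
    v =ᵐ[volume] w :=
  ae_eq_of_integral_contDiff_smul_eq hv hw fun g hg hc => by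
    simpa [testSchwartz_apply] using h (testSchwartz g hg hc)

theorem integral_schwartz_mul_fourier (φ : 𝓢(ℝ, ℂ)) {f : ℝ → ℂ} (hf : Integrable f) :
    ∫ x, φ x * 𝓕 f x = ∫ x, (𝓕 φ) x * f x := by
  have := VectorFourier.integral_fourierIntegral_smul_eq_flip (L := innerₗ ℝ)
    Real.continuous_fourierChar continuous_inner (φ.integrable (μ := volume)) hf
  rw [flip_innerₗ] at this
  exact this.symm

theorem integral_schwartz_mul_fourierInv (φ : 𝓢(ℝ, ℂ)) {f : ℝ → ℂ} (hf : Integrable f) :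
    ∫ x, φ x * 𝓕⁻ f x = ∫ x, (𝓕⁻ φ) x * f x := by
  have h1 := integral_schwartz_mul_fourier φ hf.comp_neg
  have h2 : (𝓕 fun x => f (-x)) = 𝓕⁻ f := (Real.fourierInv_eq_fourier_comp_neg f).symm
  rw [h2] at h1
  rw [h1, ← integral_neg_eq_self]
  refine integral_congr_ae (Filter.Eventually.of_forall fun x => ?_)
  simp only [neg_neg]
  rw [SchwartzMap.fourier_coe, SchwartzMap.fourierInv_coe, Real.fourierInv_eq_fourier_neg]

theorem continuous_fourier_of_integrable {f : ℝ → ℂ} (hf : Integrable f) : Continuous (𝓕 f) :=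
  VectorFourier.fourierIntegral_continuous Real.continuous_fourierChar
    (by exact continuous_inner) hf

/-- The `L²` transform is abstract; it agrees with the integral because both define the same
tempered distribution. -/
theorem coeFn_fourier_of_integrable {f : Lp ℂ 2 (volume : Measure ℝ)} (hf : Integrable f) :
    (𝓕 f : Lp ℂ 2 (volume : Measure ℝ)) =ᵐ[volume] 𝓕 (f : ℝ → ℂ) := by
  refine ae_eq_of_forall_schwartz ((Lp.memLp _).locallyIntegrable (by norm_num))
    (continuous_fourier_of_integrable hf).locallyIntegrable fun φ => ?_
  rw [integral_schwartz_mul_fourier φ hf]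
  have := congrArg (fun u : 𝓢'(ℝ, ℂ) => u φ) (Lp.fourier_toTemperedDistribution_eq f)
  simpa [TemperedDistribution.fourier_apply, Lp.toTemperedDistribution_apply] using this.symm

theorem coeFn_fourierInv_of_integrable {f : Lp ℂ 2 (volume : Measure ℝ)} (hf : Integrable f) :
    (𝓕⁻ f : Lp ℂ 2 (volume : Measure ℝ)) =ᵐ[volume] 𝓕⁻ (f : ℝ → ℂ) := by
  have hc : Continuous (𝓕⁻ (f : ℝ → ℂ)) := by
    rw [Real.fourierInv_eq_fourier_comp_neg]
    exact continuous_fourier_of_integrable hf.comp_neg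
  refine ae_eq_of_forall_schwartz ((Lp.memLp _).locallyIntegrable (by norm_num))
    hc.locallyIntegrable fun φ => ?_
  rw [integral_schwartz_mul_fourierInv φ hf]
  have := congrArg (fun u : 𝓢'(ℝ, ℂ) => u φ) (Lp.fourierInv_toTemperedDistribution_eq f)
  simpa [TemperedDistribution.fourierInv_apply, Lp.toTemperedDistribution_apply] using this.symm

theorem ae_eq_zero_of_fourier_eq_zero {v : ℝ → ℂ} (hv : Integrable v) (h : ∀ x, 𝓕 v x = 0) :
    v =ᵐ[volume] 0 := by
  refine ae_eq_of_forall_schwartz hv.locallyIntegrable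
    (w := 0) locallyIntegrable_zero fun φ => ?_
  have := integral_schwartz_mul_fourier (𝓕⁻ φ) hv
  simp only [h, mul_zero, integral_zero, FourierTransform.fourier_fourierInv_eq] at this
  simpa using this.symm

theorem fourierHat_eq_fourierInv (f : ℝ → ℂ) (p : ℝ) :
    fourierHat f p = ((Real.sqrt (2 * Real.pi))⁻¹ : ℝ) * 𝓕⁻ f ((2 * Real.pi)⁻¹ * p) := by
  rw [fourierHat, Real.fourierInv_eq']
  congr 1
  refine integral_congr_ae (Filter.Eventually.of_forall fun x => ?_)
  have : (Real.pi : ℂ) ≠ 0 := by exact_mod_cast Real.pi_ne_zero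
  simp only [smul_eq_mul, RCLike.inner_apply, conj_trivial]
  rw [mul_comm]
  congr 2
  push_cast
  field_simp

theorem memLp_comp_mul {P : ℝ → ℂ} (hP : MemLp P 2 volume) {c : ℝ} (hc : c ≠ 0) :
    MemLp (fun x => P (c * x)) 2 volume := by
  have h := Real.map_volume_mul_left hc
  have h2 : MemLp P 2 (Measure.map (c * ·) volume) := by
    rw [h]; exact hP.smul_measure ENNReal.ofReal_ne_top
  exact h2.comp_of_map (by fun_prop)

/-- The inverse Fourier transform of a square integrable function, characterized by duality. -/
theorem exists_memLp_schwartzCheck {P : ℝ → ℂ} (hP : MemLp P 2 volume) :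
    ∃ G : ℝ → ℂ, MemLp G 2 volume ∧
      (∀ φ : 𝓢(ℝ, ℂ), ∫ x, φ x * G x = ∫ p, schwartzCheck φ p * P p) ∧
      (Integrable G → P =ᵐ[volume] fourierHat G) := by
  have hpi : (2 * Real.pi) ≠ 0 := by positivity
  set s : ℝ := Real.sqrt (2 * Real.pi) with hs
  have hs0 : (s : ℂ) ≠ 0 := by
    have : 0 < s := Real.sqrt_pos.mpr (by positivity)
    exact_mod_cast this.ne'
  -- Rescaling by `2π` passes between the kernels `e^{-2πixp}` and `e^{-ixp}`; the factor `√(2π)` in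
  -- `g` restores the normalization.
  have hQ := memLp_comp_mul hP hpi
  set Q : Lp ℂ 2 (volume : Measure ℝ) := hQ.toLp _ with hQd
  set g : Lp ℂ 2 (volume : Measure ℝ) := (s : ℂ) • 𝓕 Q with hg
  refine ⟨g, Lp.memLp g, fun φ => ?_, fun hint => ?_⟩
  · have h1 : ∫ x, φ x * (𝓕 Q : Lp ℂ 2 (volume : Measure ℝ)) x = ∫ x, (𝓕 φ) x * Q x := by
      have := congrArg (fun u : 𝓢'(ℝ, ℂ) => u φ) (Lp.fourier_toTemperedDistribution_eq Q)
      simpa [TemperedDistribution.fourier_apply, Lp.toTemperedDistribution_apply] using this.symm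
    have h2 : ∫ x, φ x * g x = s * ∫ x, φ x * (𝓕 Q : Lp ℂ 2 (volume : Measure ℝ)) x := by
      rw [← integral_const_mul]
      refine integral_congr_ae ?_
      filter_upwards [Lp.coeFn_smul (s : ℂ) (𝓕 Q)] with x hx
      rw [hg, hx, Pi.smul_apply, smul_eq_mul]; ring
    have h3 : ∫ x, (𝓕 φ) x * Q x = ∫ x, (𝓕 φ) x * P (2 * Real.pi * x) := by
      refine integral_congr_ae ?_
      filter_upwards [hQ.coeFn_toLp] with x hx
      rw [hx]
    have h4 : ∫ p, schwartzCheck φ p * P p =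
        |2 * Real.pi| • ∫ x, schwartzCheck φ (2 * Real.pi * x) * P (2 * Real.pi * x) := by
      rw [Measure.integral_comp_mul_left (fun p => schwartzCheck φ p * P p), smul_smul, abs_inv,
        mul_inv_cancel₀ (abs_ne_zero.mpr hpi), one_smul]
    have h5 : ∀ x, schwartzCheck φ (2 * Real.pi * x) * P (2 * Real.pi * x) =
        (s : ℂ)⁻¹ * ((𝓕 φ) x * P (2 * Real.pi * x)) := by
      intro x
      have : schwartzCheck φ (2 * Real.pi * x) =
        ((s⁻¹ : ℝ) : ℂ) * (𝓕 φ) ((2 * Real.pi)⁻¹ * (2 * Real.pi * x)) := rfl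
      rw [this, inv_mul_cancel_left₀ hpi, ofReal_inv, mul_assoc]
    have h6 : |2 * Real.pi| = s * s := by
      rw [abs_of_pos (by positivity), hs, Real.mul_self_sqrt (by positivity)]
    rw [h2, h1, h3, h4, integral_congr_ae (Filter.Eventually.of_forall h5), integral_const_mul, h6,
      Complex.real_smul]
    push_cast
    field_simp
  · have h1 := coeFn_fourierInv_of_integrable hint
    have h2 : 𝓕⁻ g = (s : ℂ) • Q := by
      have : 𝓕⁻ ((s : ℂ) • 𝓕 Q) = (s : ℂ) • 𝓕⁻ (𝓕 Q) :=
        (Lp.fourierTransformₗᵢ ℝ ℂ).symm.map_smul _ _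
      rw [hg, this, FourierTransform.fourierInv_fourier_eq]
    rw [h2] at h1
    have h3 : ∀ᵐ x : ℝ, P (2 * Real.pi * x) = (s⁻¹ : ℝ) * 𝓕⁻ (g : ℝ → ℂ) x := by
      filter_upwards [h1, Lp.coeFn_smul (s : ℂ) Q, hQ.coeFn_toLp] with x hx h4 h5
      rw [← hx, h4, Pi.smul_apply, smul_eq_mul, hQd, h5]
      push_cast
      field_simp
    have hq : Measure.QuasiMeasurePreserving (fun p : ℝ => (2 * Real.pi)⁻¹ * p) volume volume := by
      refine ⟨by fun_prop, ?_⟩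
      rw [Real.map_volume_mul_left (inv_ne_zero hpi)]
      exact Measure.smul_absolutelyContinuous
    filter_upwards [hq.ae h3] with p hp
    rw [mul_inv_cancel_left₀ hpi] at hp
    rw [hp, fourierHat_eq_fourierInv]

/-! ### Distributions with vanishing derivative on an interval -/

/-- The primitive starting at the left end of the support vanishes beyond the right end because the
mean is zero. Order-connectedness keeps the hull of the support inside `U`. -/
theorem exists_antideriv_of_integral_eq_zero {U : Set ℝ} (hc : U.OrdConnected) {g : ℝ → ℝ}
    (hg : ContDiff ℝ (⊤ : ℕ∞) g) (hs : HasCompactSupport g) (hU : tsupport g ⊆ U)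
    (h0 : ∫ x, g x = 0) :
    ∃ χ : ℝ → ℝ, ContDiff ℝ (⊤ : ℕ∞) χ ∧ HasCompactSupport χ ∧ tsupport χ ⊆ U ∧ deriv χ = g := by
  rcases (tsupport g).eq_empty_or_nonempty with he | hne
  · rw [tsupport_eq_empty_iff] at he
    subst he
    exact ⟨0, contDiff_const, HasCompactSupport.zero, by simp, by ext; simp⟩
  have hK : IsCompact (tsupport g) := hs
  set α := sInf (tsupport g)
  set β := sSup (tsupport g)
  have hα : α ∈ U := hU (hK.sInf_mem hne)
  have hβ : β ∈ U := hU (hK.sSup_mem hne)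
  have hsub : tsupport g ⊆ Icc α β := fun x hx =>
    ⟨csInf_le hK.bddBelow hx, le_csSup hK.bddAbove hx⟩
  have hsub2 : Function.support g ⊆ Ioo α β := by
    rw [← interior_Icc]
    exact interior_maximal ((subset_tsupport g).trans hsub) hg.continuous.isOpen_support
  have hder : ∀ x, HasDerivAt (fun y => ∫ t in α..y, g t) (g x) x := fun x =>
    intervalIntegral.integral_hasDerivAt_right (hg.continuous.intervalIntegrable _ _)
      (hg.continuous.stronglyMeasurableAtFilter _ _) hg.continuous.continuousAt
  have hder' : deriv (fun y => ∫ t in α..y, g t) = g := funext fun x => (hder x).deriv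
  have hsupp : Function.support (fun y => ∫ t in α..y, g t) ⊆ Icc α β := by
    intro x hx
    by_contra hcon
    apply hx
    rcases lt_or_ge x α with h | h
    · simp only
      rw [intervalIntegral.integral_symm, neg_eq_zero]
      refine intervalIntegral.integral_zero_ae (Filter.Eventually.of_forall fun t ht => ?_)
      rw [uIoc_of_le h.le] at ht
      by_contra hgt
      exact absurd (hsub2 hgt).1 ht.2.not_gt
    · have hx : β < x := by
        by_contra h2
        exact hcon ⟨h, not_lt.mp h2⟩
      simp only
      rw [intervalIntegral.integral_eq_integral_of_support_subset, h0]
      exact hsub2.trans fun y hy => ⟨hy.1, (hy.2.trans hx).le⟩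
  refine ⟨fun y => ∫ t in α..y, g t, ?_, HasCompactSupport.of_support_subset_isCompact isCompact_Icc
    hsupp, (closure_minimal hsupp isClosed_Icc).trans (hc.out hα hβ), hder'⟩
  rw [contDiff_infty_iff_deriv]
  exact ⟨fun x => (hder x).differentiableAt, by rw [hder']; exact hg⟩

/-- A function whose distributional derivative vanishes on an open interval is constant there. -/
theorem ae_const_of_integral_deriv_eq_zero {U : Set ℝ} (hU : IsOpen U) (hc : U.OrdConnected)
    {v : ℝ → ℂ} (hv : LocallyIntegrable v)
    (h : ∀ g : ℝ → ℝ, ContDiff ℝ (⊤ : ℕ∞) g → HasCompactSupport g → tsupport g ⊆ U →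
      ∫ x, ((deriv g x : ℝ) : ℂ) * v x = 0) :
    ∃ C : ℂ, ∀ᵐ x : ℝ, x ∈ U → v x = C := by
  rcases U.eq_empty_or_nonempty with he | ⟨x₀, hx₀⟩
  · exact ⟨0, Filter.Eventually.of_forall fun x hx => by simp [he] at hx⟩
  obtain ⟨ε, hε, hball⟩ := Metric.isOpen_iff.mp hU x₀ hx₀
  let B : ContDiffBump x₀ := ⟨ε / 4, ε / 2, by positivity, by linarith⟩
  -- A fixed bump of mass one inside `U`. Any test function `φ` minus `(∫ φ) η` has mean zero, hence
  -- is a derivative of a test function in `U`, so `v` and the constant `∫ η v` pair equally with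
  -- `φ`.
  set η : ℝ → ℝ := B.normed volume with hη
  have hη1 : ContDiff ℝ (⊤ : ℕ∞) η := B.contDiff_normed
  have hη2 : HasCompactSupport η := B.hasCompactSupport_normed
  have hη3 : tsupport η ⊆ U := by
    rw [hη, B.tsupport_normed_eq]
    exact (Metric.closedBall_subset_ball (by change ε / 2 < ε; linarith)).trans hball
  have hη4 : ∫ x, η x = 1 := B.integral_normed
  have hint : ∀ g : ℝ → ℝ, ContDiff ℝ (⊤ : ℕ∞) g → HasCompactSupport g →
      Integrable fun x => (g x : ℂ) * v x := fun g hg hs => by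
    have := hv.integrable_smul_left_of_hasCompactSupport hg.continuous hs
    simpa using this
  refine ⟨∫ x, (η x : ℂ) * v x, ?_⟩
  set C := ∫ x, (η x : ℂ) * v x with hC
  have key := hU.ae_eq_zero_of_integral_contDiff_smul_eq_zero (f := fun x => v x - C)
    (μ := volume) ((hv.sub (locallyIntegrable_const C)).locallyIntegrableOn U) (fun φ hφ hs hsU => ?_)
  · filter_upwards [key] with x hx hxU
    exact sub_eq_zero.mp (hx hxU)
  set m : ℝ := ∫ x, φ x with hm
  have hφi : Integrable φ := hφ.continuous.integrable_of_hasCompactSupport hs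
  have hηi : Integrable η := hη1.continuous.integrable_of_hasCompactSupport hη2
  have hmη : HasCompactSupport fun x => m * η x := hη2.mul_left
  obtain ⟨χ, h1, h2, h3, h4⟩ := exists_antideriv_of_integral_eq_zero hc (g := fun x => φ x - m * η x)
    (hφ.sub (contDiff_const.mul hη1)) (hs.sub hmη) (by
      refine (tsupport_sub φ fun x => m * η x).trans (union_subset hsU ?_)
      exact (tsupport_mul_subset_right (f := fun _ => m) (g := η)).trans hη3) (by
      rw [integral_sub hφi (hηi.const_mul m), integral_const_mul, hη4, ← hm]; ring)
  have h5 := h χ h1 h2 h3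
  rw [h4] at h5
  have h6 : ∀ x, (((φ x - m * η x : ℝ)) : ℂ) * v x = (φ x : ℂ) * v x - m * ((η x : ℂ) * v x) := by
    intro x; push_cast; ring
  simp only [h6] at h5
  rw [integral_sub (hint φ hφ hs) ((hint η hη1 hη2).const_mul _), integral_const_mul, ← hC] at h5
  have h7 : ∀ x, φ x • (v x - C) = (φ x : ℂ) * v x - (φ x : ℂ) * C := by
    intro x; rw [Complex.real_smul]; ring
  simp only [h7]
  have hφi' : Integrable fun x => (φ x : ℂ) := hφi.ofReal
  rw [integral_sub (hint φ hφ hs) (hφi'.mul_const C), integral_mul_const]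
  have : ∫ x, (φ x : ℂ) = m := integral_ofReal
  rw [this, h5]

/-! ### Fourier transforms at complex arguments -/

/-- The Fourier transform at complex arguments. -/
def entireHat (f : ℝ → ℂ) (z : ℂ) : ℂ :=
  ((Real.sqrt (2 * Real.pi))⁻¹ : ℝ) * ∫ x : ℝ, f x * cexp (I * z * x)

theorem entireHat_ofReal (f : ℝ → ℂ) (p : ℝ) : entireHat f p = fourierHat f p := rfl

theorem norm_cexp_I_mul (z : ℂ) (x : ℝ) : ‖cexp (I * z * x)‖ = Real.exp (-z.im * x) := by
  rw [Complex.norm_exp]; simp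

theorem differentiableAt_entireHat {f : ℝ → ℂ} {z₀ : ℂ} {ε : ℝ} (hε : 0 < ε)
    (hfm : AEStronglyMeasurable f volume)
    (hf : Integrable fun x : ℝ => ‖f x‖ * Real.exp (ε * |x| - z₀.im * x)) :
    DifferentiableAt ℂ (entireHat f) z₀ := by
  have hmeas : ∀ z : ℂ, AEStronglyMeasurable (fun x : ℝ => f x * cexp (I * z * x)) volume :=
    fun z => hfm.mul (by fun_prop : Continuous fun x : ℝ => cexp (I * z * x)).aestronglyMeasurable
  have key := hasDerivAt_integral_of_dominated_loc_of_deriv_le (μ := volume) (𝕜 := ℂ)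
    (F := fun (z : ℂ) (x : ℝ) => f x * cexp (I * z * x))
    (F' := fun (z : ℂ) (x : ℝ) => f x * (cexp (I * z * x) * (I * x)))
    -- Half of the margin `ε` pays for moving `z` in the ball of radius `ε/2`; the other half
    -- absorbs the factor `|x| ≤ (2/ε) e^{ε|x|/2}` produced by differentiation.
    (bound := fun x => 2 / ε * (‖f x‖ * Real.exp (ε * |x| - z₀.im * x)))
    (s := Metric.ball z₀ (ε / 2)) (x₀ := z₀) (Metric.ball_mem_nhds _ (by positivity))
    (Filter.Eventually.of_forall hmeas) ?_ ?_ ?_ (hf.const_mul _) ?_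
  · exact key.2.differentiableAt.const_mul _
  · refine hf.mono' (hmeas z₀) (Filter.Eventually.of_forall fun x => ?_)
    rw [norm_mul, norm_cexp_I_mul]
    gcongr
    have := abs_nonneg x
    nlinarith
  · exact hfm.mul (by fun_prop : Continuous fun x : ℝ =>
      cexp (I * z₀ * x) * (I * x)).aestronglyMeasurable
  · refine Filter.Eventually.of_forall fun x z hz => ?_
    rw [norm_mul, norm_mul, norm_cexp_I_mul, norm_mul, norm_I, one_mul, norm_real, Real.norm_eq_abs]
    have h1 : |x| ≤ 2 / ε * Real.exp (ε / 2 * |x|) := by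
      have := Real.add_one_le_exp (ε / 2 * |x|)
      rw [div_mul_eq_mul_div, le_div_iff₀ hε]
      linarith
    have h2 : -z.im * x ≤ ε / 2 * |x| - z₀.im * x := by
      have h3 : |(z₀ - z).im| ≤ ε / 2 := by
        refine (Complex.abs_im_le_norm _).trans ?_
        rw [← dist_eq_norm, dist_comm]
        exact (Metric.mem_ball.mp hz).le
      have h4 : (z₀ - z).im * x ≤ ε / 2 * |x| := by
        refine (le_abs_self _).trans ?_
        rw [abs_mul]
        gcongr
      rw [sub_im] at h4
      linarith
    have h5 : Real.exp (-z.im * x) * |x| ≤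
        Real.exp (ε / 2 * |x| - z₀.im * x) * (2 / ε * Real.exp (ε / 2 * |x|)) := by gcongr
    have h6 : Real.exp (ε / 2 * |x| - z₀.im * x) * (2 / ε * Real.exp (ε / 2 * |x|)) =
        2 / ε * Real.exp (ε * |x| - z₀.im * x) := by
      rw [mul_left_comm, ← Real.exp_add]; ring_nf
    rw [h6] at h5
    calc _ ≤ ‖f x‖ * (2 / ε * Real.exp (ε * |x| - z₀.im * x)) := by gcongr
      _ = _ := by ring
  · refine Filter.Eventually.of_forall fun x z _ => ?_
    have h1 : HasDerivAt (fun z : ℂ => I * z * x) (I * x) z := by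
      simpa using ((hasDerivAt_id z).const_mul I).mul_const (x : ℂ)
    exact h1.cexp.const_mul (f x)

theorem differentiable_entireHat {f : ℝ → ℂ} (hf : Integrable f) {a b : ℝ}
    (hs : ∀ x, x ∉ Icc a b → f x = 0) : Differentiable ℂ (entireHat f) := by
  intro z
  refine differentiableAt_entireHat one_pos hf.1 ?_
  have hm : AEStronglyMeasurable (fun x : ℝ => ‖f x‖ * Real.exp (1 * |x| - z.im * x)) volume :=
    hf.1.norm.mul (by fun_prop : Continuous fun x : ℝ =>
      Real.exp (1 * |x| - z.im * x)).aestronglyMeasurable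
  refine (hf.norm.const_mul (Real.exp ((1 + |z.im|) * (|a| + |b|)))).mono' hm
    (Filter.Eventually.of_forall fun x => ?_)
  rw [norm_mul, norm_norm, Real.norm_eq_abs, Real.abs_exp, mul_comm]
  by_cases hx : x ∈ Icc a b
  · gcongr
    have h1 : |x| ≤ |a| + |b| := by
      have := abs_le_max_abs_abs hx.1 hx.2
      have h2 := max_le_add_of_nonneg (abs_nonneg a) (abs_nonneg b)
      linarith
    have h2 : -(z.im * x) ≤ |z.im| * |x| := by
      rw [← abs_mul]; exact neg_le_abs _
    calc _ ≤ (1 + |z.im|) * |x| := by linarith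
      _ ≤ _ := by gcongr
  · simp [hs x hx]

/-- The exponent `M` is only constrained where `f` is nonzero, so one constant serves both half
planes and every position of the support. -/
theorem exists_norm_entireHat_le (f : ℝ → ℂ) (hf : Integrable f) : ∃ C : ℝ, 0 < C ∧
    ∀ (z : ℂ) (M : ℝ), (∀ x, f x ≠ 0 → -z.im * x ≤ M) → ‖entireHat f z‖ ≤ C * Real.exp M := by
  set s : ℝ := (Real.sqrt (2 * Real.pi))⁻¹
  have hs : 0 ≤ s := by positivity
  have hN : 0 ≤ ∫ x, ‖f x‖ := integral_nonneg fun x => norm_nonneg _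
  refine ⟨s * (∫ x, ‖f x‖) + 1, by positivity, fun z M hM => ?_⟩
  have h1 : ‖∫ x : ℝ, f x * cexp (I * z * x)‖ ≤ ∫ x, ‖f x‖ * Real.exp M := by
    refine norm_integral_le_of_norm_le (hf.norm.mul_const _)
      (Filter.Eventually.of_forall fun x => ?_)
    rw [norm_mul, norm_cexp_I_mul]
    by_cases hx : f x = 0
    · simp [hx]
    · gcongr
      exact hM x hx
  rw [integral_mul_const] at h1
  rw [entireHat, norm_mul, norm_real, Real.norm_of_nonneg hs]
  calc s * _ ≤ s * ((∫ x, ‖f x‖) * Real.exp M) := by gcongr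
    _ ≤ _ := by nlinarith [Real.exp_pos M]

theorem entireHat_neg_conj (f : ℝ → ℝ) (z : ℂ) :
    entireHat (fun x => (f x : ℂ)) (-conj z) = conj (entireHat (fun x => (f x : ℂ)) z) := by
  rw [entireHat, entireHat, map_mul, conj_ofReal, ← integral_conj]
  congr 1
  refine integral_congr_ae (Filter.Eventually.of_forall fun x => ?_)
  simp only [map_mul, conj_ofReal, ← Complex.exp_conj, conj_I]
  ring_nf

theorem entireHat_translate (f : ℝ → ℂ) (c : ℝ) (z : ℂ) :
    entireHat (fun x => f (x - c)) z = cexp (I * c * z) * entireHat f z := by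
  rw [entireHat, entireHat, mul_left_comm, ← integral_const_mul (cexp (I * c * z)),
    ← integral_add_right_eq_self (fun x : ℝ => f (x - c) * cexp (I * z * x)) c]
  congr 1
  refine integral_congr_ae (Filter.Eventually.of_forall fun x => ?_)
  simp only [add_sub_cancel_right, ofReal_add]
  rw [mul_left_comm, ← Complex.exp_add]
  ring_nf

theorem entireHat_deriv {f : ℝ → ℝ} (hf : ContDiff ℝ (⊤ : ℕ∞) f) (hs : HasCompactSupport f) (z : ℂ) :
    entireHat (fun x => ((deriv f x : ℝ) : ℂ)) z = -I * z * entireHat (fun x => (f x : ℂ)) z := by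
  have hc : ∀ w : ℂ, Continuous fun x : ℝ => cexp (I * w * x) := fun w => by fun_prop
  have hf0 : Continuous fun x => (f x : ℂ) := by have := hf.continuous; fun_prop
  have hf1 : Continuous fun x => ((deriv f x : ℝ) : ℂ) := by
    have := hf.continuous_deriv (by simp); fun_prop
  have hs0 : HasCompactSupport fun x => (f x : ℂ) := hs.comp_left (g := ofReal) ofReal_zero
  have hs1 : HasCompactSupport fun x => ((deriv f x : ℝ) : ℂ) :=
    hs.deriv.comp_left (g := ofReal) ofReal_zero
  have h1 : ∀ x : ℝ, HasDerivAt (fun x : ℝ => (f x : ℂ)) ((deriv f x : ℝ) : ℂ) x := fun x =>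
    ((hf.differentiable (by simp)) x).hasDerivAt.ofReal_comp
  have h2 : ∀ x : ℝ, HasDerivAt (fun x : ℝ => cexp (I * z * x)) (cexp (I * z * x) * (I * z)) x := by
    intro x
    have : HasDerivAt (fun x : ℝ => I * z * x) (I * z) x := by
      simpa using (hasDerivAt_id x).ofReal_comp.const_mul (I * z)
    exact this.cexp
  have key := integral_mul_deriv_eq_deriv_mul_of_integrable (fun x _ => h1 x) (fun x _ => h2 x)
    ((hf0.mul ((hc z).mul continuous_const)).integrable_of_hasCompactSupport hs0.mul_right)
    ((hf1.mul (hc z)).integrable_of_hasCompactSupport hs1.mul_right)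
    ((hf0.mul (hc z)).integrable_of_hasCompactSupport hs0.mul_right)
  have h3 : ∀ x : ℝ, (f x : ℂ) * (cexp (I * z * x) * (I * z)) =
      (I * z) * ((f x : ℂ) * cexp (I * z * x)) := fun x => by ring
  simp only [h3] at key
  rw [integral_const_mul] at key
  rw [entireHat, entireHat, ← neg_eq_iff_eq_neg.mpr key]
  ring

/-! ### The standard subspace, the modular conjugation and translations -/

theorem mellin_eq (ψ : Hilb) : mellin ψ = Lp.fourierTransformₗᵢ ℝ ℂ
    (Lp.compMeasurePreservingₗᵢ ℂ Real.exp measurePreserving_exp ψ) := rfl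

theorem continuous_mellin : Continuous mellin :=
  (Lp.fourierTransformₗᵢ ℝ ℂ).continuous.comp
    (Lp.isometry_compMeasurePreserving measurePreserving_exp).continuous

theorem inner_mellin (ψ χ : Hilb) : ⟪mellin ψ, mellin χ⟫_ℂ = ⟪ψ, χ⟫_ℂ := by
  rw [mellin_eq, mellin_eq, LinearIsometryEquiv.inner_map_map, LinearIsometry.inner_map_map]

theorem coeFn_modConj (ψ : Hilb) : modConj ψ =ᵐ[halfLineMeasure] fun p => conj (ψ p) :=
  Lp.coeFn_star ψ

theorem isometry_modConj : Isometry modConj := by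
  refine Isometry.of_dist_eq fun ψ χ => ?_
  rw [dist_eq_norm, dist_eq_norm, Lp.norm_def, Lp.norm_def]
  congr 1
  refine eLpNorm_congr_norm_ae ?_
  filter_upwards [Lp.coeFn_sub (modConj ψ) (modConj χ), Lp.coeFn_sub ψ χ, coeFn_modConj ψ,
    coeFn_modConj χ] with p h1 h2 h3 h4
  rw [h1, h2, Pi.sub_apply, Pi.sub_apply, h3, h4, ← map_sub, RCLike.norm_conj]

theorem modConj_modConj (ψ : Hilb) : modConj (modConj ψ) = ψ := star_star ψ

theorem mem_standardSubspace_iff (ψ : Hilb) :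
    ψ ∈ standardSubspace ↔ IsModularPower (1 / 2) ψ (modConj ψ) := by
  constructor
  · rintro ⟨χ, h1, h2⟩
    have : χ = modConj ψ := by rw [← h2, modConj_modConj]
    rwa [this] at h1
  · intro h
    exact ⟨_, h, modConj_modConj ψ⟩

/-- The graph of a multiplication operator is closed: along a common subsequence both Mellin
transforms converge almost everywhere, and the pointwise relation passes to the limit. -/
theorem mem_standardSubspace_of_tendsto {u : ℕ → Hilb} {ψ : Hilb} (hu : Tendsto u atTop (𝓝 ψ))
    (h : ∀ n, u n ∈ standardSubspace) : ψ ∈ standardSubspace := by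
  rw [mem_standardSubspace_iff]
  have h1 : Tendsto (fun n => mellin (u n)) atTop (𝓝 (mellin ψ)) :=
    (continuous_mellin.tendsto ψ).comp hu
  have h2 : Tendsto (fun n => mellin (modConj (u n))) atTop (𝓝 (mellin (modConj ψ))) :=
    (continuous_mellin.tendsto _).comp ((isometry_modConj.continuous.tendsto ψ).comp hu)
  obtain ⟨n₁, hn₁, h3⟩ := (tendstoInMeasure_of_tendsto_Lp h1).exists_seq_tendsto_ae
  obtain ⟨n₂, hn₂, h4⟩ := (tendstoInMeasure_of_tendsto_Lp
    (h2.comp hn₁.tendsto_atTop)).exists_seq_tendsto_ae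
  have h5 : ∀ᵐ s : ℝ, ∀ n, mellin (modConj (u n)) s =
      cexp (-(4 * Real.pi ^ 2 * s) * (1 / 2)) * mellin (u n) s :=
    ae_all_iff.mpr fun n => (mem_standardSubspace_iff _).mp (h n)
  filter_upwards [h3, h4, h5] with s h3 h4 h5
  refine tendsto_nhds_unique h4 ?_
  have h6 := (h3.comp hn₂.tendsto_atTop).const_mul (cexp (-(4 * Real.pi ^ 2 * s) * (1 / 2)))
  refine h6.congr fun n => ?_
  simp only [Function.comp_apply, h5]

theorem inner_modConj_comm (ψ χ : Hilb) : ⟪modConj ψ, χ⟫_ℂ = conj ⟪ψ, modConj χ⟫_ℂ := by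
  rw [L2.inner_def, L2.inner_def, ← integral_conj]
  refine integral_congr_ae ?_
  filter_upwards [coeFn_modConj ψ, coeFn_modConj χ] with p h1 h2
  simp [h1, h2]

/-- On `H` the operators `J` and `Δ^{1/2}` agree. The multiplier of `Δ^{1/2}` is real, so `⟪Jψ, χ⟫ =
⟪ψ, Jχ⟫`, while antiunitarity of `J` makes the right side the conjugate of the left. This is the
inclusion `JH ⊆ H'`, the only half of the duality `JH = H'` that is needed. -/
theorem im_inner_modConj_eq_zero {ψ χ : Hilb} (hψ : ψ ∈ standardSubspace)
    (hχ : χ ∈ standardSubspace) : (⟪modConj ψ, χ⟫_ℂ).im = 0 := by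
  rw [mem_standardSubspace_iff] at hψ hχ
  have h : ⟪modConj ψ, χ⟫_ℂ = ⟪ψ, modConj χ⟫_ℂ := by
    rw [← inner_mellin, ← inner_mellin, L2.inner_def, L2.inner_def]
    refine integral_congr_ae ?_
    filter_upwards [hψ, hχ] with s h1 h2
    have h3 : cexp (-(4 * Real.pi ^ 2 * s) * (1 / 2)) =
        ((Real.exp (-(4 * Real.pi ^ 2 * s) * (1 / 2)) : ℝ) : ℂ) := by push_cast; rfl
    simp only [h1, h2, h3, RCLike.inner_apply, map_mul, conj_ofReal]
    ring
  have h2 := inner_modConj_comm ψ χ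
  rw [h] at h2 ⊢
  exact conj_eq_iff_im.mp h2.symm

theorem modConj_mem_symplecticComplement {ψ : Hilb} (hψ : ψ ∈ standardSubspace) :
    modConj ψ ∈ symplecticComplement standardSubspace := fun _ hχ =>
  im_inner_modConj_eq_zero hψ hχ

theorem coeFn_transl (a : ℝ) (ψ : Hilb) :
    transl a ψ =ᵐ[halfLineMeasure] fun p => cexp (I * a * p) * ψ p :=
  (memLp_phase_mul a ψ).coeFn_toLp

theorem transl_transl (a b : ℝ) (ψ : Hilb) : transl a (transl b ψ) = transl (a + b) ψ := by
  refine Lp.ext ?_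
  filter_upwards [coeFn_transl a (transl b ψ), coeFn_transl b ψ, coeFn_transl (a + b) ψ]
    with p h1 h2 h3
  rw [h1, h2, h3, ← mul_assoc, ← Complex.exp_add]
  push_cast
  ring_nf

theorem transl_zero (ψ : Hilb) : transl 0 ψ = ψ := by
  refine Lp.ext ?_
  filter_upwards [coeFn_transl 0 ψ] with p h1
  simp [h1]

theorem inner_transl_left (a : ℝ) (ψ χ : Hilb) :
    ⟪transl a ψ, χ⟫_ℂ = ⟪ψ, transl (-a) χ⟫_ℂ := by
  rw [L2.inner_def, L2.inner_def]
  refine integral_congr_ae ?_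
  filter_upwards [coeFn_transl a ψ, coeFn_transl (-a) χ] with p h1 h2
  simp only [h1, h2, RCLike.inner_apply, map_mul, ← Complex.exp_conj, conj_I, conj_ofReal,
    ofReal_neg]
  ring_nf

theorem mem_transl_image_iff (a : ℝ) (K : Set Hilb) (ψ : Hilb) :
    ψ ∈ transl a '' K ↔ transl (-a) ψ ∈ K := by
  constructor
  · rintro ⟨χ, hχ, rfl⟩
    rwa [transl_transl, neg_add_cancel, transl_zero]
  · intro h
    exact ⟨_, h, by rw [transl_transl, add_neg_cancel, transl_zero]⟩

theorem mem_localSubspace_iff (a b : ℝ) (ψ : Hilb) : ψ ∈ localSubspace a b ↔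
    transl (-a) ψ ∈ standardSubspace ∧
      transl (-b) ψ ∈ symplecticComplement standardSubspace := by
  rw [localSubspace, mem_inter_iff, mem_transl_image_iff, mem_transl_image_iff]

theorem transl_mem_localSubspace_iff (a b c : ℝ) (ψ : Hilb) :
    transl c ψ ∈ localSubspace (a + c) (b + c) ↔ ψ ∈ localSubspace a b := by
  rw [mem_localSubspace_iff, mem_localSubspace_iff, transl_transl, transl_transl]
  simp

/-! ### From analytic functions to vectors of the standard subspace -/

/-- Shift of the line of integration inside a horizontal strip. -/
theorem integral_eq_integral_add_mul_I {k : ℂ → ℂ} {c C : ℝ} (hc : 0 ≤ c)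
    (hk : ∀ z : ℂ, z.im ∈ Icc 0 c → DifferentiableAt ℂ k z)
    (hb : ∀ z : ℂ, z.im ∈ Icc 0 c → ‖k z‖ ≤ C * (1 + z.re ^ 2)⁻¹) :
    ∫ x : ℝ, k x = ∫ x : ℝ, k (x + c * I) := by
  have hC : 0 ≤ C := by
    have := (norm_nonneg _).trans (hb 0 (by simp [hc]))
    simpa using this
  have hline : ∀ y ∈ Icc 0 c, Integrable fun x : ℝ => k (x + y * I) := by
    intro y hy
    refine (integrable_inv_one_add_sq.const_mul C).mono' ?_ (Eventually.of_forall fun x => ?_)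
    · refine Continuous.aestronglyMeasurable (continuous_iff_continuousAt.mpr fun x => ?_)
      have : ContinuousAt k (x + y * I) := (hk _ (by simpa using hy)).continuousAt
      exact this.comp (f := fun x : ℝ => (x : ℂ) + y * I) (by fun_prop)
    · simpa using hb (x + y * I) (by simpa using hy)
  have h0 : Integrable fun x : ℝ => k x := by simpa using hline 0 (by simp [hc])
  have h1 : Integrable fun x : ℝ => k (x + c * I) := hline c (by simp [hc])
  have t0 := intervalIntegral_tendsto_integral h0 tendsto_neg_atTop_atBot tendsto_id
  have t1 := intervalIntegral_tendsto_integral h1 tendsto_neg_atTop_atBot tendsto_id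
  -- The signs `σ = ±1` treat both vertical sides of the rectangle at once.
  have side : ∀ σ : ℝ, σ ^ 2 = 1 →
      Tendsto (fun N : ℝ => ∫ y in (0 : ℝ)..c, k ((σ * N : ℝ) + y * I)) atTop (𝓝 0) := by
    intro σ hσ
    rw [tendsto_zero_iff_norm_tendsto_zero]
    have hlim : Tendsto (fun N : ℝ => C * (1 + N ^ 2)⁻¹ * |c - 0|) atTop (𝓝 0) := by
      have : Tendsto (fun N : ℝ => (1 + N ^ 2)⁻¹) atTop (𝓝 0) :=
        tendsto_inv_atTop_zero.comp (tendsto_atTop_add_const_left _ _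
          (tendsto_pow_atTop two_ne_zero))
      simpa using (this.const_mul C).mul_const |c - 0|
    refine squeeze_zero (fun _ => norm_nonneg _) (fun N => ?_) hlim
    refine intervalIntegral.norm_integral_le_of_norm_le_const fun y hy => ?_
    rw [uIoc_of_le hc] at hy
    have := hb ((σ * N : ℝ) + y * I) (by simpa using Ioc_subset_Icc_self hy)
    simpa [mul_pow, hσ] using this
  have rect : ∀ N : ℝ, (∫ x in (-N)..id N, k x) - (∫ x in (-N)..id N, k (x + c * I)) =
      -(I • ∫ y in (0 : ℝ)..c, k ((1 * N : ℝ) + y * I)) +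
        I • ∫ y in (0 : ℝ)..c, k ((-1 * N : ℝ) + y * I) := by
    intro N
    have := integral_boundary_rect_eq_zero_of_differentiableOn k ⟨-N, 0⟩ ⟨N, c⟩ (fun z hz =>
      (hk z (by
        have := hz.2
        rwa [mem_preimage, uIcc_of_le hc] at this)).differentiableWithinAt)
    simp only [ofReal_zero, zero_mul, add_zero] at this
    simp only [id, one_mul, neg_one_mul]
    linear_combination this
  have t2 := (((side 1 (by norm_num)).const_smul I).neg).add ((side (-1) (by norm_num)).const_smul I)
  simp only [smul_zero, neg_zero, add_zero] at t2
  have t3 := (t0.sub t1).congr rect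
  exact sub_eq_zero.mp (tendsto_nhds_unique t3 t2)

theorem exp_neg_abs_le (x : ℝ) : Real.exp (-|x|) ≤ 2 * (1 + x ^ 2)⁻¹ := by
  rw [Real.exp_neg, ← div_eq_mul_inv, inv_le_comm₀ (Real.exp_pos _) (by positivity), inv_div]
  have h1 := Real.quadratic_le_exp_of_nonneg (abs_nonneg x)
  have h2 := abs_nonneg x
  rw [sq_abs] at h1
  linarith

theorem ae_exp_of_ae {P : ℝ → Prop} (h : ∀ᵐ p ∂halfLineMeasure, P p) : ∀ᵐ θ : ℝ, P (Real.exp θ) :=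
  measurePreserving_exp.quasiMeasurePreserving.ae h

theorem coeFn_mellin_of_ae_eq {ψ : Hilb} {k : ℝ → ℂ} (hk : Integrable k)
    (h : ∀ᵐ θ : ℝ, ψ (Real.exp θ) = k θ) :
    mellin ψ =ᵐ[volume] fun s => ∫ θ : ℝ, cexp (-(2 * Real.pi * I * s * θ)) * k θ := by
  have h1 : (Lp.compMeasurePreserving Real.exp measurePreserving_exp ψ : ℝ → ℂ) =ᵐ[volume] k :=
    (Lp.coeFn_compMeasurePreserving _ _).trans h
  have h2 := coeFn_fourier_of_integrable (hk.congr h1.symm)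
  filter_upwards [h2] with s hs
  rw [mellin, hs, Real.fourier_real_eq_integral_exp_smul]
  refine integral_congr_ae ?_
  filter_upwards [h1] with θ hθ
  rw [hθ, smul_eq_mul]
  congr 2
  push_cast
  ring

/-- Under `p = e^z` the strip `0 ≤ Im z ≤ π` goes to the closed upper half plane, and on its top
edge the function is the conjugate of its values on the bottom edge. Shifting the Mellin integral by
`iπ` produces the factor `e^{2π²s}`, the inverse of the multiplier of `Δ^{1/2}`. The two bounds say
that the function is at most `C e^{-|Re z|}` on the strip, which justifies the shift. -/
theorem mem_standardSubspace_of_decay {h : ℂ → ℂ} {C : ℝ}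
    (hd : ∀ p : ℂ, 0 ≤ p.im → DifferentiableAt ℂ h p)
    (h1 : ∀ p : ℂ, 0 ≤ p.im → ‖h p‖ ≤ C * ‖p‖) (h2 : ∀ p : ℂ, 0 ≤ p.im → ‖h p‖ * ‖p‖ ≤ C)
    (hsymm : ∀ p : ℝ, h (-p) = conj (h p)) {ψ : Hilb}
    (hψ : ∀ᵐ p : ℝ ∂halfLineMeasure, ψ p = h p) : ψ ∈ standardSubspace := by
  set k : ℂ → ℂ := fun z => h (cexp z) with hk
  have him : ∀ z : ℂ, z.im ∈ Icc 0 Real.pi → 0 ≤ (cexp z).im := by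
    intro z hz
    rw [Complex.exp_im]
    exact mul_nonneg (Real.exp_pos _).le (Real.sin_nonneg_of_mem_Icc hz)
  have hkd : ∀ z : ℂ, z.im ∈ Icc 0 Real.pi → DifferentiableAt ℂ k z := fun z hz =>
    (hd _ (him z hz)).comp z Complex.differentiableAt_exp
  have hkb : ∀ z : ℂ, z.im ∈ Icc 0 Real.pi → ‖k z‖ ≤ C * Real.exp (-|z.re|) := by
    intro z hz
    have e1 := h1 _ (him z hz)
    have e2 := h2 _ (him z hz)
    rw [Complex.norm_exp] at e1 e2
    rcases le_total 0 z.re with h | h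
    · rwa [abs_of_nonneg h, Real.exp_neg, ← div_eq_mul_inv, le_div_iff₀ (Real.exp_pos _)]
    · rwa [abs_of_nonpos h, neg_neg]
  have hC : 0 ≤ C := (mul_nonneg (norm_nonneg _) (norm_nonneg _)).trans (h2 0 (by simp))
  have hint : Integrable fun θ : ℝ => k θ := by
    refine (integrable_inv_one_add_sq.const_mul (C * 2)).mono' ?_ (Eventually.of_forall fun x => ?_)
    · refine Continuous.aestronglyMeasurable (continuous_iff_continuousAt.mpr fun x => ?_)
      have : ContinuousAt k (x : ℂ) := (hkd _ (by simp [Real.pi_nonneg])).continuousAt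
      exact this.comp (f := fun x : ℝ => (x : ℂ)) (by fun_prop)
    · refine (hkb x (by simp [Real.pi_nonneg])).trans ?_
      rw [mul_assoc, ofReal_re]
      gcongr
      exact exp_neg_abs_le x
  have hkpi : ∀ θ : ℝ, k (θ + Real.pi * I) = conj (k θ) := by
    intro θ
    simp only [hk]
    rw [Complex.exp_add, Complex.exp_pi_mul_I, mul_neg_one, ← ofReal_exp, hsymm]
  have hint' : Integrable fun θ : ℝ => conj (k θ) := by
    simpa using (Complex.conjLIE : ℂ ≃ₗᵢ[ℝ] ℂ).toContinuousLinearEquiv.toContinuousLinearMap.integrable_comp hint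
  have m1 := coeFn_mellin_of_ae_eq (ψ := ψ) hint (by
    filter_upwards [ae_exp_of_ae hψ] with θ hθ
    rw [hθ]; simp [hk])
  have m2 := coeFn_mellin_of_ae_eq (ψ := modConj ψ) hint' (by
    filter_upwards [ae_exp_of_ae hψ, ae_exp_of_ae (coeFn_modConj ψ)] with θ hθ h3
    rw [h3, hθ]; simp [hk])
  rw [mem_standardSubspace_iff]
  filter_upwards [m1, m2] with s hs1 hs2
  rw [hs1, hs2]
  have shift := integral_eq_integral_add_mul_I (k := fun z => cexp (-(2 * Real.pi * I * s * z)) * k z)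
    (c := Real.pi) (C := Real.exp (2 * Real.pi * |s| * Real.pi) * (C * 2)) Real.pi_nonneg
    (fun z hz => (by fun_prop : DifferentiableAt ℂ (fun z => cexp (-(2 * Real.pi * I * s * z))) z).mul
      (hkd z hz)) (fun z hz => by
        have e1 : ‖cexp (-(2 * Real.pi * I * s * z))‖ ≤ Real.exp (2 * Real.pi * |s| * Real.pi) := by
          rw [Complex.norm_exp]
          have : (-(2 * Real.pi * I * s * z)).re = 2 * Real.pi * (s * z.im) := by
            simp; ring
          rw [this]
          have h4 : s * z.im ≤ |s| * Real.pi := by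
            have := le_abs_self s
            have := abs_nonneg s
            nlinarith [hz.1, hz.2]
          refine Real.exp_le_exp.mpr ?_
          rw [mul_assoc (2 * Real.pi)]
          exact mul_le_mul_of_nonneg_left h4 (by positivity)
        rw [norm_mul, mul_assoc _ (C * 2), mul_assoc C]
        have e2 := (hkb z hz).trans (mul_le_mul_of_nonneg_left (exp_neg_abs_le z.re) hC)
        gcongr)
  rw [shift, ← integral_const_mul]
  refine integral_congr_ae (Eventually.of_forall fun θ => ?_)
  simp only
  rw [hkpi, ← mul_assoc, ← Complex.exp_add]
  congr 2
  linear_combination (2 * Real.pi ^ 2 * s : ℂ) * I_sq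

theorem tendsto_of_mul_bounded {ψ : Hilb} {R : ℕ → ℝ → ℂ} (hR : ∀ n p, ‖R n p‖ ≤ 1)
    (hlim : ∀ p, Tendsto (fun n => R n p) atTop (𝓝 1)) {u : ℕ → Hilb}
    (hu : ∀ n, u n =ᵐ[halfLineMeasure] fun p => R n p * ψ p) : Tendsto u atTop (𝓝 ψ) := by
  rw [tendsto_iff_norm_sub_tendsto_zero]
  have hsq : ∀ v : Hilb, ‖v‖ ^ 2 = ∫ p, ‖v p‖ ^ 2 ∂halfLineMeasure := by
    intro v
    have h1 : ((‖v‖ ^ 2 : ℝ) : ℂ) = ((∫ p, ‖v p‖ ^ 2 ∂halfLineMeasure : ℝ) : ℂ) := by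
      have := inner_self_eq_norm_sq_to_K (𝕜 := ℂ) v
      rw [L2.inner_def] at this
      rw [← integral_complex_ofReal]
      refine (ofReal_pow _ _).trans ?_
      refine this.symm.trans (integral_congr_ae (Eventually.of_forall fun p => ?_))
      simp only [inner_self_eq_norm_sq_to_K]
      exact (ofReal_pow _ _).symm
    exact_mod_cast h1
  have hlim2 : Tendsto (fun n => ∫ p, ‖(u n - ψ : Hilb) p‖ ^ 2 ∂halfLineMeasure) atTop
      (𝓝 (∫ _, (0 : ℝ) ∂halfLineMeasure)) := by
    have hub : ∀ᵐ p ∂halfLineMeasure, ∀ n, (u n - ψ : Hilb) p = (R n p - 1) * ψ p := by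
      rw [ae_all_iff]
      intro n
      filter_upwards [Lp.coeFn_sub (u n) ψ, hu n] with p h1 h2
      rw [h1, Pi.sub_apply, h2]; ring
    refine tendsto_integral_of_dominated_convergence (fun p => 4 * ‖ψ p‖ ^ 2)
      (fun n => ((Lp.aestronglyMeasurable _).norm.pow 2)) ?_ (fun n => ?_) ?_
    · exact ((Lp.memLp ψ).integrable_norm_pow two_ne_zero).const_mul 4
    · filter_upwards [hub] with p hp
      rw [hp n, norm_mul, norm_pow, norm_mul, norm_norm, norm_norm, mul_pow]
      have h1 : ‖R n p - 1‖ ≤ 2 := by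
        refine (norm_sub_le _ _).trans ?_
        rw [norm_one]
        linarith [hR n p]
      have h2 := norm_nonneg (R n p - 1)
      gcongr
      nlinarith
    · filter_upwards [hub] with p hp
      simp only [hp]
      have h1 := ((((hlim p).sub_const 1).mul_const (ψ p)).norm).pow 2
      simpa using h1
  simp only [← hsq, integral_zero] at hlim2
  have := hlim2.sqrt
  simpa using this

/-- The real part of `1 - iδp` is `1 + δ Im p ≥ 1`. These bounds control the regularizing factors
used to approximate functions of linear growth. -/
theorem one_le_norm_one_sub_I_mul {δ : ℝ} (hδ : 0 ≤ δ) {p : ℂ} (hp : 0 ≤ p.im) :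
    1 ≤ ‖1 - I * δ * p‖ ∧ δ * ‖p‖ ≤ ‖1 - I * δ * p‖ := by
  have h1 : ‖1 - I * δ * p‖ ^ 2 = (1 + δ * p.im) ^ 2 + δ ^ 2 * p.re ^ 2 := by
    rw [← normSq_eq_norm_sq, normSq_apply]; simp; ring
  have h2 : ‖p‖ ^ 2 = p.re ^ 2 + p.im ^ 2 := by
    rw [← normSq_eq_norm_sq, normSq_apply]; ring
  have h3 : 0 ≤ δ * p.im := mul_nonneg hδ hp
  constructor
  · refine le_of_sq_le_sq ?_ (norm_nonneg _)
    rw [h1]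
    nlinarith [sq_nonneg (δ * p.re)]
  · refine le_of_sq_le_sq ?_ (norm_nonneg _)
    rw [h1, mul_pow, h2]
    nlinarith

/-- A vector given by an entire function of linear growth in the upper half plane and real on the
imaginary axis lies in the standard subspace. -/
theorem mem_standardSubspace_of_entire {h : ℂ → ℂ} (hd : Differentiable ℂ h) {C : ℝ}
    (h1 : ∀ p : ℂ, 0 ≤ p.im → ‖h p‖ ≤ C * ‖p‖)
    (hsymm : ∀ p : ℝ, h (-p) = conj (h p)) {ψ : Hilb}
    (hψ : ∀ᵐ p : ℝ ∂halfLineMeasure, ψ p = h p) : ψ ∈ standardSubspace := by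
  set δ : ℕ → ℝ := fun n => 1 / ((n : ℝ) + 1) with hδ
  have hδ0 : ∀ n, 0 < δ n := fun n => by positivity
  have hδ1 : Tendsto δ atTop (𝓝 0) := tendsto_one_div_add_atTop_nhds_zero_nat
  -- Each regularizer has its pole in the lower half plane, satisfies `R(-p) = conj R(p)` on the
  -- real line, and is bounded by one on the upper half plane. The square gives decay `|p|⁻²`, which
  -- turns linear growth into the decay `|p|⁻¹`.
  set R : ℕ → ℂ → ℂ := fun n p => ((1 - I * δ n * p) ^ 2)⁻¹ with hR
  have hne : ∀ n (p : ℂ), 0 ≤ p.im → 1 - I * δ n * p ≠ 0 := fun n p hp h0 => by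
    have := (one_le_norm_one_sub_I_mul (hδ0 n).le hp).1
    rw [h0, norm_zero] at this
    linarith
  have hR1 : ∀ n (p : ℂ), 0 ≤ p.im → ‖R n p‖ ≤ 1 := fun n p hp => by
    rw [hR]
    simp only [norm_inv, norm_pow]
    exact inv_le_one_of_one_le₀ (one_le_pow₀ (one_le_norm_one_sub_I_mul (hδ0 n).le hp).1)
  have hR2 : ∀ n (p : ℂ), 0 ≤ p.im → ‖R n p‖ * ‖p‖ ^ 2 ≤ (δ n ^ 2)⁻¹ := fun n p hp => by
    have h3 := one_le_norm_one_sub_I_mul (hδ0 n).le hp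
    have h4 : 0 < ‖1 - I * δ n * p‖ := by linarith [h3.1]
    simp only [hR, norm_inv, norm_pow]
    rw [inv_mul_le_iff₀ (by positivity), ← div_eq_mul_inv, le_div_iff₀ (by have := hδ0 n; positivity),
      mul_comm, ← mul_pow]
    have := hδ0 n
    gcongr
    exact h3.2
  have hmem : ∀ n, MemLp (fun p : ℝ => R n p * ψ p) 2 halfLineMeasure := fun n => by
    refine (Lp.memLp ψ).of_le (AEStronglyMeasurable.mul ?_ (Lp.aestronglyMeasurable ψ))
      (Eventually.of_forall fun p => ?_)
    · refine Continuous.aestronglyMeasurable ?_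
      simp only [hR]
      exact Continuous.inv₀ (by fun_prop) fun p => pow_ne_zero 2 (hne n p (by simp))
    · rw [norm_mul]
      exact mul_le_of_le_one_left (norm_nonneg _) (hR1 n p (by simp))
  refine mem_standardSubspace_of_tendsto (u := fun n => (hmem n).toLp _)
    (tendsto_of_mul_bounded (R := fun n p => R n p) (fun n p => hR1 n p (by simp)) (fun p => ?_)
      fun n => (hmem n).coeFn_toLp) fun n => ?_
  · have h2 : Tendsto (fun n => (1 - I * (δ n : ℂ) * p) ^ 2) atTop (𝓝 ((1 - I * ((0 : ℝ) : ℂ) * p) ^ 2)) := by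
      have : Tendsto (fun n => (δ n : ℂ)) atTop (𝓝 ((0 : ℝ) : ℂ)) :=
        (continuous_ofReal.tendsto 0).comp hδ1
      exact ((this.const_mul I).mul_const (p : ℂ)).const_sub 1 |>.pow 2
    have h3 := h2.inv₀ (by simp)
    simpa using h3
  · have hC0 : 0 ≤ C := by
      have := (norm_nonneg _).trans (h1 I (by simp))
      simpa using this
    have hδn := hδ0 n
    refine mem_standardSubspace_of_decay (h := fun p => R n p * h p)
      (C := C + C * (δ n ^ 2)⁻¹) (fun p hp => ?_) (fun p hp => ?_) (fun p hp => ?_) (fun p => ?_) ?_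
    · refine DifferentiableAt.mul ?_ (hd p)
      exact DifferentiableAt.inv (by fun_prop) (pow_ne_zero 2 (hne n p hp))
    · rw [norm_mul]
      calc _ ≤ 1 * (C * ‖p‖) := by gcongr; exacts [hR1 n p hp, h1 p hp]
        _ ≤ _ := by
          rw [one_mul]; gcongr
          have : 0 ≤ C * (δ n ^ 2)⁻¹ := by positivity
          linarith
    · rw [norm_mul]
      calc _ ≤ ‖R n p‖ * (C * ‖p‖) * ‖p‖ := by gcongr; exact h1 p hp
        _ = C * (‖R n p‖ * ‖p‖ ^ 2) := by ring
        _ ≤ C * (δ n ^ 2)⁻¹ := by gcongr; exact hR2 n p hp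
        _ ≤ _ := by linarith
    · simp only [hR, map_mul, map_inv₀, map_pow, map_sub, map_one, conj_I, conj_ofReal, hsymm]
      ring_nf
    · filter_upwards [hψ, (hmem n).coeFn_toLp] with p h2 h3
      rw [h3, h2]

/-- The phase `e^{-iap}` has modulus `e^{a Im p}`, which cancels the exponential in the bound and
leaves linear growth. -/
theorem transl_neg_mem_standardSubspace {F : ℂ → ℂ} (hF : Differentiable ℂ F)
    (hsymm : ∀ p : ℝ, F (-p) = conj (F p)) {a C : ℝ}
    (hb : ∀ p : ℂ, 0 ≤ p.im → ‖F p‖ ≤ C * ‖p‖ * Real.exp (-a * p.im)) {ψ : Hilb}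
    (hψ : ∀ᵐ p : ℝ ∂halfLineMeasure, ψ p = F p) : transl (-a) ψ ∈ standardSubspace := by
  refine mem_standardSubspace_of_entire (h := fun p => cexp (-(I * a * p)) * F p)
    (Differentiable.mul (by fun_prop) hF) (C := C) (fun p hp => ?_) (fun p => ?_) ?_
  · rw [norm_mul, Complex.norm_exp]
    calc _ ≤ Real.exp (-(I * a * p)).re * (C * ‖p‖ * Real.exp (-a * p.im)) := by
          gcongr; exact hb p hp
      _ = C * ‖p‖ := by
          rw [mul_left_comm, ← Real.exp_add]
          simp
  · rw [hsymm, map_mul, ← Complex.exp_conj]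
    simp
  · filter_upwards [hψ, coeFn_transl (-a) ψ] with p h1 h2
    rw [h2, h1]
    push_cast
    ring_nf

/-- Since `J T(-b) = T(b) J` and `Jψ` is represented by `F(-p)`, this is the upper half plane
criterion after the reflection `p ↦ -p`. -/
theorem modConj_transl_neg_mem_standardSubspace {F : ℂ → ℂ} (hF : Differentiable ℂ F)
    (hsymm : ∀ p : ℝ, F (-p) = conj (F p)) {b C : ℝ}
    (hb : ∀ p : ℂ, p.im ≤ 0 → ‖F p‖ ≤ C * ‖p‖ * Real.exp (-b * p.im)) {ψ : Hilb}
    (hψ : ∀ᵐ p : ℝ ∂halfLineMeasure, ψ p = F p) :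
    modConj (transl (-b) ψ) ∈ standardSubspace := by
  have h1 : modConj (transl (-b) ψ) = transl (-(-b)) (modConj ψ) := by
    refine Lp.ext ?_
    filter_upwards [coeFn_transl (-b) ψ, coeFn_modConj ψ, coeFn_modConj (transl (-b) ψ),
      coeFn_transl (-(-b)) (modConj ψ)] with p h1 h2 h3 h4
    rw [h3, h4, h1, h2, map_mul, ← Complex.exp_conj]
    simp
  rw [h1]
  refine transl_neg_mem_standardSubspace (F := fun p => F (-p)) (hF.comp differentiable_neg)
    (fun p => ?_) (C := C) (fun p hp => ?_) ?_
  · have := hsymm (-p)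
    simpa using this
  · have := hb (-p) (by simpa using hp)
    simpa using this
  · filter_upwards [hψ, coeFn_modConj ψ] with p h1 h2
    rw [h2, h1, hsymm]

/-- The upper half plane controls the left end of the interval and the lower half plane the right
end, the latter through `JH ⊆ H'` and `J² = 1`. -/
theorem mem_localSubspace_of_entire {F : ℂ → ℂ} (hF : Differentiable ℂ F)
    (hsymm : ∀ p : ℝ, F (-p) = conj (F p)) {a b C : ℝ}
    (ha : ∀ p : ℂ, 0 ≤ p.im → ‖F p‖ ≤ C * ‖p‖ * Real.exp (-a * p.im))
    (hb : ∀ p : ℂ, p.im ≤ 0 → ‖F p‖ ≤ C * ‖p‖ * Real.exp (-b * p.im)) {ψ : Hilb}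
    (hψ : ∀ᵐ p : ℝ ∂halfLineMeasure, ψ p = F p) : ψ ∈ localSubspace a b := by
  rw [mem_localSubspace_iff]
  refine ⟨transl_neg_mem_standardSubspace hF hsymm ha hψ, ?_⟩
  have := modConj_mem_symplecticComplement (modConj_transl_neg_mem_standardSubspace hF hsymm hb hψ)
  rwa [modConj_modConj] at this

/-! ### Test vectors and their symplectic pairing -/

theorem exists_eq_zero_of_hasCompactSupport {g : ℝ → ℝ} (hg : HasCompactSupport g) :
    ∃ R : ℝ, ∀ x, x ∉ Icc (-R) R → g x = 0 := by
  obtain ⟨R, hR⟩ := hg.isBounded.subset_closedBall 0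
  refine ⟨R, fun x hx => image_eq_zero_of_notMem_tsupport fun h => hx ?_⟩
  simpa [Real.closedBall_eq_Icc] using hR h

theorem integrable_ofReal_test {f : ℝ → ℝ} (hf : Continuous f) (hs : HasCompactSupport f) :
    Integrable fun x => (f x : ℂ) :=
  (hf.integrable_of_hasCompactSupport hs).ofReal

theorem differentiable_entireHat_test {f : ℝ → ℝ} (hf : Continuous f) (hs : HasCompactSupport f) :
    Differentiable ℂ (entireHat fun x => (f x : ℂ)) := by
  obtain ⟨R, hR⟩ := exists_eq_zero_of_hasCompactSupport hs
  refine differentiable_entireHat (integrable_ofReal_test hf hs) (a := -R) (b := R) fun x hx => ?_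
  simp [hR x hx]

theorem derivHat_eq {f : ℝ → ℝ} (hf : ContDiff ℝ (⊤ : ℕ∞) f) (hs : HasCompactSupport f) (p : ℝ) :
    derivHat f p = -I * p * entireHat (fun x => (f x : ℂ)) p :=
  entireHat_deriv hf hs p

theorem integrable_halfLine_iff {f : ℝ → ℂ} :
    Integrable f halfLineMeasure ↔ IntegrableOn (fun p => ((p⁻¹ : ℝ) : ℂ) * f p) (Ioi 0) := by
  rw [halfLineMeasure, integrable_withDensity_iff_integrable_smul' (by fun_prop)
    (Eventually.of_forall fun p => ENNReal.ofReal_lt_top), IntegrableOn]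
  refine integrable_congr ?_
  filter_upwards [ae_restrict_mem measurableSet_Ioi] with p hp
  rw [ENNReal.toReal_ofReal (inv_nonneg.mpr (le_of_lt hp)), Complex.real_smul]

theorem integral_halfLine (f : ℝ → ℂ) :
    ∫ p, f p ∂halfLineMeasure = ∫ p in Ioi (0 : ℝ), ((p⁻¹ : ℝ) : ℂ) * f p := by
  rw [halfLineMeasure, integral_withDensity_eq_integral_toReal_smul (by fun_prop)
    (Eventually.of_forall fun p => ENNReal.ofReal_lt_top)]
  refine integral_congr_ae ?_
  filter_upwards [ae_restrict_mem measurableSet_Ioi] with p hp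
  rw [ENNReal.toReal_ofReal (inv_nonneg.mpr (le_of_lt hp)), Complex.real_smul]

theorem restrict_absolutelyContinuous_halfLine :
    (volume.restrict (Ioi (0 : ℝ))) ≪ halfLineMeasure := by
  refine withDensity_absolutelyContinuous' (by fun_prop) ?_
  filter_upwards [ae_restrict_mem measurableSet_Ioi] with p hp
  simpa using hp

theorem ae_halfLine_iff {P : ℝ → Prop} :
    (∀ᵐ p ∂halfLineMeasure, P p) ↔ ∀ᵐ p : ℝ, 0 < p → P p := by
  have h0 := ae_restrict_iff' (μ := volume) (p := P) (measurableSet_Ioi (a := (0 : ℝ)))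
  simp only [mem_Ioi] at h0
  rw [← h0]
  exact ⟨fun h => restrict_absolutelyContinuous_halfLine.ae_le h,
    fun h => (withDensity_absolutelyContinuous _ _).ae_le h⟩

theorem memLp_halfLine_of_bound {g : ℝ → ℂ} (hg : Continuous g) {C : ℝ}
    (h1 : ∀ p, 0 < p → ‖g p‖ ≤ C * p) (h2 : ∀ p, 0 < p → ‖g p‖ * p ≤ C) :
    MemLp g 2 halfLineMeasure := by
  rw [memLp_two_iff_integrable_sq_norm hg.aestronglyMeasurable]
  have hc : Integrable (fun p => ((‖g p‖ ^ 2 : ℝ) : ℂ)) halfLineMeasure := by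
    rw [integrable_halfLine_iff]
    -- From `|g| ≤ C min(p, 1/p)` one gets `|g|²/p ≤ C² ≤ 2C²/(1+p²)` for `p ≤ 1` and `|g|²/p ≤
    -- C²/p³ ≤ 2C²/(1+p²)` for `p ≥ 1`.
    refine ((integrable_inv_one_add_sq.const_mul (2 * C ^ 2)).integrableOn (s := Ioi 0)).mono'
      (by fun_prop) ?_
    filter_upwards [ae_restrict_mem measurableSet_Ioi] with p hp
    have hp : 0 < p := hp
    rw [norm_mul, norm_real, norm_real, norm_pow, norm_norm, norm_inv, Real.norm_of_nonneg hp.le,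
      ← div_eq_mul_inv, le_div_iff₀ (by positivity), inv_mul_eq_div, div_mul_eq_mul_div,
      div_le_iff₀ hp]
    have h3 := h1 p hp
    have h4 := h2 p hp
    have h5 := norm_nonneg (g p)
    have h6 : 0 ≤ C := by nlinarith
    rcases le_total p 1 with hp1 | hp1
    · have : ‖g p‖ ^ 2 ≤ (C * p) ^ 2 := by gcongr
      have h7 : p ^ 2 ≤ p := by nlinarith
      have h8 : p ^ 2 ≤ 1 := by nlinarith
      have h9 : 0 ≤ C ^ 2 * p ^ 2 := by positivity
      have h10 : 0 ≤ C ^ 2 := by positivity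
      nlinarith [sq_nonneg ‖g p‖]
    · have : (‖g p‖ * p) ^ 2 ≤ C ^ 2 := by gcongr
      have h7 : ‖g p‖ ^ 2 ≤ (‖g p‖ * p) ^ 2 := by
        rw [mul_pow]
        exact le_mul_of_one_le_right (sq_nonneg _) (one_le_pow₀ hp1)
      have h10 : 0 ≤ C ^ 2 := by positivity
      nlinarith
  exact hc.re.congr (Eventually.of_forall fun p => ofReal_re _)

theorem exists_norm_entireHat_test_le {f : ℝ → ℝ} (hf : Continuous f) (hs : HasCompactSupport f) :
    ∃ C : ℝ, 0 < C ∧ ∀ (z : ℂ) (M : ℝ), (∀ x, f x ≠ 0 → -z.im * x ≤ M) →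
      ‖entireHat (fun x => (f x : ℂ)) z‖ ≤ C * Real.exp M := by
  obtain ⟨C, hC, h⟩ := exists_norm_entireHat_le _ (integrable_ofReal_test hf hs)
  exact ⟨C, hC, fun z M hM => h z M fun x hx => hM x (by simpa using hx)⟩

/-- The transform of `f'` is `-ip` times a bounded function, which settles small `p`; multiplied by
`p` it is, up to a phase, the bounded transform of `f''`, which settles large `p`. -/
theorem memLp_derivHat {f : ℝ → ℝ} (hf : ContDiff ℝ (⊤ : ℕ∞) f) (hs : HasCompactSupport f) :
    MemLp (derivHat f) 2 halfLineMeasure := by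
  have hd1 : ContDiff ℝ (⊤ : ℕ∞) (deriv f) := hf.deriv'
  obtain ⟨C, hC, hb⟩ := exists_norm_entireHat_test_le hf.continuous hs
  obtain ⟨C', hC', hb'⟩ := exists_norm_entireHat_test_le (hd1.continuous_deriv (by simp)) hs.deriv.deriv
  have hcont : Continuous (derivHat f) := by
    have := (differentiable_entireHat_test hd1.continuous hs.deriv).continuous
    exact this.comp continuous_ofReal
  refine memLp_halfLine_of_bound (C := C + C') hcont (fun p hp => ?_) fun p hp => ?_
  · have := hb p 0 (by simp)
    rw [derivHat_eq hf hs, norm_mul, norm_mul, norm_neg, norm_I, one_mul, norm_real,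
      Real.norm_of_nonneg hp.le, mul_comm]
    gcongr
    rw [Real.exp_zero, mul_one] at this
    linarith
  · have h1 := hb' p 0 (by simp)
    rw [entireHat_deriv hd1 hs.deriv, norm_mul, norm_mul, norm_neg, norm_I, one_mul, norm_real,
      Real.norm_of_nonneg hp.le, Real.exp_zero, mul_one, mul_comm] at h1
    have h2 : entireHat (fun x => ((deriv f x : ℝ) : ℂ)) p = derivHat f p := rfl
    rw [h2] at h1
    linarith

theorem derivHat_neg_bounds {f : ℝ → ℝ} (hf : ContDiff ℝ (⊤ : ℕ∞) f) (hs : HasCompactSupport f) :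
    ∃ C : ℝ, ∀ (z : ℂ) (M : ℝ), (∀ x, f x ≠ 0 → -z.im * x ≤ M) →
      ‖entireHat (fun x => ((deriv f x : ℝ) : ℂ)) z‖ ≤ C * ‖z‖ * Real.exp M := by
  obtain ⟨C, -, hb⟩ := exists_norm_entireHat_test_le hf.continuous hs
  refine ⟨C, fun z M hM => ?_⟩
  rw [entireHat_deriv hf hs, norm_mul, norm_mul, norm_neg, norm_I, one_mul, mul_comm, mul_right_comm]
  gcongr
  exact hb z M hM

theorem differentiable_entireHat_deriv {f : ℝ → ℝ} (hf : ContDiff ℝ (⊤ : ℕ∞) f)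
    (hs : HasCompactSupport f) : Differentiable ℂ (entireHat fun x => ((deriv f x : ℝ) : ℂ)) :=
  differentiable_entireHat_test (hf.continuous_deriv (by simp)) hs.deriv

theorem entireHat_neg_ofReal (f : ℝ → ℝ) (p : ℝ) :
    entireHat (fun x => (f x : ℂ)) (-p) = conj (entireHat (fun x => (f x : ℂ)) p) := by
  simpa using entireHat_neg_conj f p

theorem mem_localSubspace_of_derivHat {f : ℝ → ℝ} (hf : ContDiff ℝ (⊤ : ℕ∞) f)
    (hs : HasCompactSupport f) {a b : ℝ} (hab : ∀ x, f x ≠ 0 → x ∈ Icc a b) {ψ : Hilb}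
    (hψ : ψ =ᵐ[halfLineMeasure] derivHat f) : ψ ∈ localSubspace a b := by
  obtain ⟨C, hC⟩ := derivHat_neg_bounds hf hs
  exact mem_localSubspace_of_entire (differentiable_entireHat_deriv hf hs)
    (entireHat_neg_ofReal _) (fun p hp => hC p _ fun x hx => by nlinarith [(hab x hx).1])
    (fun p hp => hC p _ fun x hx => by nlinarith [(hab x hx).2]) hψ

/-- The vector given by a test function. -/
def testVector (f : ℝ → ℝ) (hf : ContDiff ℝ (⊤ : ℕ∞) f) (hs : HasCompactSupport f) : Hilb :=
  (memLp_derivHat hf hs).toLp _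

theorem coeFn_testVector {f : ℝ → ℝ} (hf : ContDiff ℝ (⊤ : ℕ∞) f) (hs : HasCompactSupport f) :
    testVector f hf hs =ᵐ[halfLineMeasure] derivHat f := MemLp.coeFn_toLp _

theorem inner_transl_transl (a : ℝ) (ψ χ : Hilb) : ⟪transl a ψ, transl a χ⟫_ℂ = ⟪ψ, χ⟫_ℂ := by
  rw [inner_transl_left, transl_transl, neg_add_cancel, transl_zero]

/-- A test vector right of `b` lies in `T(b)H`, where the component `T(b)H'` of `ψ` applies. For one
left of `a`, `J` carries its translate by `-a` into `H`, and `JH ⊆ H'` is paired with the translate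
of `ψ` in `H`. -/
theorem im_inner_testVector_eq_zero {a b : ℝ} {ψ : Hilb} (hψ : ψ ∈ localSubspace a b)
    {f : ℝ → ℝ} (hf : ContDiff ℝ (⊤ : ℕ∞) f) (hs : HasCompactSupport f)
    (hab : tsupport f ⊆ Iio a ∨ tsupport f ⊆ Ioi b) : (⟪testVector f hf hs, ψ⟫_ℂ).im = 0 := by
  rw [mem_localSubspace_iff] at hψ
  obtain ⟨C, hC⟩ := derivHat_neg_bounds hf hs
  rcases hab with h | h
  · have h1 := modConj_transl_neg_mem_standardSubspace (differentiable_entireHat_deriv hf hs)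
      (entireHat_neg_ofReal _) (b := a) (C := C) (fun p hp => hC p _ fun x hx => by
        have : x < a := h (subset_tsupport f hx)
        nlinarith) (coeFn_testVector hf hs)
    have h2 := im_inner_modConj_eq_zero h1 hψ.1
    rwa [modConj_modConj, inner_transl_transl] at h2
  · have h1 := transl_neg_mem_standardSubspace (differentiable_entireHat_deriv hf hs)
      (entireHat_neg_ofReal _) (a := b) (C := C) (fun p hp => hC p _ fun x hx => by
        have : b < x := h (subset_tsupport f hx)
        nlinarith) (coeFn_testVector hf hs)
    have h2 := hψ.2 _ h1
    rw [inner_transl_transl, ← inner_conj_symm, conj_im] at h2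
    linarith

theorem integrable_schwartz_mul_skewExt (φ : 𝓢(ℝ, ℂ)) (ψ : Hilb) :
    Integrable fun p => φ p * skewExt ψ p := by
  have ht : (fun p : ℝ => (p : ℂ) + I).HasTemperateGrowth :=
    (Complex.ofRealCLM).hasTemperateGrowth.add (Function.HasTemperateGrowth.const I)
  refine (integrable_schwartz_mul_of_memLp
    (SchwartzMap.smulLeftCLM ℂ (fun p : ℝ => (p : ℂ) + I) φ) (memLp_skewExt_div ψ)).congr
    (Eventually.of_forall fun p => ?_)
  have hne : (p : ℂ) + I ≠ 0 := fun h => by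
    have := congrArg Complex.im h
    simp at this
  simp only [SchwartzMap.smulLeftCLM_apply_apply ht, smul_eq_mul]
  field_simp

theorem schwartzCheck_testSchwartz {f : ℝ → ℝ} (hf : ContDiff ℝ (⊤ : ℕ∞) f)
    (hs : HasCompactSupport f) (p : ℝ) :
    schwartzCheck (testSchwartz f hf hs) p = entireHat (fun x => (f x : ℂ)) (-p) := by
  rw [schwartzCheck_apply, entireHat]
  congr 1
  refine integral_congr_ae (Eventually.of_forall fun x => ?_)
  simp only [testSchwartz_apply]
  ring_nf

theorem integral_eq_of_skew {g : ℝ → ℂ} (hg : Integrable g) (hskew : ∀ p, 0 < p → g (-p) = conj (g p)) :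
    ∫ p, g p = ((2 * (∫ p in Ioi (0 : ℝ), g p).re : ℝ) : ℂ) := by
  rw [← intervalIntegral.integral_Iic_add_Ioi (b := 0) hg.integrableOn hg.integrableOn]
  have h1 : ∫ p in Iic (0 : ℝ), g p = conj (∫ p in Ioi (0 : ℝ), g p) := by
    have := integral_comp_neg_Ioi (0 : ℝ) g
    rw [neg_zero] at this
    rw [← this, ← integral_conj]
    exact setIntegral_congr_fun measurableSet_Ioi fun p hp => hskew p hp
  rw [h1, add_comm, add_conj]

theorem inner_testVector {f : ℝ → ℝ} (hf : ContDiff ℝ (⊤ : ℕ∞) f) (hs : HasCompactSupport f)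
    (ψ : Hilb) : ⟪testVector f hf hs, ψ⟫_ℂ =
      I * ∫ p in Ioi (0 : ℝ), schwartzCheck (testSchwartz f hf hs) p * skewExt ψ p := by
  rw [L2.inner_def, integral_halfLine, ← integral_const_mul]
  refine integral_congr_ae ?_
  filter_upwards [restrict_absolutelyContinuous_halfLine.ae_le (coeFn_testVector hf hs),
    ae_restrict_mem measurableSet_Ioi] with p h2 hp
  have hp : 0 < p := hp
  have hp0 : (p : ℂ) ≠ 0 := by exact_mod_cast hp.ne'
  rw [h2, derivHat_eq hf hs, schwartzCheck_testSchwartz, entireHat_neg_ofReal, skewExt,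
    if_neg hp.not_gt, RCLike.inner_apply, map_mul, map_mul, map_neg, conj_I, conj_ofReal]
  push_cast
  field_simp

/-- For real `f` the integrand at `-p` is the conjugate of the one at `p`, so the integral is twice
the real part over the half line. By `inner_testVector` that real part is the imaginary part of the
scalar product. -/
theorem integral_entireHat_neg_mul_skewExt {f : ℝ → ℝ} (hf : ContDiff ℝ (⊤ : ℕ∞) f)
    (hs : HasCompactSupport f) (ψ : Hilb) :
    ∫ p : ℝ, schwartzCheck (testSchwartz f hf hs) p * skewExt ψ p =
      ((2 * (⟪testVector f hf hs, ψ⟫_ℂ).im : ℝ) : ℂ) := by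
  rw [integral_eq_of_skew (integrable_schwartz_mul_skewExt _ ψ) fun p hp => ?_]
  · rw [inner_testVector]
    simp
  · rw [schwartzCheck_testSchwartz, schwartzCheck_testSchwartz, entireHat_neg_ofReal,
      entireHat_neg_ofReal, skewExt, skewExt, if_pos (by linarith), if_neg hp.not_gt, neg_neg,
      map_mul, ← entireHat_neg_ofReal, ofReal_neg, neg_neg, conj_conj]

/-! ### Support of the inverse Fourier transform -/

/-- The inverse Fourier transform of `ψˢ` vanishes on real test functions supported in `U`. -/
def CheckVanishesOn (ψ : Hilb) (U : Set ℝ) : Prop :=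
  ∀ (f : ℝ → ℝ) (hf : ContDiff ℝ (⊤ : ℕ∞) f) (hs : HasCompactSupport f), tsupport f ⊆ U →
    ∫ p : ℝ, schwartzCheck (testSchwartz f hf hs) p * skewExt ψ p = 0

theorem checkVanishesOn_of_mem_localSubspace {a b : ℝ} {ψ : Hilb} (hψ : ψ ∈ localSubspace a b) :
    CheckVanishesOn ψ (Iio a) ∧ CheckVanishesOn ψ (Ioi b) := by
  refine ⟨fun f hf hs hU => ?_, fun f hf hs hU => ?_⟩
  · rw [integral_entireHat_neg_mul_skewExt, im_inner_testVector_eq_zero hψ hf hs (.inl hU)]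
    simp
  · rw [integral_entireHat_neg_mul_skewExt, im_inner_testVector_eq_zero hψ hf hs (.inr hU)]
    simp

theorem invFourier_skewDistribution_apply (ψ : Hilb) (φ : 𝓢(ℝ, ℂ)) :
    invFourier (skewDistribution ψ) φ = ∫ p : ℝ, schwartzCheck φ p * skewExt ψ p :=
  skewDistribution_apply ψ (schwartzCheck φ)

/-- `Distribution.IsVanishingOn` tests against Schwartz functions; boundedness of `U` makes their
supports compact, and the real and imaginary parts are then admissible real test functions. -/
theorem isVanishingOn_of_checkVanishesOn {ψ : Hilb} {U : Set ℝ} (h : CheckVanishesOn ψ U)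
    (hU : Bornology.IsBounded U) :
    Distribution.IsVanishingOn (invFourier (skewDistribution ψ)) U := by
  intro φ hφ
  have hc : HasCompactSupport φ :=
    Metric.isCompact_of_isClosed_isBounded (isClosed_tsupport _) (hU.subset hφ)
  have hre : ContDiff ℝ (⊤ : ℕ∞) fun x => (φ x).re := Complex.reCLM.contDiff.comp φ.smooth'
  have him : ContDiff ℝ (⊤ : ℕ∞) fun x => (φ x).im := Complex.imCLM.contDiff.comp φ.smooth'
  have hsre : HasCompactSupport fun x => (φ x).re := hc.comp_left (g := Complex.re) rfl
  have hsim : HasCompactSupport fun x => (φ x).im := hc.comp_left (g := Complex.im) rfl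
  have hdec : φ = testSchwartz _ hre hsre + I • testSchwartz _ him hsim := by
    ext x
    rw [add_apply, smul_apply, testSchwartz_apply, testSchwartz_apply,
      smul_eq_mul, mul_comm, re_add_im]
  have h1 := h _ hre hsre ((tsupport_comp_subset (g := Complex.re) rfl φ).trans hφ)
  have h2 := h _ him hsim ((tsupport_comp_subset (g := Complex.im) rfl φ).trans hφ)
  rw [← invFourier_skewDistribution_apply] at h1 h2
  rw [hdec, map_add, map_smul, h1, h2]
  simp

theorem dsupport_subset_of_checkVanishesOn {ψ : Hilb} {r : ℝ} (h1 : CheckVanishesOn ψ (Iio (-r)))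
    (h2 : CheckVanishesOn ψ (Ioi r)) :
    Distribution.dsupport (invFourier (skewDistribution ψ)) ⊆ Icc (-r) r := by
  intro x hx
  by_contra hcon
  rw [mem_Icc, not_and_or, not_le, not_le] at hcon
  revert hx
  rw [imp_false, Distribution.notMem_dsupport_iff]
  rcases hcon with h | h
  · exact ⟨Ioo (x - 1) (-r), isVanishingOn_of_checkVanishesOn
      (fun f hf hs hU => h1 f hf hs (hU.trans Ioo_subset_Iio_self)) (Metric.isBounded_Ioo _ _),
      isOpen_Ioo, by simp [h]⟩
  · exact ⟨Ioo r (x + 1), isVanishingOn_of_checkVanishesOn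
      (fun f hf hs hU => h2 f hf hs (hU.trans Ioo_subset_Ioi_self)) (Metric.isBounded_Ioo _ _),
      isOpen_Ioo, by simp [h]⟩

open scoped Manifold in
-- Vanishing near each point is glued by a finite smooth partition of unity on the compact support
-- of the test function.
theorem checkVanishesOn_compl_dsupport (ψ : Hilb) :
    CheckVanishesOn ψ (Distribution.dsupport (invFourier (skewDistribution ψ)))ᶜ := by
  intro f hf hs hU
  have hloc : ∀ x : tsupport f, ∃ V : Set ℝ,
      Distribution.IsVanishingOn (invFourier (skewDistribution ψ)) V ∧ IsOpen V ∧ (x : ℝ) ∈ V :=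
    fun x => (Distribution.notMem_dsupport_iff _).mp (hU x.2)
  choose V hV hVo hxV using hloc
  obtain ⟨t, ht⟩ := IsCompact.elim_finite_subcover (s := tsupport f) hs V hVo
    fun x hx => mem_iUnion.mpr ⟨⟨x, hx⟩, hxV ⟨x, hx⟩⟩
  obtain ⟨ρ, hρ⟩ := SmoothPartitionOfUnity.exists_isSubordinate 𝓘(ℝ, ℝ) (isClosed_tsupport f)
    (fun i : t => V i) (fun i => hVo i) (by
      intro x hx
      obtain ⟨i, hi, hx⟩ := mem_iUnion₂.mp (ht hx)
      exact mem_iUnion.mpr ⟨⟨i, hi⟩, hx⟩)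
  have hρf : ∀ i, ContDiff ℝ (⊤ : ℕ∞) fun x => ρ i x * f x := fun i =>
    (ρ i).contMDiff.contDiff.mul hf
  have hρs : ∀ i, HasCompactSupport fun x => ρ i x * f x := fun i => hs.mul_left
  have hdec : testSchwartz f hf hs = ∑ i, testSchwartz _ (hρf i) (hρs i) := by
    ext x
    rw [sum_apply]
    simp only [testSchwartz_apply]
    rw [← ofReal_sum, ← Finset.sum_mul]
    by_cases hx : x ∈ tsupport f
    · have := ρ.sum_eq_one hx
      rw [finsum_eq_sum_of_fintype] at this
      rw [this, one_mul]
    · rw [image_eq_zero_of_notMem_tsupport hx, mul_zero]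
  rw [← invFourier_skewDistribution_apply, hdec, map_sum]
  refine Finset.sum_eq_zero fun i _ => hV i _ ?_
  refine Subset.trans ?_ (hρ i)
  refine (tsupport_comp_subset (g := ofReal) ofReal_zero fun x => ρ i x * f x).trans ?_
  exact tsupport_mul_subset_left

theorem checkVanishesOn_mono {ψ : Hilb} {U V : Set ℝ} (h : CheckVanishesOn ψ V) (hUV : U ⊆ V) :
    CheckVanishesOn ψ U := fun f hf hs hU => h f hf hs (hU.trans hUV)

theorem checkVanishesOn_of_dsupport_subset {ψ : Hilb} {r : ℝ}
    (h : Distribution.dsupport (invFourier (skewDistribution ψ)) ⊆ Icc (-r) r) :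
    CheckVanishesOn ψ (Iio (-r)) ∧ CheckVanishesOn ψ (Ioi r) := by
  constructor
  · refine checkVanishesOn_mono (checkVanishesOn_compl_dsupport ψ) fun x hx hx2 => ?_
    exact absurd (h hx2).1 (not_le.mpr hx)
  · refine checkVanishesOn_mono (checkVanishesOn_compl_dsupport ψ) fun x hx hx2 => ?_
    exact absurd (h hx2).2 (not_le.mpr hx)

/-! ### Growth of entire functions -/

theorem entire_eq_of_eq_on_real {F G : ℂ → ℂ} (hF : Differentiable ℂ F) (hG : Differentiable ℂ G)
    (h : ∀ p : ℝ, F p = G p) : F = G := by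
  have hFa : AnalyticOnNhd ℂ F univ := fun z _ => hF.analyticAt z
  have hGa : AnalyticOnNhd ℂ G univ := fun z _ => hG.analyticAt z
  refine hFa.eq_of_frequently_eq hGa (z₀ := 0) ?_
  have ht : Tendsto (fun n : ℕ => (((1 : ℝ) / ((n : ℝ) + 1) : ℝ) : ℂ)) atTop (𝓝[≠] 0) := by
    refine tendsto_nhdsWithin_iff.mpr ⟨?_, Eventually.of_forall fun n => ?_⟩
    · have := (continuous_ofReal.tendsto 0).comp (tendsto_one_div_add_atTop_nhds_zero_nat (𝕜 := ℝ))
      rw [ofReal_zero] at this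
      exact this
    · have : (1 : ℝ) / ((n : ℝ) + 1) ≠ 0 := by positivity
      exact mem_compl_singleton_iff.mpr (ofReal_ne_zero.mpr this)
  exact ht.frequently (Frequently.of_forall fun n => h _)

theorem entire_symm_of_real {F : ℂ → ℂ} (hF : Differentiable ℂ F)
    (h : ∀ p : ℝ, F (-p) = conj (F p)) (z : ℂ) : F (-conj z) = conj (F z) := by
  have h1 : Differentiable ℂ (conj ∘ (fun z => F (-z)) ∘ conj) := fun z => by
    have : DifferentiableAt ℂ (fun z => F (-z)) (conj z) := (hF _).comp _ (by fun_prop)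
    have := this.conj_conj
    rwa [Complex.conj_conj] at this
  have := congrFun (entire_eq_of_eq_on_real h1 hF fun p => by simp [h]) z
  simp only [Function.comp_apply] at this
  rw [← this, Complex.conj_conj]

theorem integrableOn_inv_mul_norm_sq (ψ : Hilb) :
    IntegrableOn (fun p : ℝ => p⁻¹ * ‖ψ p‖ ^ 2) (Ioi 0) := by
  have h1 : Integrable (fun p => ((‖ψ p‖ ^ 2 : ℝ) : ℂ)) halfLineMeasure :=
    ((Lp.memLp ψ).integrable_norm_pow two_ne_zero).ofReal
  rw [integrable_halfLine_iff] at h1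
  refine h1.re.congr (Eventually.of_forall fun p => ?_)
  exact (re_ofReal_mul _ _).trans (by rw [ofReal_re])

theorem integrableOn_inv_mul_norm_sq_of_ae_eq {F : ℂ → ℂ} {ψ : Hilb}
    (hψ : ∀ᵐ p : ℝ ∂halfLineMeasure, F p = ψ p) :
    IntegrableOn (fun p : ℝ => p⁻¹ * ‖F p‖ ^ 2) (Ioi 0) := by
  refine (integrableOn_inv_mul_norm_sq ψ).congr ?_
  filter_upwards [restrict_absolutelyContinuous_halfLine.ae_le hψ] with p hp
  rw [hp]

/-- A nonzero value at the origin would make `1/p` integrable near zero, since `|F|²/p` is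
integrable there. -/
theorem apply_zero_of_ae_eq {F : ℂ → ℂ} (hF : Continuous F) {ψ : Hilb}
    (hψ : ∀ᵐ p : ℝ ∂halfLineMeasure, F p = ψ p) : F 0 = 0 := by
  by_contra h0
  have hc : 0 < ‖F 0‖ := norm_pos_iff.mpr h0
  have hcont : ContinuousAt (fun p : ℝ => ‖F p‖) 0 := by
    have : Continuous fun p : ℝ => ‖F p‖ := by fun_prop
    exact this.continuousAt
  have hev : ∀ᶠ p : ℝ in 𝓝 0, ‖F 0‖ / 2 < ‖F p‖ := by
    refine hcont.eventually_const_lt ?_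
    simp only [ofReal_zero]
    linarith
  obtain ⟨ε, hε, hball⟩ := Metric.eventually_nhds_iff.mp hev
  have h1 := (integrableOn_inv_mul_norm_sq_of_ae_eq hψ).mono_set
    (Ioc_subset_Ioi_self : Ioc 0 (ε / 2) ⊆ Ioi 0)
  have h2 : IntegrableOn (fun p : ℝ => p⁻¹) (Ioc 0 (ε / 2)) := by
    refine (h1.const_mul (((‖F 0‖ / 2) ^ 2)⁻¹)).mono' (by fun_prop) ?_
    filter_upwards [ae_restrict_mem measurableSet_Ioc] with p hp
    have hp0 : 0 < p := hp.1
    have h3 := hball (y := p) (by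
      rw [Real.dist_eq, sub_zero, abs_of_pos hp0]; linarith [hp.2])
    rw [norm_inv, Real.norm_of_nonneg hp0.le]
    have h4 : (‖F 0‖ / 2) ^ 2 ≤ ‖F p‖ ^ 2 := by gcongr
    have h5 : 0 < (‖F 0‖ / 2) ^ 2 := by positivity
    calc p⁻¹ = ((‖F 0‖ / 2) ^ 2)⁻¹ * (p⁻¹ * (‖F 0‖ / 2) ^ 2) := by field_simp
      _ ≤ _ := by gcongr
  have h3 : IntervalIntegrable (fun p : ℝ => p⁻¹) volume 0 (ε / 2) :=
    (intervalIntegrable_iff_integrableOn_Ioc_of_le (by positivity)).mpr h2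
  rw [intervalIntegrable_inv_iff] at h3
  rcases h3 with h3 | h3
  · linarith
  · exact h3 left_mem_uIcc

/-- On the unit disc the bound comes from `F(z) = z · dslope F 0 z`, and outside it from `1 + |z| ≤
2|z|`. -/
theorem exists_linear_bound {F : ℂ → ℂ} (hF : Differentiable ℂ F) (h0 : F 0 = 0) {r C : ℝ}
    (hr : 0 ≤ r) (hb : ∀ z, ‖F z‖ ≤ C * (1 + ‖z‖) * Real.exp (r * |z.im|)) :
    ∃ C' : ℝ, 0 < C' ∧ ∀ z, ‖F z‖ ≤ C' * ‖z‖ * Real.exp (r * |z.im|) := by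
  have hd : Continuous (dslope F 0) := by
    rw [← continuousOn_univ]
    exact ((Complex.differentiableOn_dslope univ_mem).mpr hF.differentiableOn).continuousOn
  obtain ⟨M, hM⟩ := (isCompact_closedBall (0 : ℂ) 1).exists_bound_of_continuousOn hd.continuousOn
  refine ⟨|M| + 2 * |C| + 1, by positivity, fun z => ?_⟩
  have he : 1 ≤ Real.exp (r * |z.im|) := Real.one_le_exp (by positivity)
  have hz := norm_nonneg z
  rcases le_total ‖z‖ 1 with h | h
  · have h1 := hM z (by simpa using h)
    have h2 := sub_smul_dslope F 0 z
    rw [sub_zero, h0, sub_zero] at h2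
    rw [← h2, norm_smul]
    calc ‖z‖ * ‖dslope F 0 z‖ ≤ ‖z‖ * (|M| + 2 * |C| + 1) := by
          gcongr
          linarith [le_abs_self M, abs_nonneg C]
      _ = (|M| + 2 * |C| + 1) * ‖z‖ * 1 := by ring
      _ ≤ _ := by gcongr
  · refine (hb z).trans (mul_le_mul_of_nonneg_right ?_ (Real.exp_pos _).le)
    have h1 : C * (1 + ‖z‖) ≤ |C| * (2 * ‖z‖) := by
      refine mul_le_mul (le_abs_self C) (by linarith) (by linarith) (abs_nonneg C)
    nlinarith [abs_nonneg M]

theorem norm_le_upper_of_exponentialType {F : ℂ → ℂ} (hF : Differentiable ℂ F) {r A : ℝ}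
    (hreal : ∀ x : ℝ, ‖F x‖ ≤ A * (1 + |x|))
    (htype : ∀ ε : ℝ, 0 < ε → ∃ C : ℝ, 0 < C ∧ ∀ z, ‖F z‖ ≤ C * Real.exp ((r + ε) * ‖z‖))
    {z : ℂ} (hz : 0 ≤ z.im) : ‖F z‖ ≤ 2 * A * ‖z + I‖ * Real.exp (r * z.im) := by
  have hne : ∀ w : ℂ, 0 ≤ w.re → 1 ≤ ‖w + 1‖ := fun w hw => by
    refine le_trans ?_ (Complex.abs_re_le_norm _)
    rw [add_re, one_re, abs_of_nonneg (by linarith)]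
    linarith
  have hA : 0 ≤ A := by
    have := (norm_nonneg _).trans (hreal 0)
    simpa using this
  have key : ∀ ε : ℝ, 0 < ε → ‖F z‖ ≤ 2 * A * ‖z + I‖ * Real.exp ((r + ε) * z.im) := by
    intro ε hε
    obtain ⟨C, hC, hCb⟩ := htype ε hε
    -- In the rotated variable `w = -iz` the upper half plane becomes the right one. The exponential
    -- makes `f` bounded on the positive axis, and the denominator compensates the linear growth on
    -- the imaginary axis, where `1 + |x| ≤ 2|ix + 1|` accounts for the constant `2A`.
    -- Phragmén–Lindelöf then keeps `2A` independent of `ε`, so `ε` can tend to zero.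
    set f : ℂ → ℂ := fun w => F (I * w) * cexp (-((r + ε : ℝ) * w)) / (w + 1) with hf
    have hnf : ∀ w, ‖f w‖ = ‖F (I * w)‖ * Real.exp (-((r + ε) * w.re)) / ‖w + 1‖ := fun w => by
      rw [hf]
      simp only [norm_div, norm_mul, Complex.norm_exp, neg_re, re_ofReal_mul]
    have hfb : ∀ w : ℂ, 0 ≤ w.re → ‖f w‖ ≤ C * Real.exp ((r + ε) * ‖w‖ - (r + ε) * w.re) := by
      intro w hw
      rw [hnf]
      refine (div_le_self (by positivity) (hne w hw)).trans ?_
      rw [sub_eq_add_neg, Real.exp_add, ← mul_assoc]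
      gcongr
      simpa using hCb (I * w)
    have main := PhragmenLindelof.right_half_plane_of_bounded_on_real (f := f) (C := 2 * A)
      (z := -I * z) ?_ ?_ ?_ ?_ (by simpa using hz)
    · rw [hnf] at main
      have e1 : I * (-I * z) = z := by
        rw [← mul_assoc, mul_neg, I_mul_I]; ring
      have e2 : (-I * z).re = z.im := by simp
      have e3 : ‖-I * z + 1‖ = ‖z + I‖ := by
        have : -I * z + 1 = -I * (z + I) := by
          linear_combination I_sq
        rw [this, norm_mul]
        simp
      have hpos : 0 < ‖z + I‖ := by
        rw [← e3]
        exact lt_of_lt_of_le one_pos (hne _ (by rw [e2]; exact hz))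
      rw [e1, e2, e3, div_le_iff₀ hpos, Real.exp_neg, ← div_eq_mul_inv,
        div_le_iff₀ (Real.exp_pos _)] at main
      exact main
    · refine DifferentiableOn.diffContOnCl fun w hw => DifferentiableAt.differentiableWithinAt ?_
      have hw' : 0 ≤ w.re := by
        have := closure_minimal (t := {w : ℂ | 0 ≤ w.re}) (fun w (hw : 0 < w.re) => hw.le)
          (isClosed_le continuous_const Complex.continuous_re) hw
        exact this
      have h1 : w + 1 ≠ 0 := fun h => by
        have := hne w hw'
        rw [h, norm_zero] at this
        linarith
      have h2 : DifferentiableAt ℂ (fun w => F (I * w)) w :=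
        (hF (I * w)).comp w (by fun_prop)
      exact (h2.mul (by fun_prop)).div (by fun_prop) h1
    · refine ⟨1, by norm_num, |r + ε| * 2, Asymptotics.IsBigO.of_bound C ?_⟩
      refine eventually_inf_principal.mpr (Eventually.of_forall fun w hw => ?_)
      have hw : 0 < w.re := hw
      refine (hfb w hw.le).trans ?_
      rw [Real.rpow_one, Real.norm_of_nonneg (Real.exp_pos _).le]
      gcongr
      have h1 : (r + ε) * ‖w‖ ≤ |r + ε| * ‖w‖ := by gcongr; exact le_abs_self _
      have h2 : -((r + ε) * w.re) ≤ |r + ε| * ‖w‖ := by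
        refine (neg_le_abs _).trans ?_
        rw [abs_mul]
        gcongr
        exact Complex.abs_re_le_norm w
      linarith
    · refine ⟨C, eventually_map.mpr ?_⟩
      filter_upwards [eventually_ge_atTop 0] with x hx
      refine (hfb x (by simpa using hx)).trans ?_
      simp [abs_of_nonneg hx]
    · intro x
      rw [hnf]
      have h1 : I * (x * I) = ((-x : ℝ) : ℂ) := by
        rw [mul_left_comm, I_mul_I]; push_cast; ring
      have h2 : (1 + |x|) ≤ 2 * ‖(x : ℂ) * I + 1‖ := by
        have h3 := Complex.abs_re_le_norm ((x : ℂ) * I + 1)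
        have h4 := Complex.abs_im_le_norm ((x : ℂ) * I + 1)
        simp at h3 h4
        linarith
      have h3 := hreal (-x)
      rw [abs_neg] at h3
      rw [h1, div_le_iff₀ (by nlinarith [abs_nonneg x])]
      have h4 : ((x : ℂ) * I).re = 0 := by simp
      rw [h4, mul_zero, neg_zero, Real.exp_zero, mul_one]
      refine h3.trans ?_
      nlinarith
  have hlim : Tendsto (fun ε : ℝ => 2 * A * ‖z + I‖ * Real.exp ((r + ε) * z.im)) (𝓝[>] 0)
      (𝓝 (2 * A * ‖z + I‖ * Real.exp (r * z.im))) := by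
    have : Continuous fun ε : ℝ => 2 * A * ‖z + I‖ * Real.exp ((r + ε) * z.im) := by fun_prop
    have h1 := this.tendsto 0
    rw [add_zero] at h1
    exact h1.mono_left nhdsWithin_le_nhds
  exact ge_of_tendsto hlim (eventually_nhdsWithin_of_forall fun ε hε => key ε hε)

theorem norm_le_of_exponentialType {F : ℂ → ℂ} (hF : Differentiable ℂ F) {r A : ℝ}
    (hreal : ∀ x : ℝ, ‖F x‖ ≤ A * (1 + |x|))
    (htype : ∀ ε : ℝ, 0 < ε → ∃ C : ℝ, 0 < C ∧ ∀ z, ‖F z‖ ≤ C * Real.exp ((r + ε) * ‖z‖))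
    (z : ℂ) : ‖F z‖ ≤ 2 * A * (‖z‖ + 1) * Real.exp (r * |z.im|) := by
  have hA : 0 ≤ A := by
    have := (norm_nonneg _).trans (hreal 0)
    simpa using this
  have hI : ∀ w : ℂ, ‖w + I‖ ≤ ‖w‖ + 1 := fun w => (norm_add_le _ _).trans (by simp)
  rcases le_total 0 z.im with h | h
  · rw [abs_of_nonneg h]
    refine (norm_le_upper_of_exponentialType hF hreal htype h).trans ?_
    gcongr
    exact hI z
  · rw [abs_of_nonpos h]
    have h1 := norm_le_upper_of_exponentialType (F := fun z => F (-z)) (hF.comp differentiable_neg)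
      (fun x => by simpa using hreal (-x)) (fun ε hε => by
        obtain ⟨C, hC, hb⟩ := htype ε hε
        exact ⟨C, hC, fun z => by simpa using hb (-z)⟩) (z := -z) (by simpa using h)
    rw [neg_neg, neg_im] at h1
    refine h1.trans ?_
    gcongr
    simpa using hI (-z)

/-- Only an integral bound is known on the real axis, so Phragmén–Lindelöf is applied to the
primitive `G` vanishing at the origin. Cauchy's estimate on unit circles recovers `F = G'`, and
`F(0) = 0` then improves `1 + |z|` to `|z|`. -/
theorem exists_linear_bound_of_exponentialType {F : ℂ → ℂ} (hF : Differentiable ℂ F)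
    (hsymm : ∀ p : ℂ, F (-conj p) = conj (F p)) {ψ : Hilb}
    (hψ : ∀ᵐ p : ℝ ∂halfLineMeasure, F p = ψ p) {r : ℝ} (hr : 0 ≤ r)
    (htype : ∀ ε : ℝ, 0 < ε → ∃ C : ℝ, 0 < C ∧ ∀ z, ‖F z‖ ≤ C * Real.exp ((r + ε) * ‖z‖)) :
    ∃ C : ℝ, 0 < C ∧ ∀ z, ‖F z‖ ≤ C * ‖z‖ * Real.exp (r * |z.im|) := by
  obtain ⟨G, hG0, hG⟩ := hF.isExactOn_univ.with_val_at 0 0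
  have hGd : Differentiable ℂ G := fun z => (hG z (mem_univ z)).differentiableAt
  set N : ℝ := ∫ p in Ioi (0 : ℝ), p⁻¹ * ‖F p‖ ^ 2 with hN
  have hint := integrableOn_inv_mul_norm_sq_of_ae_eq hψ
  have hnn : ∀ p ∈ Ioi (0 : ℝ), 0 ≤ p⁻¹ * ‖F p‖ ^ 2 := fun p hp => by
    have : 0 < p := hp
    positivity
  have hN0 : 0 ≤ N := setIntegral_nonneg measurableSet_Ioi hnn
  have hFneg : ∀ x : ℝ, ‖F (-x)‖ = ‖F x‖ := fun x => by
    have := hsymm x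
    rw [conj_ofReal] at this
    rw [this, RCLike.norm_conj]
  have hGpos : ∀ σ : ℝ, |σ| = 1 → ∀ x : ℝ, 0 < x → ‖G ((σ * x : ℝ))‖ ≤ (N + 1) * (1 + |x|) := by
    intro σ hσ x hx
    have hFσ : ∀ t : ℝ, ‖F ((σ * t : ℝ))‖ = ‖F t‖ := fun t => by
      rcases eq_or_eq_neg_of_abs_eq hσ with h | h
      · simp [h]
      · simpa [h] using hFneg t
    have hcont : Continuous fun t : ℝ => F ((σ * t : ℝ)) := by
      have := hF.continuous
      fun_prop
    have hftc : ∫ t in (0 : ℝ)..x, (σ : ℂ) * F ((σ * t : ℝ)) = G ((σ * x : ℝ)) := by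
      have h1 : ∀ t ∈ uIcc 0 x, HasDerivAt (fun t : ℝ => G ((σ * t : ℝ))) (σ * F ((σ * t : ℝ))) t := by
        intro t _
        have h2 : HasDerivAt (fun t : ℝ => ((σ * t : ℝ) : ℂ)) (σ : ℂ) t := by
          simpa using ((hasDerivAt_id t).const_mul σ).ofReal_comp
        have := (hG ((σ * t : ℝ)) (mem_univ _)).comp t h2
        rwa [mul_comm] at this
      rw [intervalIntegral.integral_eq_sub_of_hasDerivAt h1
        ((hcont.const_mul _).intervalIntegrable _ _)]
      simp [hG0]
    have hIoc : IntegrableOn (fun t : ℝ => x * (t⁻¹ * ‖F t‖ ^ 2) + t / x) (Ioc 0 x) := by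
      refine Integrable.add ((hint.mono_set Ioc_subset_Ioi_self).const_mul x) ?_
      exact ((by fun_prop : Continuous fun t : ℝ => t / x).integrableOn_Icc (a := 0) (b := x)).mono_set
        Ioc_subset_Icc_self
    have hbound : ‖∫ t in (0 : ℝ)..x, (σ : ℂ) * F ((σ * t : ℝ))‖ ≤
        ∫ t in Ioc 0 x, (x * (t⁻¹ * ‖F t‖ ^ 2) + t / x) := by
      rw [intervalIntegral.integral_of_le hx.le]
      refine norm_integral_le_of_norm_le hIoc ?_
      filter_upwards [ae_restrict_mem measurableSet_Ioc] with t ht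
      have ht0 : 0 < t := ht.1
      rw [norm_mul, hFσ, norm_real, Real.norm_eq_abs, hσ, one_mul]
      -- Young's inequality `|F| ≤ x|F|²/t + t/x`, weighted so that integration over `(0, x]` yields
      -- at most `xN + x/2`.
      have h1 : x * (t⁻¹ * ‖F t‖ ^ 2) + t / x = ((x * ‖F t‖) ^ 2 + t ^ 2) / (x * t) := by
        field_simp
      rw [h1, le_div_iff₀ (by positivity)]
      nlinarith [sq_nonneg (x * ‖F t‖ - t), sq_nonneg (x * ‖F t‖), sq_nonneg t,
        mul_nonneg (mul_nonneg hx.le (norm_nonneg (F t))) ht0.le]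
    rw [hftc] at hbound
    refine hbound.trans ?_
    have i1 : IntegrableOn (fun t : ℝ => x * (t⁻¹ * ‖F t‖ ^ 2)) (Ioc 0 x) :=
      (hint.mono_set Ioc_subset_Ioi_self).const_mul x
    have i2 : IntegrableOn (fun t : ℝ => t / x) (Ioc 0 x) :=
      ((by fun_prop : Continuous fun t : ℝ => t / x).integrableOn_Icc (a := 0) (b := x)).mono_set
        Ioc_subset_Icc_self
    rw [integral_add i1 i2, integral_const_mul]
    have e1 : ∫ t in Ioc 0 x, t⁻¹ * ‖F t‖ ^ 2 ≤ N :=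
      setIntegral_mono_set hint ((ae_restrict_iff' measurableSet_Ioi).mpr
        (Eventually.of_forall hnn)) (Eventually.of_forall fun t ht => ht.1)
    have e2 : ∫ t in Ioc 0 x, t / x = x / 2 := by
      rw [← intervalIntegral.integral_of_le hx.le, intervalIntegral.integral_div, integral_id]
      field_simp
      ring
    rw [e2, abs_of_pos hx]
    nlinarith
  have hGreal : ∀ x : ℝ, ‖G x‖ ≤ (N + 1) * (1 + |x|) := by
    intro x
    rcases lt_trichotomy x 0 with h | h | h
    · have := hGpos (-1) (by simp) (-x) (by linarith)
      simpa using this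
    · rw [h, ofReal_zero, hG0, norm_zero]
      positivity
    · have := hGpos 1 (by simp) x h
      simpa using this
  have hGtype : ∀ ε : ℝ, 0 < ε → ∃ C : ℝ, 0 < C ∧ ∀ z, ‖G z‖ ≤ C * Real.exp ((r + ε) * ‖z‖) := by
    intro ε hε
    -- The mean value inequality costs a factor `|z|`; the remaining `ε/2` absorbs it.
    obtain ⟨C, hC, hb⟩ := htype (ε / 2) (by positivity)
    refine ⟨2 / ε * C, by positivity, fun z => ?_⟩
    have h1 : ‖G z - G 0‖ ≤ C * Real.exp ((r + ε / 2) * ‖z‖) * ‖z - 0‖ := by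
      refine (convex_closedBall (0 : ℂ) ‖z‖).norm_image_sub_le_of_norm_hasDerivWithin_le
        (fun w _ => (hG w (mem_univ w)).hasDerivWithinAt) (fun w hw => ?_) (by simp) (by simp)
      refine (hb w).trans ?_
      have : ‖w‖ ≤ ‖z‖ := by simpa using hw
      gcongr
    rw [hG0, sub_zero, sub_zero] at h1
    refine h1.trans ?_
    have h2 : ‖z‖ ≤ 2 / ε * Real.exp (ε / 2 * ‖z‖) := by
      have := Real.add_one_le_exp (ε / 2 * ‖z‖)
      rw [div_mul_eq_mul_div, le_div_iff₀ hε]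
      linarith
    calc _ ≤ C * Real.exp ((r + ε / 2) * ‖z‖) * (2 / ε * Real.exp (ε / 2 * ‖z‖)) := by gcongr
      _ = 2 / ε * C * (Real.exp ((r + ε / 2) * ‖z‖) * Real.exp (ε / 2 * ‖z‖)) := by ring
      _ = _ := by rw [← Real.exp_add]; ring_nf
  have hGb := norm_le_of_exponentialType hGd hGreal hGtype
  refine exists_linear_bound hF (apply_zero_of_ae_eq hF.continuous hψ) hr
    (C := 4 * (N + 1) * Real.exp r) fun z => ?_
  have hder : F z = deriv G z := (hG z (mem_univ z)).deriv.symm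
  rw [hder]
  refine (norm_deriv_le_of_forall_mem_sphere_norm_le (R := 1)
    (C := 2 * (N + 1) * (‖z‖ + 2) * Real.exp (r * (|z.im| + 1))) one_pos hGd.diffContOnCl
    fun w hw => ?_).trans ?_
  · have hw1 : ‖w - z‖ = 1 := by simpa [dist_eq_norm] using hw
    have h1 : ‖w‖ ≤ ‖z‖ + 1 := by
      have := norm_le_norm_add_norm_sub' w z
      linarith
    have h2 : |w.im| ≤ |z.im| + 1 := by
      have h3 := (Complex.abs_im_le_norm (w - z)).trans hw1.le
      rw [sub_im] at h3
      have := abs_sub_abs_le_abs_sub w.im z.im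
      linarith
    refine (hGb w).trans ?_
    have h3 : ‖w‖ + 1 ≤ ‖z‖ + 2 := by linarith
    refine mul_le_mul (mul_le_mul_of_nonneg_left h3 (by positivity)) ?_ (Real.exp_pos _).le
      (by positivity)
    gcongr
  · rw [div_one, mul_add r, mul_one, Real.exp_add]
    have := norm_nonneg z
    have he : 0 ≤ (N + 1) * (Real.exp (r * |z.im|) * Real.exp r) := by positivity
    nlinarith

/-! ### Compact support gives an entire extension -/

/-- By Chebyshev, an `L²` function exceeds a positive level only on a set of finite measure. This
eliminates the constants found on unbounded intervals. -/
theorem le_zero_of_memLp_of_norm_ge {G : ℝ → ℂ} (hG : MemLp G 2 volume) {S : Set ℝ}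
    (hS : volume S = ⊤) {c : ℝ} (h : ∀ᵐ x : ℝ, x ∈ S → c ≤ ‖G x‖) : c ≤ 0 := by
  by_contra! hc
  have h1 := hG.meas_ge_lt_top (by norm_num) (by norm_num) (ε := ⟨c, hc.le⟩)
    (fun h => hc.ne' (congrArg NNReal.toReal h))
  have h2 : volume S ≤ volume {x | (⟨c, hc.le⟩ : NNReal) ≤ ‖G x‖₊} := by
    refine measure_mono_ae ?_
    filter_upwards [h] with x hx hxS
    exact hx hxS
  rw [hS, top_le_iff] at h2
  exact h1.ne h2

theorem add_I_ne_zero (p : ℝ) : (p : ℂ) + I ≠ 0 := fun h => by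
  have := congrArg Complex.im h
  simp at this

/-- If the inverse Fourier transform of `ψˢ` vanishes on `U`, then the inverse Fourier transform of
`ψˢ(p) / (p + i)` is a multiple of `e^{-x}` there. -/
theorem ae_eq_exp_of_checkVanishesOn {ψ : Hilb} {U : Set ℝ} (hU : IsOpen U) (hc : U.OrdConnected)
    (hψ : CheckVanishesOn ψ U) {G : ℝ → ℂ} (hG : MemLp G 2 volume)
    (h : ∀ φ : 𝓢(ℝ, ℂ), ∫ x, φ x * G x =
      ∫ p, schwartzCheck φ p * (((p : ℂ) + I)⁻¹ * skewExt ψ p)) :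
    ∃ C : ℂ, ∀ᵐ x : ℝ, x ∈ U → G x = C * Real.exp (-x) := by
  have hloc : LocallyIntegrable fun x : ℝ => ((Real.exp x : ℝ) : ℂ) * G x := by
    have := (hG.locallyIntegrable (by norm_num)).continuous_smul (g := Real.exp) Real.continuous_exp
    simpa using this
  suffices key : ∀ χ : ℝ → ℝ, ContDiff ℝ (⊤ : ℕ∞) χ → HasCompactSupport χ → tsupport χ ⊆ U →
      ∫ x, ((deriv χ x : ℝ) : ℂ) * (((Real.exp x : ℝ) : ℂ) * G x) = 0 by
    obtain ⟨C, hC⟩ := ae_const_of_integral_deriv_eq_zero hU hc hloc key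
    refine ⟨C, ?_⟩
    filter_upwards [hC] with x hx hxU
    rw [← hx hxU, mul_right_comm, ← ofReal_mul, ← Real.exp_add]
    simp
  intro χ hχ hs hsU
  -- With `θ = φ' - φ`, the transforms satisfy `θ̌(p) = i(p+i) φ̌(p)`. Pairing `θ` with `G` thus
  -- cancels the denominator `p + i` and leaves a multiple of the pairing of `φ` with `ψˢ`, which
  -- vanishes. This says that `e^x G` has zero derivative on `U`.
  set φ : ℝ → ℝ := fun x => Real.exp x * χ x with hφ
  set θ : ℝ → ℝ := fun x => Real.exp x * deriv χ x with hθ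
  have hφc : ContDiff ℝ (⊤ : ℕ∞) φ := Real.contDiff_exp.mul hχ
  have hφs : HasCompactSupport φ := hs.mul_left
  have hθc : ContDiff ℝ (⊤ : ℕ∞) θ := Real.contDiff_exp.mul hχ.deriv'
  have hθs : HasCompactSupport θ := hs.deriv.mul_left
  have hφU : tsupport φ ⊆ U := (tsupport_mul_subset_right (f := Real.exp) (g := χ)).trans hsU
  have hder : ∀ x, deriv φ x = φ x + θ x := fun x =>
    ((Real.hasDerivAt_exp x).mul ((hχ.differentiable (by simp)) x).hasDerivAt).deriv
  have hadd : ∀ z : ℂ, entireHat (fun x => ((deriv φ x : ℝ) : ℂ)) z =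
      entireHat (fun x => (φ x : ℂ)) z + entireHat (fun x => (θ x : ℂ)) z := by
    intro z
    rw [entireHat, entireHat, entireHat, ← mul_add, ← integral_add]
    · congr 1
      refine integral_congr_ae (Eventually.of_forall fun x => ?_)
      simp only [hder]
      push_cast
      ring
    · have : Continuous fun x : ℝ => (φ x : ℂ) * cexp (I * z * x) := by
        have := hφc.continuous; fun_prop
      exact this.integrable_of_hasCompactSupport (hφs.comp_left (g := ofReal) ofReal_zero).mul_right
    · have : Continuous fun x : ℝ => (θ x : ℂ) * cexp (I * z * x) := by
        have := hθc.continuous; fun_prop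
      exact this.integrable_of_hasCompactSupport (hθs.comp_left (g := ofReal) ofReal_zero).mul_right
  have h1 := hψ φ hφc hφs hφU
  have h2 := h (testSchwartz θ hθc hθs)
  have h3 : ∀ p : ℝ, schwartzCheck (testSchwartz φ hφc hφs) p * skewExt ψ p =
      -I * (schwartzCheck (testSchwartz θ hθc hθs) p * (((p : ℂ) + I)⁻¹ * skewExt ψ p)) := by
    intro p
    have h4 := hadd (-p)
    rw [entireHat_deriv hφc hφs] at h4
    rw [schwartzCheck_testSchwartz, schwartzCheck_testSchwartz]
    have h5 : entireHat (fun x => (θ x : ℂ)) (-p) =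
        I * (p + I) * entireHat (fun x => (φ x : ℂ)) (-p) := by
      linear_combination -h4 - entireHat (fun x => (φ x : ℂ)) (-p) * I_sq
    rw [h5]
    have := add_I_ne_zero p
    field_simp
    linear_combination entireHat (fun x => (φ x : ℂ)) (-p) * skewExt ψ p * I_sq
  rw [integral_congr_ae (Eventually.of_forall h3), integral_const_mul, ← h2] at h1
  have h6 : ∀ x : ℝ, ((deriv χ x : ℝ) : ℂ) * (((Real.exp x : ℝ) : ℂ) * G x) =
      testSchwartz θ hθc hθs x * G x := by
    intro x
    rw [testSchwartz_apply, hθ]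
    push_cast
    ring
  rw [integral_congr_ae (Eventually.of_forall h6)]
  simpa using h1

theorem skewExt_neg_ae (ψ : Hilb) : ∀ᵐ p : ℝ, skewExt ψ (-p) = conj (skewExt ψ p) := by
  filter_upwards [Measure.ae_ne volume (0 : ℝ)] with p hp
  rcases lt_or_gt_of_ne hp with h | h
  · rw [skewExt, skewExt, if_neg (by linarith), if_pos h, Complex.conj_conj]
  · rw [skewExt, skewExt, if_pos (by linarith), if_neg (by linarith), neg_neg]

theorem ae_halfLine_of_skewExt {F : ℝ → ℂ} {ψ : Hilb} (h : ∀ᵐ p : ℝ, skewExt ψ p = F p) :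
    ∀ᵐ p : ℝ ∂halfLineMeasure, F p = ψ p := by
  rw [ae_halfLine_iff]
  filter_upwards [h] with p hp hp0
  rw [← hp, skewExt, if_neg hp0.not_gt]

theorem ae_skewExt_of_ae_halfLine {F : ℂ → ℂ} {ψ : Hilb} (h : ∀ᵐ p : ℝ ∂halfLineMeasure, F p = ψ p)
    (hsymm : ∀ p : ℝ, F (-p) = conj (F p)) : ∀ᵐ p : ℝ, skewExt ψ p = F p := by
  rw [ae_halfLine_iff] at h
  have h2 : ∀ᵐ p : ℝ, 0 < -p → F ((-p : ℝ)) = ψ (-p) :=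
    (Measure.measurePreserving_neg (volume : Measure ℝ)).quasiMeasurePreserving.ae h
  filter_upwards [h, h2, Measure.ae_ne volume (0 : ℝ)] with p h1 h2 hp
  rcases lt_or_gt_of_ne hp with h | h
  · rw [skewExt, if_pos h, ← h2 (by linarith), ofReal_neg, hsymm, Complex.conj_conj]
  · rw [skewExt, if_neg (by linarith), h1 h]

theorem symm_of_ae_skewExt {F : ℂ → ℂ} (hF : Continuous F) {ψ : Hilb}
    (h : ∀ᵐ p : ℝ, skewExt ψ p = F p) (p : ℝ) : F (-p) = conj (F p) := by
  have h1 : ∀ᵐ p : ℝ, skewExt ψ (-p) = F ((-p : ℝ)) :=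
    (Measure.measurePreserving_neg (volume : Measure ℝ)).quasiMeasurePreserving.ae h
  have h2 : (fun p : ℝ => F (-p)) =ᵐ[volume] fun p : ℝ => conj (F p) := by
    filter_upwards [h, h1, skewExt_neg_ae ψ] with p h1 h2 h3
    rw [← ofReal_neg, ← h2, h3, h1]
  have h3 := (Continuous.ae_eq_iff_eq volume (by fun_prop)
    (continuous_conj.comp (hF.comp continuous_ofReal))).mp h2
  exact congrFun h3 p

theorem entireHat_indicator_exp {r : ℝ} (C : ℂ) {z : ℂ} (hz : 0 ≤ z.im) :
    entireHat ((Ioi r).indicator fun x : ℝ => C * Real.exp (-x)) z =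
      ((Real.sqrt (2 * Real.pi))⁻¹ : ℝ) * (C * (cexp ((I * z - 1) * r) / (1 - I * z))) := by
  rw [entireHat]
  congr 1
  have h1 : ∀ x : ℝ, (Ioi r).indicator (fun x : ℝ => C * ((Real.exp (-x) : ℝ) : ℂ)) x *
      cexp (I * z * x) = (Ioi r).indicator (fun x : ℝ => C * cexp ((I * z - 1) * x)) x := by
    intro x
    by_cases hx : x ∈ Ioi r
    · rw [indicator_of_mem hx, indicator_of_mem hx, mul_assoc, ofReal_exp, ← Complex.exp_add]
      push_cast
      ring_nf
    · rw [indicator_of_notMem hx, indicator_of_notMem hx, zero_mul]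
  rw [integral_congr_ae (Eventually.of_forall h1), integral_indicator measurableSet_Ioi,
    integral_const_mul, integral_exp_mul_complex_Ioi (by simp; linarith)]
  rw [← neg_sub (I * z) 1, div_neg, neg_div]

theorem exists_entire_of_checkVanishesOn {ψ : Hilb} {r : ℝ} (hr : 0 < r)
    (h1 : CheckVanishesOn ψ (Iio (-r))) (h2 : CheckVanishesOn ψ (Ioi r)) :
    ∃ F : ℂ → ℂ, IsSymmetricEntireExtension ψ F ∧
      ∃ C : ℝ, 0 < C ∧ ∀ p : ℂ, ‖F p‖ ≤ C * ‖p‖ * Real.exp (r * |p.im|) := by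
  obtain ⟨G, hG, hGd, hGi⟩ := exists_memLp_schwartzCheck (memLp_skewExt_div ψ)
  obtain ⟨C₁, hC₁⟩ := ae_eq_exp_of_checkVanishesOn isOpen_Iio ordConnected_Iio h1 hG hGd
  obtain ⟨C, hC⟩ := ae_eq_exp_of_checkVanishesOn isOpen_Ioi ordConnected_Ioi h2 hG hGd
  -- On the left `e^{-x}` is bounded below by one, which square integrability excludes unless the
  -- coefficient is zero. On the right the decaying tail may survive.
  have hC10 : C₁ = 0 := by
    have := le_zero_of_memLp_of_norm_ge hG (S := Iio (-r)) Real.volume_Iio (c := ‖C₁‖) (by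
      filter_upwards [hC₁] with x hx hxr
      have hxr' : x < -r := hxr
      rw [hx hxr, norm_mul, norm_real, Real.norm_of_nonneg (Real.exp_pos _).le]
      refine le_mul_of_one_le_right (norm_nonneg _) (Real.one_le_exp (by linarith)))
    exact norm_le_zero_iff.mp this
  subst hC10
  set G₀ : ℝ → ℂ := (Icc (-r) r).indicator G with hG₀
  set G₁ : ℝ → ℂ := (Ioi r).indicator fun x : ℝ => C * Real.exp (-x) with hG₁
  have hi₀ : Integrable G₀ := by
    rw [hG₀, integrable_indicator_iff measurableSet_Icc]
    exact (hG.locallyIntegrable (by norm_num)).integrableOn_isCompact isCompact_Icc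
  have hi₁ : Integrable G₁ := by
    rw [hG₁, integrable_indicator_iff measurableSet_Ioi]
    exact ((integrableOn_exp_neg_Ioi r).ofReal).const_mul C
  have hdec : G =ᵐ[volume] fun x => G₀ x + G₁ x := by
    filter_upwards [hC₁, hC] with x h3 h4
    rw [hG₀, hG₁]
    by_cases hx : x < -r
    · rw [indicator_of_notMem (fun h => absurd h.1 hx.not_ge),
        indicator_of_notMem (fun h => by have : r < x := h; linarith), h3 hx]
      simp
    · by_cases hx2 : r < x
      · rw [indicator_of_notMem (fun h => absurd h.2 hx2.not_ge),
          indicator_of_mem (show x ∈ Ioi r from hx2), h4 hx2, zero_add]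
      · rw [indicator_of_mem (show x ∈ Icc (-r) r from ⟨not_lt.mp hx, not_lt.mp hx2⟩),
          indicator_of_notMem (show x ∉ Ioi r from hx2), add_zero]
  have hP := hGi ((hi₀.add hi₁).congr hdec.symm)
  set s : ℂ := (((Real.sqrt (2 * Real.pi))⁻¹ : ℝ) : ℂ) with hs
  -- The second summand is `z + i` times the transform of the tail, simplified by `(z+i)/(1-iz) =
  -- i`; in this form it is visibly entire.
  set F : ℂ → ℂ := fun z => (z + I) * entireHat G₀ z + s * C * I * cexp ((I * z - 1) * r) with hF
  have hd₀ : Differentiable ℂ (entireHat G₀) :=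
    differentiable_entireHat hi₀ fun x hx => indicator_of_notMem hx _
  have hFd : Differentiable ℂ F := by
    refine Differentiable.add (Differentiable.mul (by fun_prop) hd₀) (by fun_prop)
  have hFae : ∀ᵐ p : ℝ, skewExt ψ p = F p := by
    filter_upwards [hP] with p hp
    have h3 : fourierHat G p = entireHat G₀ p + entireHat G₁ p := by
      rw [entireHat, entireHat, ← mul_add, ← integral_add]
      · rw [fourierHat]
        congr 1
        refine integral_congr_ae ?_
        filter_upwards [hdec] with x hx
        rw [hx]
        ring
      · refine hi₀.mul_bdd (c := 1)
          (by fun_prop : Continuous fun x : ℝ => cexp (I * p * x)).aestronglyMeasurable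
          (Eventually.of_forall fun x => ?_)
        rw [norm_cexp_I_mul]; simp
      · refine hi₁.mul_bdd (c := 1)
          (by fun_prop : Continuous fun x : ℝ => cexp (I * p * x)).aestronglyMeasurable
          (Eventually.of_forall fun x => ?_)
        rw [norm_cexp_I_mul]; simp
    rw [h3, hG₁, entireHat_indicator_exp C (by simp)] at hp
    have hne := add_I_ne_zero p
    have hne2 : (1 : ℂ) - I * p ≠ 0 := by
      intro h0
      apply hne
      linear_combination I * h0 + p * I_sq
    rw [inv_mul_eq_iff_eq_mul₀ hne] at hp
    have h4 : ((p : ℂ) + I) / (1 - I * p) = I := by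
      rw [div_eq_iff hne2]
      linear_combination (p : ℂ) * I_sq
    rw [hp, hF, ← hs]
    simp only
    linear_combination (s * C * cexp ((I * p - 1) * r)) * h4
  have hsymm := symm_of_ae_skewExt hFd.continuous hFae
  have hψ := ae_halfLine_of_skewExt hFae
  refine ⟨F, ⟨hFd, hψ, entire_symm_of_real hFd hsymm⟩, ?_⟩
  obtain ⟨A, hA, hAb⟩ := exists_norm_entireHat_le G₀ hi₀
  refine exists_linear_bound hFd (apply_zero_of_ae_eq hFd.continuous hψ) hr.le
    (C := A + ‖s * C * I‖) fun z => ?_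
  have hb₀ : ‖entireHat G₀ z‖ ≤ A * Real.exp (r * |z.im|) := by
    refine hAb z _ fun x hx => ?_
    have hx' : x ∈ Icc (-r) r := by
      by_contra h
      exact hx (indicator_of_notMem h _)
    have : |x| ≤ r := abs_le.mpr hx'
    calc -z.im * x ≤ |-z.im * x| := le_abs_self _
      _ = |x| * |z.im| := by rw [abs_mul, abs_neg, mul_comm]
      _ ≤ _ := by gcongr
  have hb₁ : ‖cexp ((I * z - 1) * r)‖ ≤ Real.exp (r * |z.im|) := by
    rw [Complex.norm_exp]
    refine Real.exp_le_exp.mpr ?_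
    simp
    nlinarith [neg_abs_le z.im]
  calc ‖F z‖ ≤ ‖z + I‖ * ‖entireHat G₀ z‖ + ‖s * C * I‖ * ‖cexp ((I * z - 1) * r)‖ := by
        rw [← norm_mul, ← norm_mul]
        exact norm_add_le _ _
    _ ≤ (1 + ‖z‖) * (A * Real.exp (r * |z.im|)) + ‖s * C * I‖ * Real.exp (r * |z.im|) := by
        gcongr
        refine (norm_add_le _ _).trans ?_
        rw [norm_I, add_comm]
    _ ≤ _ := by
        have : 0 ≤ ‖s * C * I‖ * Real.exp (r * |z.im|) * ‖z‖ := by positivity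
        nlinarith

theorem mem_localSubspace_of_linear_bound {ψ : Hilb} {r : ℝ} {F : ℂ → ℂ}
    (hF : IsSymmetricEntireExtension ψ F) {C : ℝ}
    (hb : ∀ p : ℂ, ‖F p‖ ≤ C * ‖p‖ * Real.exp (r * |p.im|)) : ψ ∈ localSubspace (-r) r := by
  obtain ⟨hd, hψ, hsymm⟩ := hF
  refine mem_localSubspace_of_entire hd (fun p => by simpa using hsymm p) (C := C)
    (fun p hp => ?_) (fun p hp => ?_) (hψ.mono fun p hp => hp.symm)
  · have := hb p
    rwa [abs_of_nonneg hp, ← neg_neg r] at this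
  · have := hb p
    rw [abs_of_nonpos hp] at this
    simpa using this

theorem tfae_mem_localSubspace {r : ℝ} (hr : 0 < r) (ψ : Hilb) :
    List.TFAE [
      ψ ∈ localSubspace (-r) r,
      Distribution.dsupport (invFourier (skewDistribution ψ)) ⊆ Icc (-r) r,
      ∃ F : ℂ → ℂ, IsSymmetricEntireExtension ψ F ∧
        ∃ C : ℝ, 0 < C ∧ ∀ p : ℂ, ‖F p‖ ≤ C * ‖p‖ * Real.exp (r * |p.im|),
      ∃ F : ℂ → ℂ, IsSymmetricEntireExtension ψ F ∧
        ∀ ε : ℝ, 0 < ε → ∃ C : ℝ, 0 < C ∧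
          ∀ p : ℂ, ‖F p‖ ≤ C * Real.exp ((r + ε) * ‖p‖)] := by
  tfae_have 1 → 2 := fun h =>
    have h' := checkVanishesOn_of_mem_localSubspace h
    dsupport_subset_of_checkVanishesOn h'.1 h'.2
  tfae_have 2 → 3 := fun h =>
    have h' := checkVanishesOn_of_dsupport_subset h
    exists_entire_of_checkVanishesOn hr h'.1 h'.2
  tfae_have 3 → 1 := fun ⟨F, hF, C, _, hb⟩ => mem_localSubspace_of_linear_bound hF hb
  tfae_have 4 → 3 := fun ⟨F, hF, hb⟩ =>
    ⟨F, hF, exists_linear_bound_of_exponentialType hF.1 hF.2.2 hF.2.1 hr.le hb⟩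
  tfae_have 3 → 4 := by
    rintro ⟨F, hF, C, hC, hb⟩
    refine ⟨F, hF, fun ε hε => ⟨C * (1 / ε), by positivity, fun p => (hb p).trans ?_⟩⟩
    have h1 : ‖p‖ ≤ 1 / ε * Real.exp (ε * ‖p‖) := by
      have := Real.add_one_le_exp (ε * ‖p‖)
      rw [div_mul_eq_mul_div, le_div_iff₀ hε]
      linarith
    have h2 : Real.exp (r * |p.im|) ≤ Real.exp (r * ‖p‖) := by
      gcongr
      exact Complex.abs_im_le_norm p
    calc _ ≤ C * (1 / ε * Real.exp (ε * ‖p‖)) * Real.exp (r * ‖p‖) := by gcongr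
      _ = C * (1 / ε) * (Real.exp (r * ‖p‖) * Real.exp (ε * ‖p‖)) := by ring
      _ = _ := by rw [← Real.exp_add, ← add_mul]
  tfae_finish

/-! ### The real square integrable function of a local vector -/

/-- The removable quotient `F(p)/p` is continuous on `[-1, 1]`, and for `|p| ≥ 1` its square is at
most `|F|²/|p|`; symmetry transfers integrability to the negative axis. -/
theorem memLp_dslope_zero {F : ℂ → ℂ} (hF : Differentiable ℂ F)
    (hsymm : ∀ p : ℝ, F (-p) = conj (F p)) {ψ : Hilb}
    (hψ : ∀ᵐ p : ℝ ∂halfLineMeasure, F p = ψ p) :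
    MemLp (fun p : ℝ => dslope F 0 p) 2 volume := by
  have hF0 := apply_zero_of_ae_eq hF.continuous hψ
  have hd : Continuous (dslope F 0) := by
    rw [← continuousOn_univ]
    exact ((Complex.differentiableOn_dslope univ_mem).mpr hF.differentiableOn).continuousOn
  have hc : Continuous fun p : ℝ => dslope F 0 p := hd.comp continuous_ofReal
  have hds : ∀ p : ℝ, p ≠ 0 → ‖dslope F 0 p‖ = |p|⁻¹ * ‖F p‖ := fun p hp => by
    rw [dslope_of_ne _ (by exact_mod_cast hp), slope_def_field, hF0, sub_zero, sub_zero, norm_div,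
      norm_real, Real.norm_eq_abs, div_eq_inv_mul]
  have h1 : IntegrableOn (fun p : ℝ => ‖dslope F 0 p‖ ^ 2) (Ici 1) := by
    refine ((integrableOn_inv_mul_norm_sq_of_ae_eq hψ).mono_set
      (Ici_subset_Ioi.mpr one_pos)).mono' (hc.norm.pow 2).aestronglyMeasurable ?_
    filter_upwards [ae_restrict_mem measurableSet_Ici] with p hp
    have hp : 1 ≤ p := hp
    have hp0 : 0 < p := by linarith
    rw [norm_pow, norm_norm, hds p hp0.ne', abs_of_pos hp0, mul_pow]
    gcongr
    exact pow_le_of_le_one (by positivity) (inv_le_one_of_one_le₀ hp) two_ne_zero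
  have h2 : IntegrableOn (fun p : ℝ => ‖dslope F 0 p‖ ^ 2) (Iic (-1)) := by
    have h3 := (Measure.measurePreserving_neg (volume : Measure ℝ)).integrableOn_comp_preimage
      (Homeomorph.neg ℝ).measurableEmbedding (s := Ici (1 : ℝ))
      (f := fun p : ℝ => ‖dslope F 0 p‖ ^ 2)
    rw [← h3] at h1
    simp only [neg_preimage, neg_Ici] at h1
    refine h1.congr_fun (fun p hp => ?_) measurableSet_Iic
    have hp0 : p ≠ 0 := by
      have : p ≤ -1 := hp
      linarith
    simp only [Function.comp_apply]
    rw [hds _ (neg_ne_zero.mpr hp0), hds _ hp0, abs_neg, ofReal_neg, hsymm, RCLike.norm_conj]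
  rw [memLp_two_iff_integrable_sq_norm hc.aestronglyMeasurable, ← integrableOn_univ]
  refine (h2.union ((hc.norm.pow 2).continuousOn.integrableOn_Icc (a := -1) (b := 1)) |>.union
    h1).mono_set fun p _ => ?_
  simp only [mem_union, mem_Iic, mem_Icc, mem_Ici]
  grind

/-- Testing `G` against `χ'` multiplies `-iF(p)/p` by `ip`, which restores `ψˢ`. So `G` is constant
on `U`, and infinite measure forces the constant to be zero. -/
theorem ae_eq_zero_of_checkVanishesOn {ψ : Hilb} {F : ℂ → ℂ} (hF0 : F 0 = 0)
    (hF : ∀ᵐ p : ℝ, skewExt ψ p = F p) {U : Set ℝ} (hU : IsOpen U) (hc : U.OrdConnected)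
    (htop : volume U = ⊤) (hψ : CheckVanishesOn ψ U) {G : ℝ → ℂ} (hG : MemLp G 2 volume)
    (h : ∀ φ : 𝓢(ℝ, ℂ), ∫ x, φ x * G x = ∫ p : ℝ, schwartzCheck φ p * (-I * dslope F 0 p)) :
    ∀ᵐ x : ℝ, x ∈ U → G x = 0 := by
  obtain ⟨C, hC⟩ := ae_const_of_integral_deriv_eq_zero hU hc (hG.locallyIntegrable (by norm_num))
    fun χ hχ hs hsU => by
      rw [← hψ χ hχ hs hsU]
      refine (h (testSchwartz _ hχ.deriv' hs.deriv)).trans (integral_congr_ae ?_)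
      filter_upwards [hF] with p hp
      have h1 := sub_smul_dslope F 0 (p : ℂ)
      rw [hF0, sub_zero, sub_zero, smul_eq_mul] at h1
      rw [hp, schwartzCheck_testSchwartz, schwartzCheck_testSchwartz, entireHat_deriv hχ hs, ← h1]
      linear_combination (-(p : ℂ) * dslope F 0 p * entireHat (fun x => (χ x : ℂ)) (-p)) * I_sq
  have h0 := le_zero_of_memLp_of_norm_ge hG htop (c := ‖C‖) (by
    filter_upwards [hC] with x hx hxU
    rw [hx hxU])
  filter_upwards [hC] with x hx hxU
  rw [hx hxU, norm_le_zero_iff.mp h0]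

theorem fourierHat_re {g : ℝ → ℂ} (hg : Integrable g) (p : ℝ) :
    fourierHat (fun x => ((g x).re : ℂ)) p = (fourierHat g p + conj (fourierHat g (-p))) / 2 := by
  have hi : ∀ q : ℝ, Integrable fun x : ℝ => g x * cexp (I * q * x) := fun q =>
    hg.mul_bdd (c := 1) (by fun_prop : Continuous fun x : ℝ => cexp (I * q * x)).aestronglyMeasurable
      (Eventually.of_forall fun x => by rw [norm_cexp_I_mul]; simp)
  have hi' : Integrable fun x : ℝ => conj (g x * cexp (I * (-p : ℝ) * x)) :=
    (LinearIsometryEquiv.integrable_comp_iff conjLIE).mpr (hi (-p))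
  rw [fourierHat, fourierHat, fourierHat, map_mul, conj_ofReal, ← integral_conj, ← mul_add,
    ← integral_add (hi p) hi', mul_div_assoc, ← integral_div]
  congr 1
  refine integral_congr_ae (Eventually.of_forall fun x => ?_)
  simp only [map_mul, ← Complex.exp_conj, conj_I, conj_ofReal, re_eq_add_conj]
  push_cast
  ring_nf

theorem exists_real_of_mem_localSubspace_symm {r : ℝ} (hr : 0 < r) {ψ : Hilb}
    (hψ : ψ ∈ localSubspace (-r) r) :
    ∃ f : ℝ → ℝ, MemLp f 2 volume ∧ (∀ x, x ∉ Icc (-r) r → f x = 0) ∧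
      ∀ᵐ p : ℝ ∂halfLineMeasure, -I * ψ p / p = fourierHat (fun x => (f x : ℂ)) p := by
  obtain ⟨hv1, hv2⟩ := checkVanishesOn_of_mem_localSubspace hψ
  obtain ⟨F, ⟨hd, hF, hsymm⟩, -⟩ := exists_entire_of_checkVanishesOn hr hv1 hv2
  have hsymm' : ∀ p : ℝ, F (-p) = conj (F p) := fun p => by simpa using hsymm p
  have hF0 := apply_zero_of_ae_eq hd.continuous hF
  have hskew := ae_skewExt_of_ae_halfLine hF hsymm'
  obtain ⟨G, hG, hGd, hGi⟩ := exists_memLp_schwartzCheck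
    ((memLp_dslope_zero hd hsymm' hF).const_mul (-I))
  have h1 := ae_eq_zero_of_checkVanishesOn hF0 hskew isOpen_Iio ordConnected_Iio
    Real.volume_Iio hv1 hG hGd
  have h2 := ae_eq_zero_of_checkVanishesOn hF0 hskew isOpen_Ioi ordConnected_Ioi
    Real.volume_Ioi hv2 hG hGd
  set g : ℝ → ℂ := (Icc (-r) r).indicator G with hg
  have hgG : G =ᵐ[volume] g := by
    filter_upwards [h1, h2] with x h1 h2
    by_cases hx : x ∈ Icc (-r) r
    · rw [hg, indicator_of_mem hx]
    · rw [hg, indicator_of_notMem hx]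
      rw [mem_Icc, not_and_or, not_le, not_le] at hx
      exact hx.elim h1 h2
  have hgL : MemLp g 2 volume := hG.ae_eq hgG
  have hgi : Integrable g := by
    rw [hg, integrable_indicator_iff measurableSet_Icc]
    exact (hG.locallyIntegrable (by norm_num)).integrableOn_isCompact isCompact_Icc
  have hP := hGi (hgi.congr hgG.symm)
  have hfG : fourierHat G = fourierHat g := by
    ext p
    rw [fourierHat, fourierHat]
    congr 1
    refine integral_congr_ae ?_
    filter_upwards [hgG] with x hx
    rw [hx]
  rw [hfG] at hP
  -- Taking the real part loses nothing: `-iF(p)/p` at `-p` is the conjugate of its value at `p`, so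
  -- its transform already equals that of the real part.
  refine ⟨fun x => (g x).re, hgL.re, fun x hx => ?_, ?_⟩
  · simp only [hg, indicator_of_notMem hx, zero_re]
  have hPn := (Measure.measurePreserving_neg (volume : Measure ℝ)).quasiMeasurePreserving.ae hP
  rw [ae_halfLine_iff] at hF ⊢
  filter_upwards [hF, hP, hPn] with p hp h3 h4 hp0
  have hpc : (p : ℂ) ≠ 0 := by exact_mod_cast hp0.ne'
  have hds : ∀ q : ℂ, q ≠ 0 → dslope F 0 q = F q / q := fun q hq => by
    rw [dslope_of_ne _ hq, slope_def_field, hF0, sub_zero, sub_zero]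
  rw [fourierHat_re hgi, ← h3, ← h4, ofReal_neg, hds _ hpc, hds _ (neg_ne_zero.mpr hpc), hsymm',
    ← hp hp0]
  simp only [map_mul, map_div₀, map_neg, conj_I, conj_conj, conj_ofReal]
  field_simp
  ring

theorem exists_real_of_mem_localSubspace {a b : ℝ} (hab : a < b) {ψ : Hilb}
    (hψ : ψ ∈ localSubspace a b) :
    ∃ f : ℝ → ℝ, MemLp f 2 volume ∧ (∀ x, x ∉ Icc a b → f x = 0) ∧
      ∀ᵐ p : ℝ ∂halfLineMeasure, -I * ψ p / p = fourierHat (fun x => (f x : ℂ)) p := by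
  set m : ℝ := (a + b) / 2 with hm
  have h1 : transl (-m) ψ ∈ localSubspace (-((b - a) / 2)) ((b - a) / 2) := by
    have := (transl_mem_localSubspace_iff a b (-m) ψ).mpr hψ
    convert this using 2 <;> ring
  obtain ⟨f, hf, hs, hp⟩ := exists_real_of_mem_localSubspace_symm (by linarith) h1
  refine ⟨fun x => f (x - m), hf.comp_measurePreserving (measurePreserving_sub_right volume m),
    fun x hx => hs _ fun h => hx ?_, ?_⟩
  · constructor <;> linarith [h.1, h.2]
  · filter_upwards [hp, coeFn_transl (-m) ψ] with p h2 h3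
    have h4 := entireHat_translate (fun x => (f x : ℂ)) m p
    rw [entireHat_ofReal, entireHat_ofReal, ← h2, h3] at h4
    rw [h4]
    have h5 : cexp (I * m * p) * cexp (I * (-m : ℝ) * p) = 1 := by
      rw [← Complex.exp_add]
      push_cast
      ring_nf
      exact Complex.exp_zero
    linear_combination (I * ψ p / p) * h5

theorem testVectors_subset_localSubspace (a b : ℝ) : testVectors a b ⊆ localSubspace a b := by
  rintro ψ ⟨f, hf, hs, hab, hψ⟩
  exact mem_localSubspace_of_derivHat hf hs
    (fun x hx => Ioo_subset_Icc_self (hab (subset_tsupport f hx))) hψ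

/-! ### Boundary uniqueness in the upper half plane -/

theorem cexp_add_one_ne_zero {w : ℂ} (h0 : 0 ≤ w.re) (h1 : w.re < Real.pi) :
    cexp (I * w) + 1 ≠ 0 := by
  intro h
  have him := congrArg Complex.im h
  have hre := congrArg Complex.re h
  simp only [add_im, add_re, exp_im, exp_re, one_im, one_re, zero_im, zero_re, mul_im, mul_re, I_re,
    I_im, zero_mul, one_mul, zero_sub, zero_add, add_zero, mul_eq_zero, (Real.exp_pos _).ne',
    false_or] at him hre
  rcases h0.eq_or_lt with h0 | h0
  · rw [← h0, Real.cos_zero] at hre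
    have := Real.exp_pos (-w.im)
    linarith
  · exact (Real.sin_pos_of_pos_of_lt_pi h0 h1).ne' him

theorem im_sub_one_div_add_one (E : ℂ) : ((E - 1) / (E + 1)).im = 2 * E.im / normSq (E + 1) := by
  rw [div_im]
  simp
  ring

/-- A holomorphic map from the strip `0 ≤ Re w ≤ 1` to the closed upper half plane that takes the
left boundary line into the interval `(-d, d)`. -/
def stripMap (d α : ℝ) (w : ℂ) : ℂ :=
  d * ((cexp (I * (α * w)) - 1) / (cexp (I * (α * w)) + 1))

section stripMap

variable {d α : ℝ}

theorem cexp_strip_add_one_ne_zero (hα : 0 ≤ α) (hαπ : α < Real.pi) {w : ℂ}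
    (hw : w.re ∈ Icc (0 : ℝ) 1) : cexp (I * (α * w)) + 1 ≠ 0 := by
  refine cexp_add_one_ne_zero ?_ ?_
  · rw [re_ofReal_mul]
    exact mul_nonneg hα hw.1
  · rw [re_ofReal_mul]
    nlinarith [hw.2]

theorem differentiableAt_stripMap (hα : 0 ≤ α) (hαπ : α < Real.pi) {w : ℂ}
    (hw : w.re ∈ Icc (0 : ℝ) 1) : DifferentiableAt ℂ (stripMap d α) w := by
  have h : DifferentiableAt ℂ (fun w : ℂ => cexp (I * (α * w))) w := by fun_prop
  exact ((h.sub_const 1).div (h.add_const 1) (cexp_strip_add_one_ne_zero hα hαπ hw)).const_mul _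

theorem im_stripMap (d α : ℝ) (w : ℂ) : (stripMap d α w).im =
    d * (2 * (Real.exp (-(α * w.im)) * Real.sin (α * w.re)) /
      normSq (cexp (I * (α * w)) + 1)) := by
  rw [stripMap, im_ofReal_mul, im_sub_one_div_add_one, exp_im]
  simp

theorem im_stripMap_nonneg (hd : 0 ≤ d) (hα : 0 ≤ α) (hαπ : α < Real.pi) {w : ℂ}
    (hw : w.re ∈ Icc (0 : ℝ) 1) : 0 ≤ (stripMap d α w).im := by
  rw [im_stripMap]
  have h1 : 0 ≤ Real.sin (α * w.re) :=
    Real.sin_nonneg_of_nonneg_of_le_pi (mul_nonneg hα hw.1) (by nlinarith [hw.2])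
  have h2 := normSq_nonneg (cexp (I * (α * w)) + 1)
  positivity

theorem im_stripMap_pos (hd : 0 < d) (hα : 0 < α) (hαπ : α < Real.pi) {w : ℂ}
    (hw : w.re ∈ Ioo (0 : ℝ) 1) : 0 < (stripMap d α w).im := by
  rw [im_stripMap]
  have h1 : 0 < Real.sin (α * w.re) :=
    Real.sin_pos_of_pos_of_lt_pi (mul_pos hα hw.1) (by nlinarith [hw.2])
  have h2 := normSq_pos.mpr (cexp_strip_add_one_ne_zero hα.le hαπ (Ioo_subset_Icc_self hw))
  positivity

theorem stripMap_eq_ofReal (hd : 0 < d) {w : ℂ} (hw : w.re = 0) :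
    ∃ t : ℝ, |t| < d ∧ stripMap d α w = t := by
  set e : ℝ := Real.exp (-(α * w.im)) with he
  have he0 : 0 < e := Real.exp_pos _
  have h1 : cexp (I * (α * w)) = e := by
    rw [he, ofReal_exp]
    congr 1
    apply Complex.ext <;> simp [hw]
  refine ⟨d * ((e - 1) / (e + 1)), ?_, by rw [stripMap, h1]; push_cast; rfl⟩
  rw [abs_mul, abs_of_pos hd]
  refine mul_lt_of_lt_one_right hd ?_
  rw [abs_div, abs_of_pos (by linarith : 0 < e + 1), div_lt_one (by linarith), abs_lt]
  constructor <;> linarith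

/-- The Möbius inverse `E = (d+z)/(d-z)` preserves the upper half plane, so `0 < arg E < π`.
Choosing `α` midway between `arg E` and `π` puts `Re w = arg E / α` strictly inside `(0, 1)`, while
`α < π` keeps the strip away from the pole `e^{iαw} = -1`. -/
theorem exists_stripMap_eq (hd : 0 < d) {z : ℂ} (hz : 0 < z.im) :
    ∃ (α : ℝ) (w : ℂ), 0 < α ∧ α < Real.pi ∧ w.re ∈ Ioo (0 : ℝ) 1 ∧ stripMap d α w = z := by
  have hdz : (d : ℂ) - z ≠ 0 := fun h => by
    have := congrArg Complex.im h
    simp at this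
    exact hz.ne' this
  set E : ℂ := (d + z) / (d - z) with hE
  have hEim : 0 < E.im := by
    have : E.im = 2 * d * z.im / normSq (d - z) := by
      rw [hE, div_im]
      simp
      ring
    rw [this]
    have := normSq_pos.mpr hdz
    positivity
  have hE0 : E ≠ 0 := fun h => by simp [h] at hEim
  have hθ0 : 0 < E.arg := by
    rcases (arg_nonneg_iff.mpr hEim.le).eq_or_lt with h | h
    · exact absurd (arg_eq_zero_iff.mp h.symm).2 hEim.ne'
    · exact h
  have hθπ : E.arg < Real.pi := arg_lt_pi_iff.mpr (.inr hEim.ne')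
  have hα0 : 0 < (E.arg + Real.pi) / 2 := by linarith
  refine ⟨(E.arg + Real.pi) / 2, -I * (log E / ((E.arg + Real.pi) / 2 : ℝ)), hα0, by linarith,
    ?_, ?_⟩
  · have : (-I * (log E / ((E.arg + Real.pi) / 2 : ℝ))).re = E.arg / ((E.arg + Real.pi) / 2) := by
      rw [neg_mul, neg_re, I_mul_re, neg_neg, div_ofReal_im, log_im]
    rw [this]
    exact ⟨by positivity, by rw [div_lt_one hα0]; linarith⟩
  · generalize (E.arg + Real.pi) / 2 = α at hα0
    have hαc : (α : ℂ) ≠ 0 := by exact_mod_cast hα0.ne'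
    have hdc : (d : ℂ) ≠ 0 := by exact_mod_cast hd.ne'
    have h3 : I * (α * (-I * (log E / α))) = log E := by
      field_simp
      linear_combination -log E * I_sq
    have h4 : E + 1 = 2 * d / (d - z) := by
      rw [hE]
      field_simp
      ring
    have h5 : E - 1 = 2 * z / (d - z) := by
      rw [hE]
      field_simp
      ring
    rw [stripMap, h3, exp_log hE0, h4, h5]
    field_simp

end stripMap

/-- A bounded holomorphic function on the upper half plane that vanishes on an interval of the
boundary vanishes identically. -/
theorem eq_zero_of_eq_zero_on_interval {A : ℂ → ℂ} {d M : ℝ} (hd : 0 < d)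
    (hc : ContinuousOn A {z | 0 ≤ z.im}) (hA : DifferentiableOn ℂ A {z | 0 < z.im})
    (hM : ∀ z, 0 ≤ z.im → ‖A z‖ ≤ M) (h0 : ∀ t : ℝ, |t| < d → A t = 0) {z : ℂ} (hz : 0 < z.im) :
    A z = 0 := by
  obtain ⟨α, w, hα, hαπ, hw, rfl⟩ := exists_stripMap_eq hd hz
  have hdc : DiffContOnCl ℂ (A ∘ stripMap d α) (HadamardThreeLines.verticalStrip 0 1) := by
    constructor
    · exact hA.comp (fun v hv => (differentiableAt_stripMap hα.le hαπ
        (Ioo_subset_Icc_self hv)).differentiableWithinAt) fun v hv => im_stripMap_pos hd hα hαπ hv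
    · rw [HadamardThreeLines.verticalStrip, closure_preimage_re, closure_Ioo zero_ne_one]
      exact hc.comp (fun v hv =>
        (differentiableAt_stripMap hα.le hαπ hv).continuousAt.continuousWithinAt)
        fun v hv => im_stripMap_nonneg hd.le hα.le hαπ hv
  -- The function is zero on the left line and at most `M` on the right one, so the interpolated
  -- bound is `0^(1 - Re w) * M^(Re w)`. It vanishes because `Re w < 1`.
  have := HadamardThreeLines.norm_le_interp_of_mem_verticalClosedStrip₀₁' (A ∘ stripMap d α)
    (z := w) (a := 0) (b := M) (Ioo_subset_Icc_self hw) hdc ?_ ?_ ?_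
  · rw [Real.zero_rpow (by linarith [hw.2]), zero_mul] at this
    exact norm_le_zero_iff.mp this
  · refine ⟨M, ?_⟩
    rintro _ ⟨v, hv, rfl⟩
    exact hM _ (im_stripMap_nonneg hd.le hα.le hαπ hv)
  · intro v hv
    obtain ⟨t, ht, hvt⟩ := stripMap_eq_ofReal (α := α) hd hv
    rw [Function.comp_apply, hvt, h0 t ht, norm_zero]
  · intro v hv
    have hv : v.re = 1 := hv
    exact hM _ (im_stripMap_nonneg hd.le hα.le hαπ (by rw [hv]; simp))

section halfLine

variable {w : ℝ → ℂ}

theorem continuousOn_entireHat_of_halfLine (hw : Integrable w) (hs : ∀ p, p ≤ 0 → w p = 0) :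
    ContinuousOn (entireHat w) {z | 0 ≤ z.im} := by
  refine ContinuousOn.mul continuousOn_const ?_
  refine continuousOn_of_dominated (bound := fun p => ‖w p‖) (fun z hz => ?_) (fun z hz => ?_) hw.norm
    (Eventually.of_forall fun p => by fun_prop)
  · exact hw.1.mul (by fun_prop : Continuous fun x : ℝ => cexp (I * z * x)).aestronglyMeasurable
  · refine Eventually.of_forall fun p => ?_
    have hz : 0 ≤ z.im := hz
    rcases le_or_gt p 0 with hp | hp
    · simp [hs p hp]
    · rw [norm_mul, norm_cexp_I_mul]
      exact mul_le_of_le_one_right (norm_nonneg _) (Real.exp_le_one_iff.mpr (by nlinarith))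

theorem differentiableOn_entireHat_of_halfLine (hw : Integrable w) (hs : ∀ p, p ≤ 0 → w p = 0) :
    DifferentiableOn ℂ (entireHat w) {z | 0 < z.im} := by
  intro z hz
  have hz : 0 < z.im := hz
  refine (differentiableAt_entireHat (half_pos hz) hw.1 ?_).differentiableWithinAt
  refine hw.norm.mono' (hw.1.norm.mul (by fun_prop : Continuous fun x : ℝ =>
      Real.exp (z.im / 2 * |x| - z.im * x)).aestronglyMeasurable) (Eventually.of_forall fun p => ?_)
  rcases le_or_gt p 0 with hp | hp
  · simp [hs p hp]
  · rw [norm_mul, norm_norm, Real.norm_of_nonneg (Real.exp_pos _).le]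
    refine mul_le_of_le_one_right (norm_nonneg _) (Real.exp_le_one_iff.mpr ?_)
    rw [abs_of_pos hp]
    nlinarith

/-- An integrable function on the half line whose Fourier transform vanishes on an interval
vanishes. -/
theorem ae_eq_zero_of_entireHat_eq_zero (hw : Integrable w) (hs : ∀ p, p ≤ 0 → w p = 0) {d : ℝ}
    (hd : 0 < d) (h : ∀ t : ℝ, |t| < d → entireHat w t = 0) : w =ᵐ[volume] 0 := by
  obtain ⟨C, -, hC⟩ := exists_norm_entireHat_le w hw
  have h1 : ∀ z : ℂ, 0 < z.im → entireHat w z = 0 := fun z hz =>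
    eq_zero_of_eq_zero_on_interval hd (continuousOn_entireHat_of_halfLine hw hs)
      (differentiableOn_entireHat_of_halfLine hw hs) (M := C * Real.exp 0) (fun z hz => hC z 0
        fun p hp => by
          have : 0 < p := not_le.mp fun h => hp (hs p h)
          nlinarith) h hz
  have hi : Integrable fun p : ℝ => w p * cexp (I * I * p) := by
    refine hw.norm.mono' (hw.1.mul (by fun_prop :
      Continuous fun x : ℝ => cexp (I * I * x)).aestronglyMeasurable) (Eventually.of_forall fun p => ?_)
    rcases le_or_gt p 0 with hp | hp
    · simp [hs p hp]
    · rw [norm_mul, norm_cexp_I_mul]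
      exact mul_le_of_le_one_right (norm_nonneg _) (Real.exp_le_one_iff.mpr (by simp [hp.le]))
  have h2 := ae_eq_zero_of_fourier_eq_zero hi fun x => by
    -- On the line `Im z = 1` the transform of `w` is the Fourier transform of `w e^{-p}`, so
    -- injectivity on `L¹` applies and the exponential factor is divided out.
    have h3 := h1 ((-(2 * Real.pi * x) : ℝ) + I) (by simp)
    rw [entireHat, mul_eq_zero, or_iff_right (by
      rw [ofReal_eq_zero]; positivity)] at h3
    rw [Real.fourier_real_eq_integral_exp_smul, ← h3]
    refine integral_congr_ae (Eventually.of_forall fun p => ?_)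
    simp only [smul_eq_mul]
    rw [mul_left_comm, ← Complex.exp_add]
    push_cast
    ring_nf
  filter_upwards [h2] with p hp
  exact (mul_eq_zero.mp hp).resolve_right (Complex.exp_ne_zero _)

end halfLine

/-! ### Cyclicity of the test vectors -/

theorem derivHat_linearCombination {f g : ℝ → ℝ} (hf : ContDiff ℝ (⊤ : ℕ∞) f)
    (hfs : HasCompactSupport f) (hg : ContDiff ℝ (⊤ : ℕ∞) g) (hgs : HasCompactSupport g)
    (x y p : ℝ) :
    derivHat (fun t => x * f t + y * g t) p = x * derivHat f p + y * derivHat g p := by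
  have hi : ∀ {h : ℝ → ℝ}, ContDiff ℝ (⊤ : ℕ∞) h → HasCompactSupport h →
      Integrable fun t : ℝ => ((deriv h t : ℝ) : ℂ) * cexp (I * p * t) := fun hh hs =>
    (integrable_ofReal_test (hh.continuous_deriv (by simp)) hs.deriv).mul_bdd (c := 1)
      (by fun_prop : Continuous fun x : ℝ => cexp (I * p * x)).aestronglyMeasurable
      (Eventually.of_forall fun x => by rw [norm_cexp_I_mul]; simp)
  rw [derivHat, derivHat, derivHat, fourierHat, fourierHat, fourierHat, mul_left_comm (x : ℂ),
    mul_left_comm (y : ℂ), ← mul_add, ← integral_const_mul (x : ℂ),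
    ← integral_const_mul (y : ℂ), ← integral_add ((hi hf hfs).const_mul _) ((hi hg hgs).const_mul _)]
  congr 1
  refine integral_congr_ae (Eventually.of_forall fun t => ?_)
  have h1 : deriv (fun t => x * f t + y * g t) t = x * deriv f t + y * deriv g t :=
    ((((hf.differentiable (by simp)) t).hasDerivAt.const_mul x).add
      (((hg.differentiable (by simp)) t).hasDerivAt.const_mul y)).deriv
  simp only [h1]
  push_cast
  ring

theorem linearCombination_mem_testVectors {a b : ℝ} {ψ χ : Hilb} (hψ : ψ ∈ testVectors a b)
    (hχ : χ ∈ testVectors a b) (x y : ℝ) : (x : ℂ) • ψ + (y : ℂ) • χ ∈ testVectors a b := by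
  obtain ⟨f, hf, hfs, hfU, hfψ⟩ := hψ
  obtain ⟨g, hg, hgs, hgU, hgχ⟩ := hχ
  have h1 : HasCompactSupport fun t => x * f t := hfs.mul_left
  have h2 : HasCompactSupport fun t => y * g t := hgs.mul_left
  refine ⟨fun t => x * f t + y * g t, (contDiff_const.mul hf).add (contDiff_const.mul hg),
    h1.add h2, ?_, ?_⟩
  · refine (tsupport_add (fun t => x * f t) fun t => y * g t).trans (union_subset ?_ ?_)
    · exact (tsupport_mul_subset_right (f := fun _ => x) (g := f)).trans hfU
    · exact (tsupport_mul_subset_right (f := fun _ => y) (g := g)).trans hgU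
  · filter_upwards [hfψ, hgχ, Lp.coeFn_add ((x : ℂ) • ψ) ((y : ℂ) • χ),
      Lp.coeFn_smul (x : ℂ) ψ, Lp.coeFn_smul (y : ℂ) χ] with p h1 h2 h3 h4 h5
    rw [h3, Pi.add_apply, h4, h5, Pi.smul_apply, Pi.smul_apply, h1, h2,
      derivHat_linearCombination hf hfs hg hgs, smul_eq_mul, smul_eq_mul]

theorem zero_mem_testVectors (a b : ℝ) : (0 : Hilb) ∈ testVectors a b := by
  refine ⟨fun _ => 0, contDiff_const, HasCompactSupport.zero, by simp [tsupport], ?_⟩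
  refine (Lp.coeFn_zero ℂ 2 halfLineMeasure).trans (Eventually.of_forall fun p => ?_)
  simp [derivHat, fourierHat]

/-- The complex span of the test vectors. -/
def testSubmodule (a b : ℝ) : Submodule ℂ Hilb where
  carrier := {x | ∃ ξ ∈ testVectors a b, ∃ η ∈ testVectors a b, x = ξ + I • η}
  zero_mem' := ⟨0, zero_mem_testVectors a b, 0, zero_mem_testVectors a b, by simp⟩
  add_mem' := by
    rintro _ _ ⟨ξ, hξ, η, hη, rfl⟩ ⟨ξ', hξ', η', hη', rfl⟩
    refine ⟨_, linearCombination_mem_testVectors hξ hξ' 1 1, _,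
      linearCombination_mem_testVectors hη hη' 1 1, ?_⟩
    push_cast
    module
  smul_mem' := by
    rintro c _ ⟨ξ, hξ, η, hη, rfl⟩
    refine ⟨_, linearCombination_mem_testVectors hξ hη c.re (-c.im), _,
      linearCombination_mem_testVectors hξ hη c.im c.re, ?_⟩
    conv_lhs => rw [← re_add_im c]
    have h : (I * I : ℂ) • ((c.im : ℂ) • η) = -((c.im : ℂ) • η) := by
      rw [I_mul_I, neg_one_smul]
    push_cast
    rw [← sub_eq_zero] at h ⊢
    rw [← h]
    module

/-- The transform is analytic, and nonzero at the origin because `f` has nonzero mean, so its real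
zeros form a discrete and hence null set. -/
theorem ae_entireHat_neg_ne_zero {f : ℝ → ℝ} (hf : Continuous f) (hs : HasCompactSupport f)
    (h0 : ∫ x, f x ≠ 0) : ∀ᵐ p : ℝ, entireHat (fun x => (f x : ℂ)) (-p) ≠ 0 := by
  have hd := differentiable_entireHat_test hf hs
  have ha : AnalyticOnNhd ℝ (fun p : ℝ => entireHat (fun x => (f x : ℂ)) (-p)) univ := fun p _ => by
    have h1 : AnalyticAt ℂ (fun z => entireHat (fun x => (f x : ℂ)) (-z)) (p : ℂ) :=
      (hd.comp differentiable_neg).analyticAt _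
    exact (h1.restrictScalars (𝕜 := ℝ)).comp (ofRealCLM.analyticAt p)
  have h1 := ha.preimage_zero_mem_codiscrete (x := 0) (by
    rw [ofReal_zero, neg_zero, entireHat]
    simp only [mul_zero, zero_mul, Complex.exp_zero, mul_one]
    have h1 : ∫ x, (f x : ℂ) = ((∫ x, f x : ℝ) : ℂ) := integral_ofReal
    rw [h1]
    have : (0 : ℝ) < (Real.sqrt (2 * Real.pi))⁻¹ := by positivity
    exact mul_ne_zero (by exact_mod_cast this.ne') (by exact_mod_cast h0))
  have h2 := ae_restrict_le_codiscreteWithin (μ := volume) (U := (univ : Set ℝ)) MeasurableSet.univ h1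
  rw [Measure.restrict_univ] at h2
  exact h2

theorem eq_zero_of_inner_testVector {a b : ℝ} (hab : a < b) {ψ : Hilb}
    (h : ∀ (f : ℝ → ℝ) (hf : ContDiff ℝ (⊤ : ℕ∞) f) (hs : HasCompactSupport f),
      tsupport f ⊆ Ioo a b → ⟪testVector f hf hs, ψ⟫_ℂ = 0) : ψ = 0 := by
  -- The bump lives within `(b-a)/4` of the midpoint, so translates by `|t| < (b-a)/4` stay inside
  -- `(a, b)`.
  let B : ContDiffBump ((a + b) / 2) := ⟨(b - a) / 8, (b - a) / 4, by linarith, by linarith⟩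
  have hBsupp : ∀ x, B x ≠ 0 → |x - (a + b) / 2| < (b - a) / 4 := fun x hx => by
    have : x ∈ Function.support B := hx
    rwa [B.support_eq, Metric.mem_ball, Real.dist_eq] at this
  set f : ℝ → ℝ := fun x => B x with hf
  have hfc : ContDiff ℝ (⊤ : ℕ∞) f := B.contDiff
  have hfs : HasCompactSupport f := B.hasCompactSupport
  -- Translating `f` by `-t` multiplies `f̌(p)` by `e^{itp}`. Orthogonality to all these translates
  -- therefore says that the transform of `w` vanishes for `|t| < (b-a)/4`.
  set w : ℝ → ℂ := (Ioi 0).indicator fun p : ℝ =>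
    schwartzCheck (testSchwartz f hfc hfs) p * skewExt ψ p with hw
  have hwi : Integrable w := (integrable_schwartz_mul_skewExt _ ψ).indicator measurableSet_Ioi
  have hw0 : w =ᵐ[volume] 0 := by
    refine ae_eq_zero_of_entireHat_eq_zero hwi (fun p hp => indicator_of_notMem (not_lt.mpr hp) _)
      (d := (b - a) / 4) (by linarith) fun t ht => ?_
    have hsupp : Function.support (fun x => f (x - -t)) ⊆
        Icc ((a + b) / 2 - t - (b - a) / 4) ((a + b) / 2 - t + (b - a) / 4) := fun x hx => by
      have := abs_lt.mp (hBsupp _ hx)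
      constructor <;> linarith [this.1, this.2]
    have hgc : ContDiff ℝ (⊤ : ℕ∞) fun x => f (x - -t) := hfc.comp (contDiff_id.sub contDiff_const)
    have hgs : HasCompactSupport fun x => f (x - -t) :=
      HasCompactSupport.of_support_subset_isCompact isCompact_Icc hsupp
    have h1 := h _ hgc hgs ((closure_minimal hsupp isClosed_Icc).trans fun x hx => by
      have := abs_lt.mp ht
      constructor <;> linarith [hx.1, hx.2, this.1, this.2])
    rw [inner_testVector, mul_eq_zero, or_iff_right I_ne_zero] at h1
    rw [entireHat, mul_eq_zero]
    right
    rw [← h1, ← integral_indicator measurableSet_Ioi]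
    refine integral_congr_ae (Eventually.of_forall fun p => ?_)
    simp only [hw]
    by_cases hp : p ∈ Ioi (0 : ℝ)
    · rw [indicator_of_mem hp, indicator_of_mem hp, schwartzCheck_testSchwartz,
        schwartzCheck_testSchwartz, entireHat_translate (fun x => (f x : ℂ))]
      push_cast
      ring_nf
    · rw [indicator_of_notMem hp, indicator_of_notMem hp, zero_mul]
  have hne := ae_entireHat_neg_ne_zero hfc.continuous hfs (B.integral_pos (μ := volume)).ne'
  rw [Lp.eq_zero_iff_ae_eq_zero]
  change ∀ᵐ p ∂halfLineMeasure, ψ p = 0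
  rw [ae_halfLine_iff]
  filter_upwards [hw0, hne] with p h1 h2 hp
  rw [hw, indicator_of_mem (show p ∈ Ioi (0 : ℝ) from hp), schwartzCheck_testSchwartz, skewExt,
    if_neg hp.not_gt] at h1
  exact (mul_eq_zero.mp h1).resolve_left h2

theorem isCyclic_testVectors {a b : ℝ} (hab : a < b) : IsCyclic (testVectors a b) := by
  change Dense (testSubmodule a b : Set Hilb)
  rw [Submodule.dense_iff_topologicalClosure_eq_top, Submodule.topologicalClosure_eq_top_iff,
    Submodule.eq_bot_iff]
  intro ψ hψ
  refine eq_zero_of_inner_testVector hab fun f hf hs hU => ?_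
  exact (Submodule.mem_orthogonal _ _).mp hψ _ ⟨_, ⟨f, hf, hs, hU, coeFn_testVector hf hs⟩, 0,
    zero_mem_testVectors a b, by simp⟩

end LightRay

end

theorem mainTheorem10 :
    (∀ r : ℝ, 0 < r → ∀ ψ : LightRay.Hilb,
      List.TFAE [
        ψ ∈ LightRay.localSubspace (-r) r,
        Distribution.dsupport (LightRay.invFourier (LightRay.skewDistribution ψ)) ⊆ Icc (-r) r,
        ∃ F : ℂ → ℂ, LightRay.IsSymmetricEntireExtension ψ F ∧
          ∃ C : ℝ, 0 < C ∧ ∀ p : ℂ, ‖F p‖ ≤ C * ‖p‖ * Real.exp (r * |p.im|),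
        ∃ F : ℂ → ℂ, LightRay.IsSymmetricEntireExtension ψ F ∧
          ∀ ε : ℝ, 0 < ε → ∃ C : ℝ, 0 < C ∧
            ∀ p : ℂ, ‖F p‖ ≤ C * Real.exp ((r + ε) * ‖p‖)]) ∧
    (∀ a b : ℝ, a < b →
      (∀ ψ ∈ LightRay.localSubspace a b, ∃ f : ℝ → ℝ, MemLp f 2 volume ∧
        (∀ x, x ∉ Icc a b → f x = 0) ∧
        ∀ᵐ p : ℝ ∂LightRay.halfLineMeasure,
          -I * ψ p / p = LightRay.fourierHat (fun x => (f x : ℂ)) p) ∧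
      (∀ f : ℝ → ℝ, ContDiff ℝ (⊤ : ℕ∞) f → HasCompactSupport f → tsupport f ⊆ Ioo a b →
        MemLp (LightRay.derivHat f) 2 LightRay.halfLineMeasure) ∧
      LightRay.testVectors a b ⊆ LightRay.localSubspace a b ∧
      LightRay.IsCyclic (LightRay.testVectors a b)) := by
  exact ⟨fun r hr ψ => LightRay.tfae_mem_localSubspace hr ψ, fun a b hab =>
    ⟨fun ψ hψ => LightRay.exists_real_of_mem_localSubspace hab hψ,
      fun f hf hs _ => LightRay.memLp_derivHat hf hs,
      LightRay.testVectors_subset_localSubspace a b,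
      LightRay.isCyclic_testVectors hab⟩⟩
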